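/- A \emph{run} of a finite sequence of distinct real numbers is a maximal nonempty contiguous subsequence that is increasing or decreasing. For $k\ge 3$, a \emph{$k$-rollercoaster} is a finite sequence in which every run has at least $k$ elements (the empty sequence is one). Consider comparison-based random access machine programs: finite programs, built from assignments, conditionals and while-loops, on variables and arrays of machine words, with unit-cost operations (addition, truncated subtraction and multiplication of words, comparison of words, indexed reading and writing of array cells); the input is $n$, $k$ and a sequence $S[1:n]$, whose entries are accessible only through unit-cost comparisons "$S[i]<S[j]$?" for computed positions $i,j$. \textbf{Theorem.} There are one such program and absolute constants $c, C$ such that for every $k\ge 3$, every $n\ge 0$ and every sequence $S[1:n]$ of distinct real numbers, the program, using only machine words less than $(n+k+2)^{c}$ (that is, words of $O(\log(n+k))$ bits), halts after at most $C\max(n,1)\,k^2$ steps and outputs the length of a longest (not necessarily contiguous) subsequence of $S$ that is a $k$-rollercoaster. Thus this length is computed in $O(nk^2)$ time by a comparison-based algorithm. In particular, for every fixed $k\ge3$ (e.g. for ordinary rollercoasters, $k=3$), there is a constant $D$, depending only on $k$, such that the program halts after at most $D\max(n,1)$ steps for all $n$ and $S$, i.e. in linear time. -/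

import Mathlib

namespace Rollercoaster

/-! ### Runs and `k`-rollercoasters -/

/-- The contiguous block `a p, …, a q` of the finite sequence `a` is increasing or decreasing.
A block of a single element is both. -/
def IsMonotoneBlock {m : ℕ} (a : Fin m → ℝ) (p q : Fin m) : Prop :=
  p ≤ q ∧ (StrictMonoOn a (Set.Icc p q) ∨ StrictAntiOn a (Set.Icc p q))

/-- A run: a (nonempty) contiguous block that is increasing or decreasing, maximal under inclusion. -/
def IsRun {m : ℕ} (a : Fin m → ℝ) (p q : Fin m) : Prop :=
  IsMonotoneBlock a p q ∧
    ∀ p' q' : Fin m, p' ≤ p → q ≤ q' → IsMonotoneBlock a p' q' → p' = p ∧ q' = q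

/-- A `k`-rollercoaster: every run has length (number of elements) at least `k`.
The empty sequence has no run, hence is a `k`-rollercoaster. -/
def IsRollercoaster (k : ℕ) {m : ℕ} (a : Fin m → ℝ) : Prop :=
  ∀ p q : Fin m, IsRun a p q → k ≤ ((q : ℕ) - (p : ℕ)) + 1

/-- `r` is the length of a longest (not necessarily contiguous) subsequence of `S` that is a
`k`-rollercoaster. -/
def IsLongestLength (k : ℕ) {n : ℕ} (S : Fin n → ℝ) (r : ℕ) : Prop :=
  IsGreatest {m : ℕ | ∃ e : Fin m → Fin n, StrictMono e ∧ IsRollercoaster k (S ∘ e)} r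

/-! ### Comparison-based random access machine programs

Programs manipulate machine words (natural numbers less than a word bound `W`), which are held in
variables and in arrays.  The names of the variables and arrays are numerals in the program text,
so that a program uses only finitely many of them; array indices are computed at run time.
The input keys `S 0, …, S (n - 1)` cannot be read, copied or altered: the only access to them is
the test `key i j`, which decides whether `S i < S j`. -/

/-- Integer expressions. -/
inductive Expr : Type
  | const (c : ℕ)
  | var (x : ℕ)
  | get (a : ℕ) (i : Expr)
  | add (e f : Expr)
  | sub (e f : Expr)
  | mul (e f : Expr)

/-- Tests: integer comparison, comparison of two input keys, and Boolean combinations. -/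
inductive Test : Type
  | lt (e f : Expr)
  | key (e f : Expr)
  | not (b : Test)
  | and (b d : Test)

/-- Programs. -/
inductive Cmd : Type
  | skip
  | assign (x : ℕ) (e : Expr)
  | put (a : ℕ) (i e : Expr)
  | seq (P Q : Cmd)
  | ite (b : Test) (P Q : Cmd)
  | loop (b : Test) (P : Cmd)

/-- Memory contents: the value of each variable and of each array cell. -/
structure State : Type where
  var : ℕ → ℕ
  arr : ℕ → ℕ → ℕ

/-- The value of an expression; subtraction is truncated at `0`. -/
def Expr.eval (σ : State) : Expr → ℕ
  | .const c => c
  | .var x => σ.var x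
  | .get a i => σ.arr a (i.eval σ)
  | .add e f => e.eval σ + f.eval σ
  | .sub e f => e.eval σ - f.eval σ
  | .mul e f => e.eval σ * f.eval σ

/-- All values (in particular all array indices) that occur when an expression is evaluated are
machine words, that is, less than `W`. -/
def Expr.Fits (W : ℕ) (σ : State) : Expr → Prop
  | .const c => c < W
  | .var x => σ.var x < W
  | .get a i => i.Fits W σ ∧ σ.arr a (i.eval σ) < W
  | .add e f => e.Fits W σ ∧ f.Fits W σ ∧ e.eval σ + f.eval σ < W
  | .sub e f => e.Fits W σ ∧ f.Fits W σ
  | .mul e f => e.Fits W σ ∧ f.Fits W σ ∧ e.eval σ * f.eval σ < W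

/-- The time to evaluate an expression: one unit for every operation, constant, and variable or
array access. -/
def Expr.cost : Expr → ℕ
  | .const _ => 1
  | .var _ => 1
  | .get _ i => i.cost + 1
  | .add e f => e.cost + f.cost + 1
  | .sub e f => e.cost + f.cost + 1
  | .mul e f => e.cost + f.cost + 1

/-- The truth value of a test. -/
def Test.Holds {n : ℕ} (S : Fin n → ℝ) (σ : State) : Test → Prop
  | .lt e f => e.eval σ < f.eval σ
  | .key e f => ∃ (i : e.eval σ < n) (j : f.eval σ < n), S ⟨e.eval σ, i⟩ < S ⟨f.eval σ, j⟩
  | .not b => ¬ b.Holds S σ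
  | .and b d => b.Holds S σ ∧ d.Holds S σ

/-- A test can be evaluated without a fault: all values are machine words, and input keys are
compared only at positions less than `n`.  In a conjunction the second test is evaluated only if
the first one holds. -/
def Test.Safe {n : ℕ} (S : Fin n → ℝ) (W : ℕ) (σ : State) : Test → Prop
  | .lt e f => e.Fits W σ ∧ f.Fits W σ
  | .key e f => (e.Fits W σ ∧ e.eval σ < n) ∧ (f.Fits W σ ∧ f.eval σ < n)
  | .not b => b.Safe S W σ
  | .and b d => b.Safe S W σ ∧ (b.Holds S σ → d.Safe S W σ)

/-- The time charged for a test. -/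
def Test.cost : Test → ℕ
  | .lt e f => e.cost + f.cost + 1
  | .key e f => e.cost + f.cost + 1
  | .not b => b.cost + 1
  | .and b d => b.cost + d.cost + 1

/-- Write a value to a variable. -/
def State.setVar (σ : State) (x v : ℕ) : State :=
  { σ with var := Function.update σ.var x v }

/-- Write a value to an array cell. -/
def State.setArr (σ : State) (a i v : ℕ) : State :=
  { σ with arr := Function.update σ.arr a (Function.update (σ.arr a) i v) }

/-- `Exec S W P σ τ t`: on a machine with word bound `W` and input keys `S`, the program `P` started
in the memory state `σ` halts without a fault in the state `τ` after exactly `t` units of time. -/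
inductive Exec {n : ℕ} (S : Fin n → ℝ) (W : ℕ) : Cmd → State → State → ℕ → Prop
  | skip (σ : State) : Exec S W .skip σ σ 1
  | assign (x : ℕ) (e : Expr) (σ : State) (he : e.Fits W σ) :
      Exec S W (.assign x e) σ (σ.setVar x (e.eval σ)) (e.cost + 1)
  | put (a : ℕ) (i e : Expr) (σ : State) (hi : i.Fits W σ) (he : e.Fits W σ) :
      Exec S W (.put a i e) σ (σ.setArr a (i.eval σ) (e.eval σ)) (i.cost + e.cost + 1)
  | seq {P Q : Cmd} {σ τ υ : State} {s t : ℕ} (hP : Exec S W P σ τ s) (hQ : Exec S W Q τ υ t) :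
      Exec S W (.seq P Q) σ υ (s + t)
  | ite_true {b : Test} {P Q : Cmd} {σ τ : State} {t : ℕ} (hs : b.Safe S W σ)
      (hb : b.Holds S σ) (hP : Exec S W P σ τ t) : Exec S W (.ite b P Q) σ τ (b.cost + t)
  | ite_false {b : Test} {P Q : Cmd} {σ τ : State} {t : ℕ} (hs : b.Safe S W σ)
      (hb : ¬ b.Holds S σ) (hQ : Exec S W Q σ τ t) : Exec S W (.ite b P Q) σ τ (b.cost + t)
  | loop_true {b : Test} {P : Cmd} {σ τ υ : State} {s t : ℕ} (hs : b.Safe S W σ)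
      (hb : b.Holds S σ) (hP : Exec S W P σ τ s) (hL : Exec S W (.loop b P) τ υ t) :
      Exec S W (.loop b P) σ υ (b.cost + s + t)
  | loop_false {b : Test} {P : Cmd} {σ : State} (hs : b.Safe S W σ) (hb : ¬ b.Holds S σ) :
      Exec S W (.loop b P) σ σ b.cost

/-- The initial memory: variable `0` holds `n`, variable `1` holds `k`, everything else is `0`. -/
def initState (n k : ℕ) : State where
  var := fun x => if x = 0 then n else if x = 1 then k else 0
  arr := fun _ _ => 0

/-- On the input `n`, `k`, `S[1:n]`, the program `P`, run on a machine whose words are the numbers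
less than `(n + k + 2) ^ c` (words of `O(log (n + k))` bits), halts without a fault within
`T` units of time, and then variable `0` holds the length of a longest `k`-rollercoaster in `S`. -/
def ComputesWithin (P : Cmd) (c k : ℕ) {n : ℕ} (S : Fin n → ℝ) (T : ℕ) : Prop :=
  ∃ (τ : State) (t : ℕ), Exec S ((n + k + 2) ^ c) P (initState n k) τ t ∧
    IsLongestLength k S (τ.var 0) ∧ t ≤ T

end Rollercoaster

/-! Build a subsequence from left to right and remember only its last position, its length
("value"), the direction of its last run and the number of elements of that run, capped at `k` (its
"level"). `Reach` generates these states. Rollercoasters of length `v ≥ 1` correspond to reachable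
states of level `k` ("full" states) of value `v`: see `Reach.isRollercoaster` and
`IsRollercoaster.exists_reach`. It therefore suffices to maintain, for each direction `d`, the
largest full value `L d` and, for every relevant `v`, an endpoint `F d v` of lowest key among full
states of value at least `v`.

Partial runs are kept in a patience row. One row serves all starting values: the items with label at
least `w` play the role of the patience row for climbs started with value at least `w`, so counting
those below a key gives the length of such a climb. A new label is at least as large as all older
ones, so for every `w` up to it an insertion must delete the first item of that sub-row above the
new key. A single min/max pass over the labels does this for all `w` simultaneously
(`count_displace`).

Rows stay short because small values can be forgotten. Put `base d = min (L (!d)) (L d - k)`.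
Extending a state of value at most `L (!d)` gives no more than a fresh start at the same position;
the fresh start has level 1 only, but if the old value is also at most `L d - k`, it becomes full
before the extended state can improve on `L d`. Hence low labels may be dropped and `3 * k` items
suffice (`Inv.trim`). `Probe.insert` shows that treating one position preserves soundness and
completeness of the data.

Row operations cost `O(k)` per position, and choosing the best label of a climb with `k - 1`
elements costs `O(k ^ 2)`. Extending a full state requires the largest `w` with `F d w` below the
new key. This is a linear scan, started at a finger stored in the first item of the opposite row
beyond the new position: that item has a lower key in direction `d`, so its old scan result is still
valid. A potential charging each item for the gap between its finger and the current maximum pays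
for the scan (`Probe.potential_insert_le`, `Inv.potential_trim_le`). It grows by `O(k)` per position
and per unit of growth of `L`, and each `L d` stays at most `n`.

The rest verifies a concrete program by weakest preconditions (`Runs`):
`Ready.runs_advance_amortized` treats one position, and `exists_runs_longest` sums the costs. -/

namespace Rollercoaster

/-! ### Subsequences as reachable states, and their equivalence with rollercoasters -/

/-- The key of position `i` in direction `d`: increasing (`true`) or decreasing (`false`). -/
noncomputable def key {n : ℕ} (S : Fin n → ℝ) (d : Bool) (i : ℕ) : ℝ :=
  if h : i < n then (if d then S ⟨i, h⟩ else -S ⟨i, h⟩) else 0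

/-- `Reach n k T d j x v`: some subsequence of length `v` ends at position `x` with a partial last
run in direction `d` having at least `j` elements, and all its other runs are complete. -/
inductive Reach (n k : ℕ) (T : Bool → ℕ → ℝ) : Bool → ℕ → ℕ → ℕ → Prop
  | start (d : Bool) {x : ℕ} (hx : x < n) : Reach n k T d 1 x 1
  | turnAt {d : Bool} {x v : ℕ} (h : Reach n k T (!d) k x v) : Reach n k T d 1 x v
  | turnAfter {d : Bool} {y x v : ℕ} (hyx : y < x) (hx : x < n) (h : Reach n k T (!d) k y v) :
      Reach n k T d 1 x (v + 1)
  | step {d : Bool} {j y x v : ℕ} (hyx : y < x) (hx : x < n) (hT : T d y < T d x)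
      (h : Reach n k T d j y v) : Reach n k T d (min (j + 1) k) x (v + 1)

section Reach

variable {n k : ℕ} {T : Bool → ℕ → ℝ}

theorem Reach.lt {d : Bool} {j x v : ℕ} (h : Reach n k T d j x v) : x < n := by
  induction h <;> assumption

theorem Reach.pos {d : Bool} {j x v : ℕ} (h : Reach n k T d j x v) : 1 ≤ v := by
  induction h <;> omega

theorem Reach.le {d : Bool} {j x v : ℕ} (h : Reach n k T d j x v) : v ≤ x + 1 := by
  induction h <;> omega

end Reach

/-- The block `[p, q]` of the sequence `e` of positions is monotone in direction `c`. -/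
def Climbs (T : Bool → ℕ → ℝ) (e : ℕ → ℕ) (c : Bool) (p q : ℕ) : Prop :=
  ∀ l, p ≤ l → l < q → T c (e l) < T c (e (l + 1))

/-- The pair `i, i + 1` lies in a monotone block of at least `k` of the first `m` elements. -/
def Covered (k : ℕ) (T : Bool → ℕ → ℝ) (e : ℕ → ℕ) (m i : ℕ) : Prop :=
  ∃ p q c, p ≤ i ∧ i + 1 ≤ q ∧ q < m ∧ k ≤ q + 1 - p ∧ Climbs T e c p q

theorem Climbs.congr {T : Bool → ℕ → ℝ} {e e' : ℕ → ℕ} {c : Bool} {p q : ℕ}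
    (h : Climbs T e c p q) (he : ∀ l, l ≤ q → e' l = e l) : Climbs T e' c p q := by
  intro l hl hq
  rw [he l (by omega), he (l + 1) (by omega)]
  exact h l hl hq

theorem Covered.congr {k : ℕ} {T : Bool → ℕ → ℝ} {e e' : ℕ → ℕ} {m m' i : ℕ}
    (h : Covered k T e m i) (hm : m ≤ m') (he : ∀ l, l < m → e' l = e l) :
    Covered k T e' m' i := by
  obtain ⟨p, q, c, h1, h2, h3, h4, h5⟩ := h
  exact ⟨p, q, c, h1, h2, by omega, h4, h5.congr fun l hl => he l (by omega)⟩

theorem Climbs.snoc {T : Bool → ℕ → ℝ} {e e' : ℕ → ℕ} {c : Bool} {p q x : ℕ}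
    (h : Climbs T e c p q) (he : ∀ l, l ≤ q → e' l = e l) (hx : e' (q + 1) = x)
    (hT : T c (e q) < T c x) : Climbs T e' c p (q + 1) := by
  intro l hl hq
  rcases Nat.lt_or_ge l q with h' | h'
  · exact h.congr he l hl h'
  · obtain rfl : l = q := by omega
    rw [he l le_rfl, hx]
    exact hT

/-- A subsequence witnessing `Reach`. -/
structure Witness (n k : ℕ) (T : Bool → ℕ → ℝ) (e : ℕ → ℕ) (d : Bool) (j x v : ℕ) : Prop where
  pos : 1 ≤ v
  mono : ∀ i, i + 1 < v → e i < e (i + 1)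
  last : e (v - 1) = x
  lt : x < n
  tail : ∃ r, j ≤ r ∧ 1 ≤ r ∧ r ≤ v ∧ Climbs T e d (v - r) (v - 1) ∧
    ∀ i, i + 1 + r ≤ v → Covered k T e v i

/-- At level `k` the last climb is itself a block of at least `k` elements, so it covers the pairs
that were still open. -/
theorem Witness.covered {n k : ℕ} {T : Bool → ℕ → ℝ} {e : ℕ → ℕ} {d : Bool} {x v : ℕ}
    (h : Witness n k T e d k x v) {i : ℕ} (hi : i + 1 < v) : Covered k T e v i := by
  obtain ⟨r, h1, h2, h3, h4, h5⟩ := h.tail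
  by_cases hc : i + 1 + r ≤ v
  · exact h5 i hc
  · exact ⟨v - r, v - 1, d, by omega, by omega, by omega, by omega, h4⟩

/-- Each rule of `Reach` either keeps the subsequence or appends `x` in slot `v`; what needs care is
which block covers the newly created pair. -/
theorem Reach.exists_witness {n k : ℕ} {T : Bool → ℕ → ℝ}
    (hneg : ∀ d x, T (!d) x = -T d x) (hne : ∀ d x y, x < y → y < n → T d x ≠ T d y)
    {d : Bool} {j x v : ℕ} (h : Reach n k T d j x v) : ∃ e, Witness n k T e d j x v := by
  induction h with
  | start d hx =>
    rename_i x
    exact ⟨fun _ => x, le_rfl, fun i hi => by omega, rfl, hx, 1, le_rfl, le_rfl, le_rfl,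
      fun l hl hq => by omega, fun i hi => by omega⟩
  | @turnAt d x v h ih =>
    obtain ⟨e, he⟩ := ih
    exact ⟨e, he.pos, he.mono, he.last, he.lt, 1, le_rfl, le_rfl, he.pos,
      fun l hl hq => by omega, fun i hi => he.covered (by omega)⟩
  | @turnAfter d y x v hyx hx h ih =>
    obtain ⟨e, he⟩ := ih
    have hp := he.pos
    have hu : ∀ l, l < v → Function.update e v x l = e l := fun l hl =>
      Function.update_of_ne (by omega) _ _
    have huv : Function.update e v x v = x := Function.update_self ..
    refine ⟨Function.update e v x, by omega, ?_, by simp, hx, ?_⟩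
    · intro i hi
      rcases Nat.lt_or_ge (i + 1) v with h' | h'
      · rw [hu i (by omega), hu _ h']; exact he.mono i h'
      · obtain rfl : v = i + 1 := by omega
        rw [huv, hu i (by omega)]
        have := he.last
        simp only [Nat.add_sub_cancel] at this
        omega
    · have hcov : ∀ i, i + 1 < v → Covered k T (Function.update e v x) (v + 1) i := fun i hi =>
        (he.covered hi).congr (by omega) hu
      -- The rule `turnAfter` does not prescribe how the keys compare. If the key rises in direction
      -- `d`, the last pair is already a climb of two elements; otherwise the pair prolongs the
      -- completed run of direction `!d`.
      rcases lt_or_gt_of_ne (hne d y x hyx hx) with hlt | hgt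
      · refine ⟨2, by omega, by omega, by omega, ?_, fun i hi => hcov i (by omega)⟩
        intro l hl hq
        obtain rfl : l = v - 1 := by omega
        rw [hu _ (by omega), Nat.sub_add_cancel hp, huv, he.last]
        exact hlt
      · refine ⟨1, by omega, by omega, by omega, fun l hl hq => by omega, ?_⟩
        intro i hi
        rcases Nat.lt_or_ge (i + 1) v with h' | h'
        · exact hcov i h'
        · obtain ⟨r, h1, h2, h3, h4, h5⟩ := he.tail
          refine ⟨v - r, v - 1 + 1, !d, by omega, by omega, by omega, by omega, ?_⟩
          refine h4.snoc (fun l hl => hu l (by omega)) ?_ ?_ (x := x)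
          · rw [Nat.sub_add_cancel hp, huv]
          · rw [he.last, hneg, hneg]; exact neg_lt_neg hgt
  | @step d j y x v hyx hx hT h ih =>
    obtain ⟨e, he⟩ := ih
    have hp := he.pos
    have hu : ∀ l, l < v → Function.update e v x l = e l := fun l hl =>
      Function.update_of_ne (by omega) _ _
    have huv : Function.update e v x v = x := Function.update_self ..
    refine ⟨Function.update e v x, by omega, ?_, by simp, hx, ?_⟩
    · intro i hi
      rcases Nat.lt_or_ge (i + 1) v with h' | h'
      · rw [hu i (by omega), hu _ h']; exact he.mono i h'
      · obtain rfl : v = i + 1 := by omega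
        rw [huv, hu i (by omega)]
        have := he.last
        simp only [Nat.add_sub_cancel] at this
        omega
    · obtain ⟨r, h1, h2, h3, h4, h5⟩ := he.tail
      refine ⟨r + 1, by omega, by omega, by omega, ?_, fun i hi =>
        (h5 i (by omega)).congr (by omega) hu⟩
      have := h4.snoc (e' := Function.update e v x) (x := x) (fun l hl => hu l (by omega))
        (by rw [Nat.sub_add_cancel hp, huv]) (by rw [he.last]; exact hT)
      rw [Nat.sub_add_cancel hp] at this
      simpa using this

section key

variable {n : ℕ} {S : Fin n → ℝ}

theorem key_not (d : Bool) (x : ℕ) : key S (!d) x = -key S d x := by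
  unfold key
  cases d <;> split <;> simp

theorem key_ne (hS : Function.Injective S) (d : Bool) {x y : ℕ} (hxy : x < y) (hy : y < n) :
    key S d x ≠ key S d y := by
  have hx : x < n := by omega
  have : S ⟨x, hx⟩ ≠ S ⟨y, hy⟩ := fun h => by
    have := hS h
    simp at this
    omega
  unfold key
  cases d <;> simpa [hx, hy] using this

theorem strictMonoOn_Icc_iff {m : ℕ} (a : Fin m → ℝ) (p q : Fin m) :
    StrictMonoOn a (Set.Icc p q) ↔
      ∀ l (h : l + 1 < m), (p : ℕ) ≤ l → l < q → a ⟨l, by omega⟩ < a ⟨l + 1, h⟩ := by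
  constructor
  · intro h l hl h1 h2
    refine h (Set.mem_Icc.2 ⟨Fin.le_def.2 h1, Fin.le_def.2 h2.le⟩)
      (Set.mem_Icc.2 ⟨Fin.le_def.2 ?_, Fin.le_def.2 h2⟩) (Fin.lt_def.2 (Nat.lt_succ_self l))
    exact h1.trans (Nat.le_succ l)
  · intro h x hx y hy hxy
    simp only [Set.mem_Icc, Fin.le_def, Fin.lt_def] at hx hy hxy
    have key : ∀ c (hc : (x : ℕ) + (c + 1) < m), (x : ℕ) + (c + 1) ≤ q →
        a x < a ⟨(x : ℕ) + (c + 1), hc⟩ := by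
      intro c
      induction c with
      | zero => intro hc hq; exact h x hc (by omega) (by omega)
      | succ c ih =>
        intro hc hq
        exact (ih (by omega) (by omega)).trans (h (x + (c + 1)) hc (by omega) (by omega))
    have := key (y - x - 1) (by omega) (by omega)
    have e : (x : ℕ) + (y - x - 1 + 1) = y := by omega
    simpa [e] using this

theorem isMonotoneBlock_iff {m : ℕ} (e : Fin m → Fin n) (f : ℕ → ℕ)
    (hf : ∀ i : Fin m, f i = e i) (p q : Fin m) :
    IsMonotoneBlock (S ∘ e) p q ↔ (p : ℕ) ≤ q ∧ ∃ c, Climbs (key S) f c p q := by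
  have hm : ∀ c, Climbs (key S) f c p q ↔ ∀ l (h : l + 1 < m), (p : ℕ) ≤ l → l < q →
      key S c (e ⟨l, by omega⟩) < key S c (e ⟨l + 1, h⟩) := by
    intro c
    constructor
    · intro h l hl h1 h2
      have := h l h1 h2
      rwa [hf ⟨l, by omega⟩, hf ⟨l + 1, hl⟩] at this
    · intro h l h1 h2
      have h3 : l + 1 < m := by omega
      have := h l h3 h1 h2
      rwa [← hf ⟨l, by omega⟩, ← hf ⟨l + 1, h3⟩] at this
  unfold IsMonotoneBlock
  rw [Fin.le_def, Bool.exists_bool, hm, hm, strictMonoOn_Icc_iff]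
  have hanti : StrictAntiOn (S ∘ e) (Set.Icc p q) ↔
      StrictMonoOn (fun i => -(S ∘ e) i) (Set.Icc p q) := by
    simp only [StrictAntiOn, StrictMonoOn, neg_lt_neg_iff]
  rw [hanti, strictMonoOn_Icc_iff, or_comm]
  simp [key]

end key

/-- Every adjacent pair lies in a monotone block of at least `k` elements. A run containing such a
pair must contain the whole block, since two monotone blocks sharing a pair have the same direction
and a monotone union. -/
theorem Reach.isRollercoaster {n k : ℕ} {S : Fin n → ℝ} (hS : Function.Injective S) (hk : 2 ≤ k)
    {d : Bool} {x v : ℕ} (h : Reach n k (key S) d k x v) :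
    ∃ e : Fin v → Fin n, StrictMono e ∧ IsRollercoaster k (S ∘ e) := by
  obtain ⟨f, hf⟩ := h.exists_witness key_not (fun d x y hxy hy => key_ne hS d hxy hy)
  have hlt : ∀ i j, i < j → j < v → f i < f j := by
    intro i j hij
    induction j, hij using Nat.le_induction with
    | base => exact fun h => hf.mono i h
    | succ j hj ih => exact fun h => (ih (by omega)).trans (hf.mono j h)
  have hn : ∀ i, i < v → f i < n := by
    intro i hi
    rcases Nat.lt_or_ge i (v - 1) with h' | h'
    · exact (hlt i (v - 1) h' (by omega)).trans (by rw [hf.last]; exact hf.lt)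
    · obtain rfl : i = v - 1 := by omega
      rw [hf.last]; exact hf.lt
  refine ⟨fun i => ⟨f i, hn i i.2⟩, fun i j hij => hlt i j hij j.2, ?_⟩
  have hblock := fun p q => isMonotoneBlock_iff (S := S) (fun i : Fin v => ⟨f i, hn i i.2⟩) f
    (fun i => rfl) p q
  have hv : k ≤ v := by
    obtain ⟨r, h1, h2, h3, h4, h5⟩ := hf.tail
    omega
  have hdir : ∀ i, i + 1 < v → ∃ c, key S c (f i) < key S c (f (i + 1)) := by
    intro i hi
    obtain ⟨p, q, c, h1, h2, h3, h4, h5⟩ := hf.covered hi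
    exact ⟨c, h5 i h1 h2⟩
  intro p q hrun
  obtain ⟨hmon, hmax⟩ := hrun
  obtain ⟨hpq, c, hc⟩ := (hblock p q).1 hmon
  rcases Nat.lt_or_ge p q with hlt' | hge
  · obtain ⟨p', q', c', h1, h2, h3, h4, h5⟩ := hf.covered (i := p) (by omega)
    have hcc : c' = c := by
      by_contra hne
      have e1 := hc p le_rfl hlt'
      have e2 := h5 p h1 h2
      obtain rfl : c' = !c := by cases c <;> cases c' <;> simp_all
      rw [key_not, key_not] at e2
      linarith
    subst hcc
    have := hmax ⟨min p p', by omega⟩ ⟨max q q', by omega⟩ (by simp [Fin.le_def])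
      (by simp [Fin.le_def]) ((hblock _ _).2 ⟨by simp; omega, c', ?_⟩)
    · simp only [Fin.ext_iff] at this
      omega
    · intro l hl1 hl2
      simp only at hl1 hl2
      by_cases hin : (p : ℕ) ≤ l ∧ l < q
      · exact hc l hin.1 hin.2
      · exact h5 l (by omega) (by omega)
  -- A run of one element is impossible: as `v ≥ k ≥ 2`, the element has a neighbour, and together
  -- they form a larger monotone block.
  · exfalso
    have hpq' : (p : ℕ) = q := by omega
    rcases Nat.lt_or_ge (p + 1) v with h' | h'
    · obtain ⟨c, hc⟩ := hdir p h'
      have := hmax p ⟨p + 1, h'⟩ le_rfl (by simp [Fin.le_def]; omega)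
        ((hblock _ _).2 ⟨by simp, c, fun l h1 h2 => by
          obtain rfl : l = p := by simp at h2; omega
          exact hc⟩)
      simp only [Fin.ext_iff] at this
      omega
    · obtain ⟨c, hc⟩ := hdir (p - 1) (by omega)
      have := hmax ⟨p - 1, by omega⟩ q (by simp [Fin.le_def]) le_rfl
        ((hblock _ _).2 ⟨by simp; omega, c, fun l h1 h2 => by
          obtain rfl : l = p - 1 := by simp at h1 h2; omega
          exact hc⟩)
      simp only [Fin.ext_iff] at this
      omega

/-- Follow the sequence pair by pair. At a change of direction the climb just finished is a run,
hence long enough for its level to be `k`, and `turnAt` applies. -/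
theorem IsRollercoaster.exists_reach {n k m : ℕ} {S : Fin n → ℝ} (hS : Function.Injective S)
    (hk : 2 ≤ k) {e : Fin m → Fin n} (he : StrictMono e) (hr : IsRollercoaster k (S ∘ e))
    (hm : 1 ≤ m) : ∃ d x, Reach n k (key S) d k x m := by
  let f : ℕ → ℕ := fun i => if h : i < m then e ⟨i, h⟩ else 0
  have hf : ∀ i : Fin m, f i = e i := fun i => by simp [f]
  have hblock := fun p q => isMonotoneBlock_iff (S := S) e f hf p q
  have hfn : ∀ i, i < m → f i < n := fun i hi => by simp [f, hi]
  have hmono : ∀ i, i + 1 < m → f i < f (i + 1) := fun i hi => by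
    have h : i < m := by omega
    simp only [f, hi, h, dite_true]
    exact he (by simp [Fin.lt_def])
  -- A climb that starts at the beginning or after a descent, and stops at the end or before a
  -- descent, is maximal and hence a run.
  have hrun : ∀ p i d, p < i → i < m → Climbs (key S) f d p i →
      (p = 0 ∨ key S (!d) (f (p - 1)) < key S (!d) (f p)) →
      (i + 1 = m ∨ key S (!d) (f i) < key S (!d) (f (i + 1))) → k ≤ i - p + 1 := by
    intro p i d hpi hi hc hleft hright
    refine hr ⟨p, by omega⟩ ⟨i, hi⟩ ⟨(hblock _ _).2 ⟨by simp; omega, d, hc⟩, ?_⟩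
    intro p' q' hp' hq' hb
    obtain ⟨hpq', c, hc'⟩ := (hblock _ _).1 hb
    simp only [Fin.le_def] at hp' hq'
    have hcc : c = d := by
      by_contra hne
      have e1 := hc p le_rfl hpi
      have e2 := hc' p hp' (by omega)
      obtain rfl : c = !d := by cases c <;> cases d <;> simp_all
      rw [key_not, key_not] at e2
      linarith
    subst hcc
    simp only [Fin.ext_iff]
    constructor
    · by_contra hne
      rcases hleft with h0 | h0
      · omega
      · have := hc' (p - 1) (by omega) (by omega)
        rw [Nat.sub_add_cancel (by omega)] at this
        rw [key_not, key_not] at h0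
        linarith
    · by_contra hne
      rcases hright with h0 | h0
      · omega
      · have := hc' i (by omega) (by omega)
        rw [key_not, key_not] at h0
        linarith
  have hdir : ∀ i, i + 1 < m → ∃ d, key S d (f i) < key S d (f (i + 1)) := by
    intro i hi
    rcases lt_or_gt_of_ne (key_ne hS true (hmono i hi) (hfn _ hi)) with h | h
    · exact ⟨true, h⟩
    · exact ⟨false, by rw [← Bool.not_true, key_not, key_not]; exact neg_lt_neg h⟩
  -- Here `p` is the start of the last climb; recording that it cannot be extended to the left is
  -- what makes `hrun` applicable at the next turn.
  have hmain : ∀ i, i + 1 < m → ∃ d p, p < i + 1 ∧ Climbs (key S) f d p (i + 1) ∧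
      (p = 0 ∨ key S (!d) (f (p - 1)) < key S (!d) (f p)) ∧
      Reach n k (key S) d (min (i + 1 - p + 1) k) (f (i + 1)) (i + 2) := by
    intro i
    induction i with
    | zero =>
      intro hi
      obtain ⟨d, hd⟩ := hdir 0 hi
      refine ⟨d, 0, by omega, fun l h1 h2 => ?_, Or.inl rfl, ?_⟩
      · obtain rfl : l = 0 := by omega
        exact hd
      · exact Reach.step (hmono 0 hi) (hfn _ hi) hd (Reach.start d (hfn 0 (by omega)))
    | succ i ih =>
      intro hi
      obtain ⟨d, p, hp, hc, hl, hR⟩ := ih (by omega)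
      obtain ⟨c, hcd⟩ := hdir (i + 1) hi
      by_cases hcc : c = d
      · subst hcc
        refine ⟨c, p, by omega, hc.snoc (fun _ _ => rfl) rfl hcd, hl, ?_⟩
        have := Reach.step (hmono (i + 1) hi) (hfn _ hi) hcd hR
        convert this using 1
        omega
      · obtain rfl : c = !d := by cases c <;> cases d <;> simp_all
        have hlen := hrun p (i + 1) d hp (by omega) hc hl (Or.inr hcd)
        rw [min_eq_right (by omega)] at hR
        refine ⟨!d, i + 1, by omega, fun l h1 h2 => ?_, Or.inr ?_, ?_⟩
        · obtain rfl : l = i + 1 := by omega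
          exact hcd
        · simpa using hc i (by omega) (by omega)
        · have h1 : Reach n k (key S) (!d) 1 (f (i + 1)) (i + 2) :=
            Reach.turnAt (by simpa using hR)
          have := Reach.step (hmono (i + 1) hi) (hfn _ hi) hcd h1
          convert this using 1
          omega
  rcases Nat.lt_or_ge 1 m with h1 | h1
  · obtain ⟨d, p, hp, hc, hl, hR⟩ := hmain (m - 2) (by omega)
    have hlen := hrun p (m - 2 + 1) d hp (by omega) hc hl (Or.inl (by omega))
    rw [min_eq_right (by omega)] at hR
    refine ⟨d, f (m - 2 + 1), ?_⟩
    convert hR using 1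
    omega
  -- A single element is its own run, of length `1 < k`.
  · exfalso
    obtain rfl : m = 1 := by omega
    have := hr 0 0 ⟨(hblock _ _).2 ⟨le_rfl, true, fun l h1 h2 => by simp at h2⟩,
      fun p' q' _ _ _ => ⟨Subsingleton.elim _ _, Subsingleton.elim _ _⟩⟩
    simp at this
    omega

/-- The longest rollercoaster has the largest length of a full `Reach`. -/
theorem isLongestLength_of_reach {n k r : ℕ} {S : Fin n → ℝ} (hS : Function.Injective S)
    (hk : 2 ≤ k) (hr : r = 0 ∨ ∃ d x v, r ≤ v ∧ Reach n k (key S) d k x v)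
    (hmax : ∀ d x v, Reach n k (key S) d k x v → v ≤ r) : IsLongestLength k S r := by
  constructor
  · rcases hr with rfl | ⟨d, x, v, hv, h⟩
    · exact ⟨fun i => i.elim0, fun i => i.elim0, fun p => p.elim0⟩
    · obtain rfl : r = v := le_antisymm hv (hmax _ _ _ h)
      exact h.isRollercoaster hS hk
  · rintro m ⟨e, he, hm⟩
    rcases Nat.eq_zero_or_pos m with rfl | hpos
    · exact Nat.zero_le _
    · obtain ⟨d, x, h⟩ := hm.exists_reach hS hk he hpos
      exact hmax _ _ _ h


/-! ### Labelled patience rows -/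

/-- An element of a patience row: a position, its label and its finger. -/
structure Item : Type where
  pos : ℕ
  lab : ℕ
  fin : ℕ

/-- The number of items of a row with label at least `w` and key less than `z`. -/
noncomputable def count (T : ℕ → ℝ) (R : List Item) (w : ℕ) (z : ℝ) : ℕ :=
  open Classical in R.countP fun a => decide (T a.pos < z ∧ w ≤ a.lab)

/-- Push a displaced label through a row. -/
def cascade : ℕ → List Item → List Item
  | _, [] => []
  | r, a :: R => ⟨a.pos, min a.lab r, a.fin⟩ :: cascade (max r a.lab) R

/-- What remains of the upper part of a row after its first element has been replaced. -/
def displace : List Item → List Item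
  | [] => []
  | a :: R => cascade a.lab R

section count

variable {T : ℕ → ℝ} {w : ℕ} {z s : ℝ}

@[simp] theorem count_nil : count T [] w z = 0 := rfl

theorem count_cons (a : Item) (R : List Item) : open Classical in
    count T (a :: R) w z = count T R w z + if T a.pos < z ∧ w ≤ a.lab then 1 else 0 := by
  classical
  simp [count, List.countP_cons]

theorem count_append (R Q : List Item) :
    count T (R ++ Q) w z = count T R w z + count T Q w z := by
  simp [count, List.countP_append]

theorem one_le_count {R : List Item} :
    1 ≤ count T R w z ↔ ∃ a ∈ R, T a.pos < z ∧ w ≤ a.lab := by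
  unfold count
  rw [Nat.succ_le_iff, List.countP_pos_iff]
  simp

theorem count_eq_zero {R : List Item} (h : ∀ a ∈ R, z ≤ T a.pos) : count T R w z = 0 := by
  by_contra h0
  obtain ⟨a, ha, h1, -⟩ := one_le_count.1 (Nat.one_le_iff_ne_zero.2 h0)
  exact absurd (h a ha) (not_le.2 h1)

theorem count_eq_length {R : List Item} (h : ∀ a ∈ R, T a.pos < z ∧ w ≤ a.lab) :
    count T R w z = R.length := by
  unfold count
  rw [List.countP_eq_length]
  simpa using h

theorem count_congr {R : List Item} {w' : ℕ} {z' : ℝ}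
    (h : ∀ a ∈ R, (T a.pos < z ∧ w ≤ a.lab) ↔ (T a.pos < z' ∧ w' ≤ a.lab)) :
    count T R w z = count T R w' z' := by
  unfold count
  exact List.countP_congr fun a ha => by simpa using h a ha

theorem count_filter {R : List Item} {c : ℕ} (h : c ≤ w) :
    count T (R.filter fun a => decide (c ≤ a.lab)) w z = count T R w z := by
  unfold count
  rw [List.countP_filter]
  refine List.countP_congr fun a _ => ?_
  simp only [Bool.decide_and, Bool.and_eq_true, decide_eq_true_eq]
  exact ⟨fun h => h.1, fun h' => ⟨h', h.trans h'.2⟩⟩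

theorem count_mono_sublist {R Q : List Item} (h : R.Sublist Q) :
    count T R w z ≤ count T Q w z := h.countP_le

/-- For a fixed threshold `w` only the truth of `w ≤ lab` matters. If the carried label reaches `w`,
all items keep this truth value; otherwise exactly the first item with label at least `w` loses it,
and from then on the carried label reaches `w`. If that item is not below `z`, no later item is, so
the truncated `- 1` acts on `0`. -/
theorem count_cascade {R : List Item} (hR : R.Pairwise fun a b => T a.pos < T b.pos) (r : ℕ) :
    count T (cascade r R) w z = if w ≤ r then count T R w z else count T R w z - 1 := by
  induction R generalizing r with
  | nil => simp [cascade]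
  | cons a R ih =>
    rw [List.pairwise_cons] at hR
    rw [cascade, count_cons, ih hR.2, count_cons]
    by_cases h1 : w ≤ r
    · simp [h1]
    · by_cases h2 : w ≤ a.lab
      · by_cases h3 : T a.pos < z
        · simp [h1, h2, h3]
        · have := count_eq_zero (w := w) fun b hb => (not_lt.1 h3).trans (hR.1 b hb).le
          simp [h1, h2, h3, this]
      · simp [h1, h2]

/-- This is the point of the cascade: in the sub-row of every threshold simultaneously, precisely
the first item disappears. -/
theorem count_displace {R : List Item} (hR : R.Pairwise fun a b => T a.pos < T b.pos) :
    count T (displace R) w z = count T R w z - 1 := by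
  cases R with
  | nil => rfl
  | cons a R =>
    rw [List.pairwise_cons] at hR
    rw [displace, count_cascade hR.2, count_cons]
    by_cases h2 : w ≤ a.lab
    · by_cases h3 : T a.pos < z
      · simp [h2, h3]
      · have := count_eq_zero (w := w) fun b hb => (not_lt.1 h3).trans (hR.1 b hb).le
        simp [h2, h3, this]
    · simp [h2]

end count

section cascade

theorem mem_cascade {b : Item} {R : List Item} {r : ℕ} (h : b ∈ cascade r R) :
    ∃ a ∈ R, b.pos = a.pos ∧ b.fin = a.fin ∧ (b.lab = r ∨ ∃ c ∈ R, b.lab = c.lab) := by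
  induction R generalizing r with
  | nil => simp [cascade] at h
  | cons a R ih =>
    rw [cascade, List.mem_cons] at h
    rcases h with rfl | h
    · refine ⟨a, by simp, rfl, rfl, ?_⟩
      rcases le_total a.lab r with h | h
      · exact Or.inr ⟨a, by simp, by simp [h]⟩
      · exact Or.inl (by simp [h])
    · obtain ⟨c, hc, h1, h2, h3⟩ := ih h
      refine ⟨c, by simp [hc], h1, h2, ?_⟩
      rcases h3 with h3 | ⟨e, he, h3⟩
      · rcases le_total a.lab r with h | h
        · exact Or.inl (by rw [h3, max_eq_left h])
        · exact Or.inr ⟨a, by simp, by rw [h3, max_eq_right h]⟩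
      · exact Or.inr ⟨e, by simp [he], h3⟩

theorem mem_displace {b : Item} {R : List Item} (h : b ∈ displace R) :
    ∃ a ∈ R, b.pos = a.pos ∧ b.fin = a.fin ∧ ∃ c ∈ R, b.lab = c.lab := by
  cases R with
  | nil => simp [displace] at h
  | cons a R =>
    obtain ⟨c, hc, h1, h2, h3⟩ := mem_cascade h
    refine ⟨c, by simp [hc], h1, h2, ?_⟩
    rcases h3 with h3 | ⟨e, he, h3⟩
    · exact ⟨a, by simp, h3⟩
    · exact ⟨e, by simp [he], h3⟩

@[simp] theorem length_cascade (r : ℕ) (R : List Item) : (cascade r R).length = R.length := by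
  induction R generalizing r with
  | nil => rfl
  | cons a R ih => simp [cascade, ih]

@[simp] theorem length_displace (R : List Item) : (displace R).length = R.length - 1 := by
  cases R <;> simp [displace]

theorem map_pos_cascade (r : ℕ) (R : List Item) :
    (cascade r R).map Item.pos = R.map Item.pos := by
  induction R generalizing r with
  | nil => rfl
  | cons a R ih => simp [cascade, ih]

theorem map_pos_displace (R : List Item) :
    (displace R).map Item.pos = (R.map Item.pos).tail := by
  cases R <;> simp [displace, map_pos_cascade]

theorem pairwise_displace {T : ℕ → ℝ} {R : List Item}
    (hR : R.Pairwise fun a b => T a.pos < T b.pos) :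
    (displace R).Pairwise fun a b => T a.pos < T b.pos := by
  have h : ∀ Q : List Item, (Q.Pairwise fun a b => T a.pos < T b.pos) ↔
      (Q.map Item.pos).Pairwise fun a b => T a < T b := fun Q => by rw [List.pairwise_map]
  rw [h, map_pos_displace]
  exact ((h R).1 hR).tail

end cascade

section insertion

variable {T : ℕ → ℝ} {w : ℕ} {z : ℝ} {A B : List Item} {x : Item}

theorem count_insertion (hB : B.Pairwise fun a b => T a.pos < T b.pos) : open Classical in
    count T (A ++ x :: displace B) w z =
      count T A w z + (count T B w z - 1) + if T x.pos < z ∧ w ≤ x.lab then 1 else 0 := by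
  rw [count_append, count_cons, count_displace hB, add_assoc]

/-- A sub-row that loses an item of `B` below `z` gains `x`, which lies lower and has a label at
least as large. -/
theorem count_le_count_insertion (hB : B.Pairwise fun a b => T a.pos < T b.pos)
    (hxB : ∀ b ∈ B, T x.pos < T b.pos) (hlab : ∀ b ∈ B, b.lab ≤ x.lab) :
    count T (A ++ B) w z ≤ count T (A ++ x :: displace B) w z := by
  rw [count_insertion hB, count_append]
  rcases Nat.eq_zero_or_pos (count T B w z) with h | h
  · omega
  · obtain ⟨a, ha, h1, h2⟩ := one_le_count.1 h
    rw [if_pos ⟨(hxB a ha).trans h1, h2.trans (hlab a ha)⟩]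
    omega

theorem count_lt_count_insertion (hB : B.Pairwise fun a b => T a.pos < T b.pos)
    (hAx : ∀ a ∈ A, T a.pos < T x.pos) (hxB : ∀ b ∈ B, T x.pos < T b.pos)
    (hz : T x.pos < z) (hw : w ≤ x.lab) :
    count T (A ++ B) w (T x.pos) + 1 ≤ count T (A ++ x :: displace B) w z := by
  rw [count_insertion hB, count_append, count_eq_zero fun b hb => (hxB b hb).le,
    if_pos ⟨hz, hw⟩, count_congr (w' := w) (z' := z) fun a ha =>
      and_congr_left fun _ => iff_of_true (hAx a ha) ((hAx a ha).trans hz)]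
  omega

/-- Soundness of insertion: a count that was not available before comes from a climb ending at `x`.
If `B` contributes below `z`, its loss already compensates for the gain of `x`. -/
theorem le_count_insertion {j : ℕ} (hB : B.Pairwise fun a b => T a.pos < T b.pos)
    (hAx : ∀ a ∈ A, T a.pos < T x.pos)
    (h : j ≤ count T (A ++ x :: displace B) w z) :
    j ≤ count T (A ++ B) w z ∨
      T x.pos < z ∧ w ≤ x.lab ∧ j ≤ count T (A ++ B) w (T x.pos) + 1 := by
  rw [count_insertion hB] at h
  rw [count_append]
  by_cases hc : T x.pos < z ∧ w ≤ x.lab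
  · rw [if_pos hc] at h
    rcases Nat.eq_zero_or_pos (count T B w z) with h0 | h0
    · right
      refine ⟨hc.1, hc.2, ?_⟩
      rw [count_append, count_congr (R := A) (w' := w) (z' := z) fun a ha =>
        and_congr_left fun _ => iff_of_true (hAx a ha) ((hAx a ha).trans hc.1)]
      omega
    · left; omega
  · rw [if_neg hc] at h
    left; omega

end insertion


/-! ### The invariant and the treatment of one position -/

theorem Reach.inv {n k : ℕ} {T : Bool → ℕ → ℝ} {d : Bool} {j x v : ℕ}
    (h : Reach n k T d j x v) :
    (j = 1 ∧ v = 1) ∨ (j = 1 ∧ Reach n k T (!d) k x v) ∨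
      (j = 1 ∧ ∃ y v', y < x ∧ v = v' + 1 ∧ Reach n k T (!d) k y v') ∨
      ∃ j' y v', y < x ∧ T d y < T d x ∧ Reach n k T d j' y v' ∧ j = min (j' + 1) k ∧
        v = v' + 1 := by
  cases h with
  | start => simp
  | turnAt h => exact Or.inr (Or.inl ⟨rfl, h⟩)
  | turnAfter hyx hx h => exact Or.inr (Or.inr (Or.inl ⟨rfl, _, _, hyx, rfl, h⟩))
  | step hyx hx hT h => exact Or.inr (Or.inr (Or.inr ⟨_, _, _, hyx, hT, h, rfl, rfl⟩))

/-- The data kept by the algorithm, for each direction: the largest value of a full sequence, the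
best endpoint for each value, and the truncated patience row. -/
structure Data : Type where
  L : Bool → ℕ
  F : Bool → ℕ → ℕ
  R : Bool → List Item

/-- Values up to `base` are irrelevant for the further computation. -/
def Data.base (D : Data) (k : ℕ) (d : Bool) : ℕ := min (D.L (!d)) (D.L d - k)

/-- The algorithm knows a sequence of value at least `v` that ends below `z`, at level `j` or at a
level from which no improvement over `L` is possible. -/
def Data.Knows (D : Data) (k : ℕ) (T : Bool → ℕ → ℝ) (d : Bool) (j v : ℕ) (z : ℝ) : Prop :=
  v ≤ D.base k d ∨
    (∃ w i, 1 ≤ w ∧ 1 ≤ i ∧ i < k ∧ v + 1 ≤ w + i ∧ i ≤ count (T d) (D.R d) w z ∧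
      (j ≤ i ∨ v + k ≤ D.L d + i)) ∨
    ∃ u, v ≤ u ∧ D.base k d < u ∧ u ≤ D.L d ∧ T d (D.F d u) < z

/-- The data describe the first `t` positions, and the rows have at most `m` items. -/
structure Inv (n k : ℕ) (T : Bool → ℕ → ℝ) (m t : ℕ) (D : Data) : Prop where
  complete : ∀ d x v, x < t → Reach n k T d k x v → v ≤ D.L d
  full : ∀ d v, 1 ≤ v → v ≤ D.L d →
    D.F d v < t ∧ ∃ v', v ≤ v' ∧ Reach n k T d k (D.F d v) v'
  mono : ∀ d v v', D.base k d < v → v ≤ v' → v' ≤ D.L d → T d (D.F d v) ≤ T d (D.F d v')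
  sorted : ∀ d, (D.R d).Pairwise fun a b => T d a.pos < T d b.pos
  item : ∀ d, ∀ a ∈ D.R d, a.pos < t ∧ 1 ≤ a.lab ∧ a.lab ≤ D.L (!d) + 1
  finger : ∀ d, ∀ a ∈ D.R d, a.fin ≤ D.base k (!d) ∨
    a.fin ≤ D.L (!d) ∧ T (!d) (D.F (!d) a.fin) ≤ T (!d) a.pos
  length : ∀ d, (D.R d).length ≤ m
  row : ∀ d w z j, 1 ≤ w → 1 ≤ j → j ≤ count (T d) (D.R d) w z →
    ∃ x v, x < t ∧ T d x < z ∧ w + j ≤ v + 1 ∧ Reach n k T d (min j k) x v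
  knows : ∀ d x j v z, x < t → Reach n k T d j x v → T d x < z → D.Knows k T d j v z

theorem inv_zero (n k : ℕ) (T : Bool → ℕ → ℝ) (F : Bool → ℕ → ℕ) :
    Inv n k T (3 * k) 0 ⟨fun _ => 0, F, fun _ => []⟩ where
  complete := by simp
  full := by simp; omega
  mono := fun d v v' h1 h2 h3 => by simp [Data.base] at h1 h3; omega
  sorted := by simp
  item := by simp
  finger := by simp
  length := by simp
  row := by simp; omega
  knows := by simp

/-- The quantities computed for the new position `t`: the row is split at the key of `t`, `z` is
the best label of a sequence of `k - 1` elements below `t`, and `w` is the result of the scan. -/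
structure Probe (k : ℕ) (T : Bool → ℕ → ℝ) (t : ℕ) (D : Data) (A B : Bool → List Item)
    (z w : Bool → ℕ) : Prop where
  split : ∀ d, D.R d = A d ++ B d
  below : ∀ d, ∀ a ∈ A d, T d a.pos < T d t
  above : ∀ d, ∀ a ∈ B d, T d t < T d a.pos
  le_z : ∀ d l, 1 ≤ l → k ≤ count (T d) (D.R d) l (T d t) + 1 → l ≤ z d
  z_spec : ∀ d, 1 ≤ z d → k ≤ count (T d) (D.R d) (z d) (T d t) + 1
  base_le : ∀ d, D.base k d ≤ w d
  finger_le : ∀ d a, (B (!d)).head? = some a → a.fin ≤ w d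
  w_le : ∀ d, w d ≤ D.L d
  scanned : ∀ d, w d = D.base k d ∨ (∃ a, (B (!d)).head? = some a ∧ w d = a.fin) ∨
    T d (D.F d (w d)) < T d t
  maximal : ∀ d, w d < D.L d → T d t ≤ T d (D.F d (w d + 1))

/-- The value of the new position. -/
def newValue (k b w z : ℕ) : ℕ := max (if b < w then w + 1 else 0) (if 1 ≤ z then z + k - 1 else 0)

/-- The data after the treatment of position `t`, before the rows are truncated. -/
def Data.insert (D : Data) (k t : ℕ) (A B : Bool → List Item) (z w : Bool → ℕ) : Data :=
  let U := fun d => newValue k (D.base k d) (w d) (z d)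
  let L := fun d => max (D.L d) (U d)
  { L := L
    F := fun d v => if w d < v ∧ v ≤ U d then t else D.F d v
    R := fun d => A d ++ ⟨t, max (L (!d)) (D.L (!d) + 1), w (!d)⟩ :: displace (B d) }

/-- Items with a label below `threshold` are irrelevant. -/
def Data.threshold (D : Data) (k : ℕ) (d : Bool) : ℕ := D.base k d + 1 - k

/-- Truncation of the rows. -/
def Data.trim (D : Data) (k : ℕ) : Data :=
  { L := D.L
    F := D.F
    R := fun d => ((D.R d).filter fun a => decide (D.threshold k d ≤ a.lab)).take (3 * k) }

theorem Inv.value_le {n k t : ℕ} {T : Bool → ℕ → ℝ} {D : Data} (h : Inv n k T (3 * k + 1) t D)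
    {d : Bool} {w j : ℕ} {z : ℝ} (hw : 1 ≤ w) (hj : 1 ≤ j) (hk : k ≤ j)
    (hc : j ≤ count (T d) (D.R d) w z) : w + j ≤ D.L d + 1 := by
  obtain ⟨x, v, h1, h2, h3, h4⟩ := h.row d w z j hw hj hc
  rw [min_eq_right hk] at h4
  have := h.complete d x v h1 h4
  omega

/-- If a row overflows, then the full sequences of its direction are far ahead. -/
theorem Inv.overflow {n k t : ℕ} {T : Bool → ℕ → ℝ} {D : Data} (h : Inv n k T (3 * k + 1) t D)
    (hk : 3 ≤ k) {d : Bool} {w : ℕ} {z : ℝ} (hw : 1 ≤ w) (hth : D.threshold k d ≤ w)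
    (hc : 3 * k ≤ count (T d) (D.R d) w z) :
    D.L (!d) + k < D.L d ∧ D.base k d = D.L (!d) := by
  -- This gives `w + 3 * k ≤ D.L d + 1`. Were the base equal to `D.L d - k`, the threshold would
  -- force `w ≥ D.L d + 1 - 2 * k`, a contradiction; so the base is `D.L (!d)`, and `w ≥ D.L (!d) +
  -- 1 - k` yields the gap.
  have := h.value_le hw (by omega) (by omega) hc
  unfold Data.threshold Data.base at hth
  unfold Data.base
  omega

/-- Only completeness is at stake, since a sublist has smaller counts. Low labels lead to irrelevant
values; an item cut off at the right end is preceded by a climb of `3 * k` items, whose full state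
is lower and better than any partial one. -/
theorem Inv.trim {n k t : ℕ} {T : Bool → ℕ → ℝ} {D : Data} (h : Inv n k T (3 * k + 1) t D)
    (hk : 3 ≤ k) : Inv n k T (3 * k) t (D.trim k) := by
  have hsub : ∀ d, ((D.trim k).R d).Sublist (D.R d) := fun d =>
    (List.take_sublist _ _).trans List.filter_sublist
  refine
    { complete := h.complete
      full := h.full
      mono := h.mono
      sorted := fun d => (h.sorted d).sublist (hsub d)
      item := fun d a ha => h.item d a ((hsub d).subset ha)
      finger := fun d a ha => h.finger d a ((hsub d).subset ha)
      length := fun d => by simp [Data.trim]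
      row := fun d w z j hw hj hc => h.row d w z j hw hj (hc.trans (count_mono_sublist (hsub d)))
      knows := ?_ }
  intro d x j v z hx hR hz
  rcases h.knows d x j v z hx hR hz with h1 | ⟨w, i, hw, hi, hik, hv, hc, hj⟩ | h1
  · exact Or.inl h1
  · by_cases hthr : D.threshold k d ≤ w
    swap
    -- With `w` below the threshold and fewer than `k` items, `v ≤ w + i - 1` cannot exceed the
    -- base.
    · left
      change v ≤ D.base k d
      unfold Data.threshold at hthr
      omega
    set Q := (D.R d).filter fun a => decide (D.threshold k d ≤ a.lab) with hQ
    have hQc : count (T d) Q w z = count (T d) (D.R d) w z := count_filter hthr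
    by_cases hcut : i ≤ count (T d) (Q.take (3 * k)) w z
    · exact Or.inr (Or.inl ⟨w, i, hw, hi, hik, hv, hcut, hj⟩)
    right; right
    have hsplit : count (T d) Q w z =
        count (T d) (Q.take (3 * k)) w z + count (T d) (Q.drop (3 * k)) w z := by
      rw [← count_append, List.take_append_drop]
    obtain ⟨b, hb, hbz, -⟩ := one_le_count.1 (show 1 ≤ count (T d) (Q.drop (3 * k)) w z by omega)
    have hlen : (Q.take (3 * k)).length = 3 * k := by
      rw [List.length_take]
      have : (Q.drop (3 * k)).length ≠ 0 := fun h0 => by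
        rw [List.length_eq_zero_iff] at h0
        rw [h0] at hb
        simp at hb
      rw [List.length_drop] at this
      omega
    have hQs : Q.Pairwise fun a b => T d a.pos < T d b.pos := (h.sorted d).sublist
      List.filter_sublist
    have hlow : ∀ a ∈ Q.take (3 * k), T d a.pos < T d b.pos ∧ max 1 (D.threshold k d) ≤ a.lab := by
      intro a ha
      have h1 := hQs
      rw [← List.take_append_drop (3 * k) Q, List.pairwise_append] at h1
      refine ⟨h1.2.2 a ha b hb, ?_⟩
      have h2 : a ∈ Q := (List.take_sublist _ _).subset ha
      rw [hQ, List.mem_filter] at h2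
      have h3 := h.item d a h2.1
      have h4 := of_decide_eq_true h2.2
      omega
    have hbig : 3 * k ≤ count (T d) (D.R d) (max 1 (D.threshold k d)) (T d b.pos) := by
      rw [← hlen, ← count_eq_length hlow]
      exact count_mono_sublist (hsub d)
    obtain ⟨hov, hbase⟩ := h.overflow hk (le_max_left _ _) (le_max_right _ _) hbig
    obtain ⟨y, u, hy, hyb, hu, hRu⟩ := h.row d _ _ _ (le_max_left _ _) (by omega) hbig
    rw [min_eq_right (by omega)] at hRu
    have hlab : ∀ w' z', 1 ≤ count (T d) (D.R d) w' z' → w' ≤ D.L (!d) + 1 := by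
      intro w' z' h1
      obtain ⟨a, ha, -, h2⟩ := one_le_count.1 h1
      exact h2.trans (h.item d a ha).2.2
    have hw' := hlab w z (hi.trans hc)
    have hth : D.threshold k d = D.base k d + 1 - k := rfl
    -- The full state has `u ≥ D.L (!d) + 2 * k`, whereas the base is `D.L (!d)` and the row only
    -- accounts for values up to `D.L (!d) + k - 1`. Hence it is recorded in `F`, and its value
    -- exceeds `v`.
    rcases h.knows d y k u z hy hRu (hyb.trans hbz) with h1 | ⟨w2, i2, hw2, hi2, hik2, hv2, hc2, -⟩
      | ⟨u2, h1, h2, h3, h4⟩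
    · omega
    · have := hlab w2 z (hi2.trans hc2)
      omega
    · exact ⟨u2, by omega, h2, h3, h4⟩
  · exact Or.inr (Or.inr h1)

section step

variable {n k t : ℕ} {T : Bool → ℕ → ℝ} {D : Data} {A B : Bool → List Item} {z w : Bool → ℕ}

/-- If the scan did not move, `w d` is the base or a finger. The finger belongs to an item above `t`
in direction `!d`, that is, below `t` in direction `d`, and its recorded endpoint is no higher than
that item. -/
theorem Probe.lt_of_base_lt (hneg : ∀ d x, T (!d) x = -T d x) (h : Inv n k T (3 * k) t D)
    (hp : Probe k T t D A B z w) {d : Bool} (hb : D.base k d < w d) :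
    T d (D.F d (w d)) < T d t := by
  rcases hp.scanned d with h1 | ⟨a, ha, h1⟩ | h1
  · omega
  · have haB : a ∈ B (!d) := List.mem_of_mem_head? ha
    have haR : a ∈ D.R (!d) := by rw [hp.split]; simp [haB]
    have h2 := hp.above _ a haB
    have h3 := h.finger _ a haR
    rw [Bool.not_not, ← h1] at h3
    rw [hneg, hneg] at h2
    rcases h3 with h3 | h3
    · omega
    · linarith [h3.2]
  · exact h1

theorem Probe.lt_of_le (hneg : ∀ d x, T (!d) x = -T d x) (h : Inv n k T (3 * k) t D)
    (hp : Probe k T t D A B z w) {d : Bool} {v : ℕ} (hb : D.base k d < v) (hv : v ≤ w d) :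
    T d (D.F d v) < T d t :=
  (h.mono d v (w d) hb hv (hp.w_le d)).trans_lt (hp.lt_of_base_lt hneg h (hb.trans_le hv))

theorem Probe.le_of_lt (h : Inv n k T (3 * k) t D) (hp : Probe k T t D A B z w) {d : Bool} {v : ℕ}
    (hv : w d < v) (hL : v ≤ D.L d) : T d t ≤ T d (D.F d v) :=
  (hp.maximal d (by omega)).trans
    (h.mono d _ _ (by have := hp.base_le d; omega) hv hL)

/-- The scan stops at the first failure; monotonicity of `F` excludes any later success. -/
theorem Probe.le_w (h : Inv n k T (3 * k) t D) (hp : Probe k T t D A B z w) {d : Bool} {v : ℕ}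
    (hL : v ≤ D.L d) (hlt : T d (D.F d v) < T d t) : v ≤ w d := by
  by_contra hc
  exact absurd hlt (not_lt.2 (hp.le_of_lt h (not_le.1 hc) hL))

/-- The new value is attained. -/
theorem Probe.reach_newValue (hk : 3 ≤ k) (ht : t < n) (hneg : ∀ d x, T (!d) x = -T d x)
    (h : Inv n k T (3 * k) t D) (hp : Probe k T t D A B z w) {d : Bool}
    (hU : 1 ≤ newValue k (D.base k d) (w d) (z d)) :
    ∃ v, newValue k (D.base k d) (w d) (z d) ≤ v ∧ Reach n k T d k t v := by
  have h1 : D.base k d < w d → ∃ v, w d + 1 ≤ v ∧ Reach n k T d k t v := by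
    intro hb
    obtain ⟨h1, v, h2, h3⟩ := h.full d (w d) (by omega) (hp.w_le d)
    have := Reach.step h1 ht (hp.lt_of_base_lt hneg h hb) h3
    rw [min_eq_right (by omega)] at this
    exact ⟨v + 1, by omega, this⟩
  have h2 : 1 ≤ z d → ∃ v, z d + k - 1 ≤ v ∧ Reach n k T d k t v := by
    intro hz
    have hc := hp.z_spec d hz
    obtain ⟨x, v, h1, h2, h3, h4⟩ := h.row d (z d) (T d t) (k - 1) hz (by omega) (by omega)
    have := Reach.step h1 ht h2 h4
    refine ⟨v + 1, by omega, ?_⟩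
    convert this using 1
    omega
  unfold newValue at hU ⊢
  by_cases c1 : D.base k d < w d <;> by_cases c2 : 1 ≤ z d <;> simp only [c1, c2, if_true, if_false]
    at hU ⊢
  · rcases le_total (w d + 1) (z d + k - 1) with hle | hle
    · rw [max_eq_right hle]; exact h2 c2
    · rw [max_eq_left hle]; exact h1 c1
  · simpa using h1 c1
  · simpa using h2 c2
  · simp at hU

/-- Completeness for the new full value: each way in which the predecessor is known either gives one
of the two candidates in `newValue` or bounds `v + 1` by the old `D.L d`. -/
theorem Probe.value_le (hk : 3 ≤ k) (h : Inv n k T (3 * k) t D) (hp : Probe k T t D A B z w) {d : Bool}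
    {j y v : ℕ} (hy : y < t) (hT : T d y < T d t) (hR : Reach n k T d j y v) (hj : k ≤ j + 1) :
    v + 1 ≤ max (D.L d) (newValue k (D.base k d) (w d) (z d)) := by
  have hv := hR.pos
  rcases h.knows d y j v _ hy hR hT with h1 | ⟨u, i, hu, hi, hik, huv, hc, hj'⟩ | ⟨u, h1, h2, h3, h4⟩
  · unfold Data.base at h1
    omega
  · by_cases hcase : k ≤ i + 1
    · have := hp.le_z d u hu (by omega)
      unfold newValue
      split_ifs <;> omega
    -- Here `i + 1 < k ≤ j + 1` rules out `j ≤ i`, so the known level is one from which `D.L d`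
    -- cannot be improved.
    · omega
  · have := hp.le_w h h3 h4
    unfold newValue
    split_ifs <;> omega

theorem Probe.complete (hk : 3 ≤ k) (h : Inv n k T (3 * k) t D) (hp : Probe k T t D A B z w) (d : Bool)
    (x v : ℕ) (hx : x < t + 1) (hR : Reach n k T d k x v) :
    v ≤ max (D.L d) (newValue k (D.base k d) (w d) (z d)) := by
  rcases Nat.lt_or_ge x t with h1 | h1
  · exact (h.complete d x v h1 hR).trans (le_max_left _ _)
  · obtain rfl : x = t := by omega
    rcases hR.inv with h2 | h2 | h2 | ⟨j, y, v', hy, hT, hR', hj, rfl⟩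
    · omega
    · omega
    · omega
    · exact hp.value_le hk h hy hT hR' (by omega)

/-- The starting value of a run is the new label. -/
theorem Probe.start_le (hk : 3 ≤ k) (h : Inv n k T (3 * k) t D) (hp : Probe k T t D A B z w) {d : Bool}
    {v : ℕ} (hR : v = 1 ∨ Reach n k T (!d) k t v ∨
      ∃ y v', y < t ∧ v = v' + 1 ∧ Reach n k T (!d) k y v') :
    v ≤ max (max (D.L (!d)) (newValue k (D.base k (!d)) (w (!d)) (z (!d)))) (D.L (!d) + 1) := by
  rcases hR with rfl | hR | ⟨y, v', hy, rfl, hR⟩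
  · omega
  · exact (hp.complete hk h _ _ _ (Nat.lt_succ_self t) hR).trans (le_max_left _ _)
  · have := h.complete _ _ _ hy hR
    omega

/-- A label is realized by turning after the best earlier full state of direction `!d`, or at `t`
itself if its own full value is larger. With no earlier full state, the label `1` is a fresh start.
-/
theorem Probe.reach_start (hk : 3 ≤ k) (ht : t < n) (hneg : ∀ d x, T (!d) x = -T d x)
    (h : Inv n k T (3 * k) t D) (hp : Probe k T t D A B z w) (d : Bool) :
    ∃ v, max (max (D.L (!d)) (newValue k (D.base k (!d)) (w (!d)) (z (!d)))) (D.L (!d) + 1) ≤ v ∧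
      Reach n k T d 1 t v := by
  by_cases hc : newValue k (D.base k (!d)) (w (!d)) (z (!d)) ≤ D.L (!d) + 1
  · rw [max_eq_right (by omega)]
    rcases Nat.eq_zero_or_pos (D.L (!d)) with h0 | h0
    · exact ⟨1, by omega, Reach.start d ht⟩
    · obtain ⟨h1, v, h2, h3⟩ := h.full (!d) _ h0 le_rfl
      exact ⟨v + 1, by omega, Reach.turnAfter h1 ht h3⟩
  · obtain ⟨v, h1, h2⟩ := hp.reach_newValue hk ht hneg h (d := !d) (by omega)
    exact ⟨v, by omega, Reach.turnAt h2⟩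

theorem base_le_base_insert (D : Data) (d : Bool) :
    D.base k d ≤ (D.insert k t A B z w).base k d := by
  simp only [Data.base, Data.insert]
  omega

theorem Probe.key_insert_le (h : Inv n k T (3 * k) t D) (hp : Probe k T t D A B z w) {d : Bool} {v : ℕ}
    (hL : v ≤ D.L d) : T d ((D.insert k t A B z w).F d v) ≤ T d (D.F d v) := by
  simp only [Data.insert]
  split_ifs with hc
  · exact hp.le_of_lt h hc.1 hL
  · exact le_rfl

/-- Soundness of the row splits by `le_count_insertion` into old climbs and climbs ending at `t`.
For completeness, old knowledge survives because counts do not drop and keys in `F` do not rise; a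
state ending at `t` is either a start, covered by the new label, or a step from a state already
known below `t`. -/
theorem Probe.insert (hk : 3 ≤ k) (ht : t < n) (hneg : ∀ d x, T (!d) x = -T d x)
    (h : Inv n k T (3 * k) t D) (hp : Probe k T t D A B z w) :
    Inv n k T (3 * k + 1) (t + 1) (D.insert k t A B z w) := by
  have hB : ∀ d, (B d).Pairwise fun a b => T d a.pos < T d b.pos := fun d =>
    ((h.sorted d).sublist (by rw [hp.split]; exact List.sublist_append_right _ _))
  have hA : ∀ d, (A d).Pairwise fun a b => T d a.pos < T d b.pos := fun d =>
    ((h.sorted d).sublist (by rw [hp.split]; exact List.sublist_append_left _ _))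
  have hRA : ∀ d, ∀ a ∈ A d, a ∈ D.R d := fun d a ha => by rw [hp.split]; simp [ha]
  have hRB : ∀ d, ∀ a ∈ B d, a ∈ D.R d := fun d a ha => by rw [hp.split]; simp [ha]
  set D' := D.insert k t A B z w with hD'
  have hL' : ∀ d, D'.L d = max (D.L d) (newValue k (D.base k d) (w d) (z d)) := fun d => rfl
  have hF' : ∀ d v, D'.F d v =
    if w d < v ∧ v ≤ newValue k (D.base k d) (w d) (z d) then t else D.F d v := fun d v => rfl
  set x : Bool → Item := fun d => ⟨t, max (D'.L (!d)) (D.L (!d) + 1), w (!d)⟩ with hx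
  have hR' : ∀ d, D'.R d = A d ++ x d :: displace (B d) := fun d => rfl
  have hbb : ∀ d, D.base k d ≤ D'.base k d := fun d => base_le_base_insert D d
  have hLL : ∀ d, D.L d ≤ D'.L d := fun d => le_max_left _ _
  have hlabB : ∀ d, ∀ b ∈ B d, b.lab ≤ (x d).lab := fun d b hb =>
    ((h.item d b (hRB d b hb)).2.2).trans (le_max_right _ _)
  have hgrow : ∀ d u z', count (T d) (D.R d) u z' ≤ count (T d) (D'.R d) u z' := fun d u z' => by
    rw [hp.split, hR']
    exact count_le_count_insertion (hB d) (hp.above d) (hlabB d)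
  have hgrow' : ∀ d u z', T d t < z' → u ≤ (x d).lab →
      count (T d) (D.R d) u (T d t) + 1 ≤ count (T d) (D'.R d) u z' := fun d u z' hz hu => by
    rw [hp.split, hR']
    exact count_lt_count_insertion (x := x d) (hB d) (hp.below d) (hp.above d) hz hu
  have hbase_lt : ∀ d, D.base k d < (x d).lab := fun d => by
    simp only [hx, Data.base]; omega
  have hFw : ∀ d v, D'.base k d < v → v ≤ w d → T d (D'.F d v) < T d t := fun d v hb hv => by
    rw [hF', if_neg (by omega)]
    exact hp.lt_of_le hneg h ((hbb d).trans_lt hb) hv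
  have hFU : ∀ d v, D'.base k d < v → v ≤ newValue k (D.base k d) (w d) (z d) →
      T d (D'.F d v) ≤ T d t := fun d v hb hv => by
    rcases Nat.lt_or_ge (w d) v with hc | hc
    · rw [hF', if_pos ⟨hc, hv⟩]
    · exact (hFw d v hb hc).le
  refine
    { complete := fun d y v hy hR => hp.complete hk h d y v hy hR
      full := ?_
      mono := ?_
      sorted := ?_
      item := ?_
      finger := ?_
      length := ?_
      row := ?_
      knows := ?_ }
  · intro d v hv hvL
    rw [hF']
    split_ifs with hc
    · obtain ⟨v', h1, h2⟩ := hp.reach_newValue hk ht hneg h (d := d) (by omega)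
      exact ⟨Nat.lt_succ_self t, v', by omega, h2⟩
    · have := hp.w_le d
      rw [hL'] at hvL
      obtain ⟨h1, h2⟩ := h.full d v hv (by omega)
      exact ⟨by omega, h2⟩
  · intro d v v' hb hvv hvL
    rw [hL'] at hvL
    have hw := hp.w_le d
    rw [hF' d v']
    split_ifs with hc
    · exact hFU d v hb (by omega)
    · rw [hF' d v]
      split_ifs with hc'
      · exact hp.le_of_lt h (by omega) (by omega)
      · exact h.mono d v v' ((hbb d).trans_lt hb) hvv (by omega)
  · intro d
    rw [hR', List.pairwise_append, List.pairwise_cons]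
    have hd : ∀ b ∈ displace (B d), T d t < T d b.pos := fun b hb => by
      obtain ⟨a, ha, h1, -⟩ := mem_displace hb
      rw [h1]; exact hp.above d a ha
    refine ⟨hA d, ⟨hd, pairwise_displace (hB d)⟩, ?_⟩
    intro a ha b hb
    rcases List.mem_cons.1 hb with rfl | hb
    · exact hp.below d a ha
    · exact (hp.below d a ha).trans (hd b hb)
  · intro d a ha
    rw [hR', List.mem_append, List.mem_cons] at ha
    have := hLL (!d)
    rcases ha with ha | rfl | ha
    · obtain ⟨h1, h2, h3⟩ := h.item d a (hRA d a ha)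
      omega
    · simp only [hx]
      omega
    · obtain ⟨b, hb, h1, -, c, hc, h2⟩ := mem_displace ha
      obtain ⟨h3, -⟩ := h.item d b (hRB d b hb)
      obtain ⟨-, h4, h5⟩ := h.item d c (hRB d c hc)
      omega
  · have hold : ∀ d, ∀ a ∈ D.R d, a.fin ≤ D'.base k (!d) ∨
        a.fin ≤ D'.L (!d) ∧ T (!d) (D'.F (!d) a.fin) ≤ T (!d) a.pos := by
      intro d a ha
      rcases h.finger d a ha with h1 | ⟨h1, h2⟩
      · exact Or.inl (h1.trans (hbb _))
      · exact Or.inr ⟨h1.trans (hLL _), (hp.key_insert_le h h1).trans h2⟩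
    intro d a ha
    rw [hR', List.mem_append, List.mem_cons] at ha
    rcases ha with ha | rfl | ha
    · exact hold d a (hRA d a ha)
    · by_cases hc : w (!d) ≤ D'.base k (!d)
      · exact Or.inl hc
      · exact Or.inr ⟨(hp.w_le _).trans (hLL _), (hFw _ _ (not_le.1 hc) le_rfl).le⟩
    · obtain ⟨b, hb, h1, h2, -⟩ := mem_displace ha
      rw [h1, h2]
      exact hold d b (hRB d b hb)
  · intro d
    have := h.length d
    rw [hp.split] at this
    rw [hR']
    simp at this ⊢
    omega
  · intro d u z' j hu hj hc
    rw [hR'] at hc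
    rcases le_count_insertion (x := x d) (hB d) (hp.below d) hc with h1 | ⟨hz, hlab, h1⟩
    · rw [← hp.split] at h1
      obtain ⟨y, v, h2, h3, h4, h5⟩ := h.row d u z' j hu hj h1
      exact ⟨y, v, by omega, h3, h4, h5⟩
    · rw [← hp.split] at h1
      replace h1 : j ≤ count (T d) (D.R d) u (T d t) + 1 := h1
      rcases Nat.lt_or_ge 1 j with hj1 | hj1
      · obtain ⟨y, v, h2, h3, h4, h5⟩ := h.row d u (T d t) (j - 1) hu (by omega) (by omega)
        have := Reach.step h2 ht h3 h5
        refine ⟨t, v + 1, Nat.lt_succ_self t, hz, by omega, ?_⟩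
        convert this using 1
        omega
      · obtain rfl : j = 1 := by omega
        obtain ⟨v, h2, h3⟩ := hp.reach_start hk ht hneg h d
        refine ⟨t, v, Nat.lt_succ_self t, hz, ?_, ?_⟩
        · exact Nat.succ_le_succ (hlab.trans h2)
        · rw [min_eq_left (by omega)]; exact h3
  · intro d y j v z' hy hR hz
    rcases Nat.lt_or_ge y t with hyt | hyt
    · rcases h.knows d y j v z' hyt hR hz with h1 | ⟨u, i, hu, hi, hik, huv, hc, hj⟩ |
        ⟨u, h1, h2, h3, h4⟩
      · exact Or.inl (h1.trans (hbb d))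
      · exact Or.inr (Or.inl ⟨u, i, hu, hi, hik, huv, hc.trans (hgrow _ _ _), by
          have := hLL d; omega⟩)
      · by_cases hb : u ≤ D'.base k d
        · exact Or.inl (h1.trans hb)
        · exact Or.inr (Or.inr ⟨u, h1, not_le.1 hb, h3.trans (hLL d),
            (hp.key_insert_le h h3).trans_lt h4⟩)
    · obtain rfl : y = t := by omega
      have hstart : v = 1 ∨ Reach n k T (!d) k y v ∨
          (∃ x v', x < y ∧ v = v' + 1 ∧ Reach n k T (!d) k x v') → j = 1 →
          D'.Knows k T d j v z' := by
        intro h1 hj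
        have h2 := hp.start_le hk h h1
        refine Or.inr (Or.inl ⟨(x d).lab, 1, by simp only [hx]; omega, le_rfl, by omega, ?_, ?_,
          Or.inl hj.le⟩)
        · exact Nat.succ_le_succ h2
        · exact le_trans (by omega) (hgrow' d _ z' hz le_rfl)
      rcases hR.inv with h2 | h2 | h2 | ⟨i₀, x₀, v', hx₀, hT, hR₀, hj, rfl⟩
      · exact hstart (Or.inl h2.2) h2.1
      · exact hstart (Or.inr (Or.inl h2.2)) h2.1
      · exact hstart (Or.inr (Or.inr h2.2)) h2.1
      · have hv' := hR₀.pos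
        rcases h.knows d x₀ i₀ v' _ hx₀ hR₀ hT with h1 | ⟨u, i, hu, hi, hik, huv, hc, hj'⟩ |
          ⟨u, h1, h2, h3, h4⟩
        -- An irrelevant predecessor: the new label alone exceeds its value. Level 1 may be lower
        -- than the true level, but the value is at most `D.L d - k`, so no improvement is lost.
        · have h5 := hbase_lt d
          refine Or.inr (Or.inl ⟨(x d).lab, 1, by omega, le_rfl, by omega, by omega, ?_, ?_⟩)
          · exact le_trans (by omega) (hgrow' d _ z' hz le_rfl)
          · right
            have := hLL d
            unfold Data.base at h1
            omega
        · have hulab : u ≤ (x d).lab := by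
            obtain ⟨a, ha, -, h6⟩ := one_le_count.1 (hi.trans hc)
            exact h6.trans ((h.item d a ha).2.2.trans (le_max_right _ _))
          rcases Nat.lt_or_ge (i + 1) k with hcase | hcase
          · refine Or.inr (Or.inl ⟨u, i + 1, hu, by omega, hcase, by omega, ?_, ?_⟩)
            · exact le_trans (by omega) (hgrow' d u z' hz hulab)
            · have := hLL d
              omega
          -- The climb becomes full at `t`, so the knowledge passes from the row to `F`.
          · have hle := hp.le_z d u hu (by omega)
            have hU : u + k - 1 ≤ newValue k (D.base k d) (w d) (z d) := by
              unfold newValue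
              split_ifs <;> omega
            by_cases hb : u + k - 1 ≤ D'.base k d
            · exact Or.inl (by omega)
            · exact Or.inr (Or.inr ⟨u + k - 1, by omega, not_le.1 hb,
                hU.trans (le_max_right _ _), (hFU d _ (not_le.1 hb) hU).trans_lt hz⟩)
        · have hle := hp.le_w h h3 h4
          have hU : u + 1 ≤ newValue k (D.base k d) (w d) (z d) := by
            unfold newValue
            split_ifs <;> omega
          by_cases hb : u + 1 ≤ D'.base k d
          · exact Or.inl (by omega)
          · exact Or.inr (Or.inr ⟨u + 1, by omega, not_le.1 hb,
              hU.trans (le_max_right _ _), (hFU d _ (not_le.1 hb) hU).trans_lt hz⟩)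

end step


/-! ### Amortized analysis of the scan -/

/-- The part of the potential that is due to the items of a row, when the full sequences of the
opposite direction have value `a` and those of the same direction have value `b`. -/
def weight (a b : ℕ) (R : List Item) : ℕ :=
  (R.map fun x => (a - max x.fin b) + (a + 1 - x.lab)).sum

/-- The potential of a row with `m` free places. -/
def potential (a b m : ℕ) (R : List Item) : ℕ := weight a b R + m * (a - b)

section weight

variable {a b a' b' m : ℕ}

@[simp] theorem weight_nil : weight a b [] = 0 := rfl

theorem weight_cons (x : Item) (R : List Item) :
    weight a b (x :: R) = (a - max x.fin b) + (a + 1 - x.lab) + weight a b R := by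
  simp [weight]

theorem weight_append (R Q : List Item) : weight a b (R ++ Q) = weight a b R + weight a b Q := by
  simp [weight]

/-- Each item has two terms that grow with `a`, at rate at most one; raising `b` only helps. -/
theorem weight_le_of_le (ha : a ≤ a') (hb : b ≤ b') (R : List Item) :
    weight a' b' R ≤ weight a b R + 2 * R.length * (a' - a) := by
  induction R with
  | nil => simp
  | cons x R ih =>
    rw [weight_cons, weight_cons, List.length_cons,
      show 2 * (R.length + 1) * (a' - a) = 2 * R.length * (a' - a) + 2 * (a' - a) by ring]
    omega

theorem potential_le_of_le (ha : a ≤ a') (hb : b ≤ b') (R : List Item) :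
    potential a' b' m R ≤ potential a b m R + 2 * (R.length + m) * (a' - a) := by
  have h1 := weight_le_of_le ha hb R
  have h2 : m * (a' - b') ≤ m * (a - b) + m * (a' - a) := by
    rw [← mul_add]
    exact Nat.mul_le_mul_left m (by omega)
  unfold potential
  have h3 : 2 * (R.length + m) * (a' - a) = 2 * R.length * (a' - a) + 2 * (m * (a' - a)) := by ring
  omega

/-- At each item `min` and `max` merely redistribute the stored and the carried label, so the label
terms are conserved except for the incoming `r` and the discarded last label. -/
theorem weight_cascade_le (r : ℕ) (R : List Item) :
    weight a b (cascade r R) ≤ weight a b R + (a + 1 - r) := by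
  induction R generalizing r with
  | nil => simp [cascade]
  | cons x R ih =>
    rw [cascade, weight_cons, weight_cons]
    have := ih (max r x.lab)
    simp only
    omega

/-- The new item takes the place of the head of `B`, or of a free place with implicit finger `0`.
The rise of the finger pays for the scan above `b`; the label term of the new item is at most `1`,
and the head's label term passes to the cascade. -/
theorem potential_insertion_le {m' : ℕ} {A B : List Item} {x : Item}
    (hm : m' + (1 + (B.length - 1)) = m + B.length) (hw : x.fin ≤ a) (hlab : a ≤ x.lab)
    (hB : ∀ y, B.head? = some y → y.fin ≤ x.fin) :
    potential a b m' (A ++ x :: displace B) +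
        (x.fin - max ((B.head?.map Item.fin).getD 0) b) ≤
      potential a b m (A ++ B) + 1 := by
  unfold potential
  rw [weight_append, weight_append, weight_cons]
  cases B with
  | nil =>
    obtain rfl : m = m' + 1 := by simpa using hm.symm
    simp only [displace, weight_nil, List.head?_nil, Option.map_none,
      Option.getD_none, add_mul, one_mul]
    omega
  | cons y B =>
    have h1 := weight_cascade_le (a := a) (b := b) y.lab B
    have h2 := hB y rfl
    rw [displace, weight_cons]
    obtain rfl : m' = m := by
      rw [List.length_cons] at hm
      omega
    simp only [List.head?_cons, Option.map_some, Option.getD_some]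
    omega

/-- A dropped item has label at most `b`, so its label term alone covers the cost `a - b` of the
free place it leaves. -/
theorem potential_filter_le {c : ℕ} (hc : c ≤ b + 1) (R : List Item) :
    potential a b (m + R.length - (R.filter fun x => decide (c ≤ x.lab)).length)
      (R.filter fun x => decide (c ≤ x.lab)) ≤ potential a b m R := by
  unfold potential
  have h1 : ∀ Q : List Item, (Q.filter fun x => decide (c ≤ x.lab)).length ≤ Q.length := fun Q =>
    List.length_filter_le _ _
  have h2 : weight a b (R.filter fun x => decide (c ≤ x.lab)) +
      (R.length - (R.filter fun x => decide (c ≤ x.lab)).length) * (a - b) ≤ weight a b R := by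
    induction R with
    | nil => simp
    | cons x R ih =>
      have := h1 R
      by_cases hx : c ≤ x.lab
      · rw [List.filter_cons_of_pos (by simpa using hx), weight_cons, weight_cons,
          List.length_cons, List.length_cons, Nat.add_sub_add_right]
        omega
      · rw [List.filter_cons_of_neg (by simpa using hx), weight_cons, List.length_cons,
          Nat.sub_add_comm this, add_mul, one_mul]
        omega
  have := h1 R
  rw [Nat.add_sub_assoc this, add_mul]
  omega

theorem weight_le_of_sublist {R Q : List Item} (h : R.Sublist Q) : weight a b R ≤ weight a b Q :=
  (h.map _).sum_le_sum fun _ _ => Nat.zero_le _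

end weight

/-- The potential that pays for the scan in direction `!d`. -/
def Data.potential (D : Data) (k : ℕ) (d : Bool) : ℕ :=
  Rollercoaster.potential (D.L (!d)) (D.L d) (3 * k + 1 - (D.R d).length) (D.R d)

/-- The value at which the scan in direction `d` starts. -/
def Data.scanStart (D : Data) (k : ℕ) (B : Bool → List Item) (d : Bool) : ℕ :=
  max (D.base k d) (((B (!d)).head?.map Item.fin).getD 0)

theorem exists_key_bound (T : ℕ → ℝ) (R : List Item) : ∃ z, ∀ a ∈ R, T a.pos < z := by
  induction R with
  | nil => simp
  | cons a R ih =>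
    obtain ⟨z, hz⟩ := ih
    refine ⟨max z (T a.pos + 1), fun b hb => ?_⟩
    rcases List.mem_cons.1 hb with rfl | hb
    · exact lt_max_of_lt_right (lt_add_one _)
    · exact lt_max_of_lt_left (hz b hb)

/-- Filtering is `potential_filter_le`. Cutting to length `3 * k` would create a free place not paid
for, but it happens only on overflow. -/
theorem Inv.potential_trim_le {n k t : ℕ} {T : Bool → ℕ → ℝ} {D : Data} (hk : 3 ≤ k)
    (h : Inv n k T (3 * k + 1) t D) (d : Bool) : (D.trim k).potential k d ≤ D.potential k d := by
  have hthr : D.threshold k d ≤ D.L d + 1 := by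
    unfold Data.threshold Data.base
    omega
  have h1 := potential_filter_le (a := D.L (!d)) (m := 3 * k + 1 - (D.R d).length) hthr (D.R d)
  have hlen := h.length d
  rw [Nat.sub_add_cancel hlen] at h1
  refine le_trans ?_ h1
  set Q := (D.R d).filter fun x => decide (D.threshold k d ≤ x.lab) with hQ
  have hR : (D.trim k).R d = Q.take (3 * k) := rfl
  change Rollercoaster.potential (D.L (!d)) (D.L d) _ _ ≤ _
  rw [hR]
  by_cases hcut : Q.length ≤ 3 * k
  · rw [List.take_of_length_le hcut]
  · obtain ⟨z, hz⟩ := exists_key_bound (T d) Q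
    have hcount : count (T d) Q (max 1 (D.threshold k d)) z = Q.length := by
      refine count_eq_length fun a ha => ⟨hz a ha, ?_⟩
      rw [hQ, List.mem_filter] at ha
      have h3 := h.item d a ha.1
      have h4 := of_decide_eq_true ha.2
      omega
    obtain ⟨h2, -⟩ := h.overflow hk (d := d) (z := z) (le_max_left _ _) (le_max_right _ _) (by
      have hsub : Q.Sublist (D.R d) := List.filter_sublist
      have := count_mono_sublist (T := T d) (w := max 1 (D.threshold k d)) (z := z) hsub
      omega)
    unfold Rollercoaster.potential
    -- On overflow `D.L d` exceeds `D.L (!d)`, so free places cost nothing.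
    rw [Nat.sub_eq_zero_of_le (by omega : D.L (!d) ≤ D.L d), mul_zero, mul_zero]
    exact weight_le_of_sublist (List.take_sublist _ _)

/-- The potential pays for the scan above the new `L d`, while the scan starts at the base if the
finger is lower. If the base is the old `D.L d`, the difference is the growth of `L d`; if it is
`D.L (!d) - k`, the part not covered is at most `k`. -/
theorem Probe.potential_insert_le {n k t : ℕ} {T : Bool → ℕ → ℝ} {D : Data}
    {A B : Bool → List Item} {z w : Bool → ℕ} (hk : 3 ≤ k)
    (h : Inv n k T (3 * k) t D) (hp : Probe k T t D A B z w) (d : Bool) :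
    (D.insert k t A B z w).potential k d + (w (!d) - D.scanStart k B (!d)) ≤
      D.potential k d + 2 * (3 * k + 1) * ((D.insert k t A B z w).L (!d) - D.L (!d)) +
        ((D.insert k t A B z w).L d - D.L d) + k + 1 := by
  have hlen := h.length d
  set D' := D.insert k t A B z w with hD'
  have hL : ∀ c, D.L c ≤ D'.L c := fun c => le_max_left _ _
  have h1 := potential_le_of_le (m := 3 * k + 1 - (D.R d).length) (hL (!d)) (hL d) (D.R d)
  rw [Nat.add_sub_cancel' (by omega : (D.R d).length ≤ 3 * k + 1)] at h1
  have hw := hp.w_le (!d)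
  have hl1 : (D.R d).length = (A d).length + (B d).length := by rw [hp.split]; simp
  have hR' : D'.R d = A d ++ ⟨t, max (D'.L (!d)) (D.L (!d) + 1), w (!d)⟩ :: displace (B d) := by
    rw [hD']
    simp only [Data.insert]
  have hl2 : (D'.R d).length = (A d).length + (1 + ((B d).length - 1)) := by rw [hR']; simp; omega
  have h2 := potential_insertion_le (a := D'.L (!d)) (b := D'.L d)
    (m := 3 * k + 1 - (D.R d).length) (m' := 3 * k + 1 - (D'.R d).length) (A := A d)
    (B := B d) (x := ⟨t, max (D'.L (!d)) (D.L (!d) + 1), w (!d)⟩) (by omega) (hw.trans (hL _))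
    (le_max_left _ _) (fun y hy => hp.finger_le (!d) y (by rwa [Bool.not_not]))
  rw [← hp.split, ← hR'] at h2
  have hLd := hL d
  unfold Data.potential Data.scanStart
  unfold Data.base
  rw [Bool.not_not]
  simp only at h2
  generalize ((B d).head?.map Item.fin).getD 0 = f at *
  generalize 2 * (3 * k + 1) * (D'.L (!d) - D.L (!d)) = g at *
  omega


/-! ### Weakest preconditions for programs with running time -/

/-- The program `P`, started in the state `σ`, halts in a state and after a time satisfying `Q`. -/
def Runs {n : ℕ} (S : Fin n → ℝ) (W : ℕ) (P : Cmd) (σ : State) (Q : State → ℕ → Prop) : Prop :=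
  ∃ τ t, Exec S W P σ τ t ∧ Q τ t

section Runs

variable {n : ℕ} {S : Fin n → ℝ} {W : ℕ} {σ : State} {Q : State → ℕ → Prop}

theorem Runs.mono {P : Cmd} {Q' : State → ℕ → Prop} (h : Runs S W P σ Q)
    (hQ : ∀ τ t, Q τ t → Q' τ t) : Runs S W P σ Q' := by
  obtain ⟨τ, t, h1, h2⟩ := h
  exact ⟨τ, t, h1, hQ _ _ h2⟩

theorem runs_skip : Runs S W .skip σ Q ↔ Q σ 1 := by
  constructor
  · rintro ⟨τ, t, h, hQ⟩
    cases h
    exact hQ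
  · exact fun h => ⟨σ, 1, .skip σ, h⟩

theorem runs_assign {x : ℕ} {e : Expr} :
    Runs S W (.assign x e) σ Q ↔ e.Fits W σ ∧ Q (σ.setVar x (e.eval σ)) (e.cost + 1) := by
  constructor
  · rintro ⟨τ, t, h, hQ⟩
    cases h with
    | assign _ _ _ he => exact ⟨he, hQ⟩
  · exact fun h => ⟨_, _, .assign x e σ h.1, h.2⟩

theorem runs_put {a : ℕ} {i e : Expr} :
    Runs S W (.put a i e) σ Q ↔ i.Fits W σ ∧ e.Fits W σ ∧
      Q (σ.setArr a (i.eval σ) (e.eval σ)) (i.cost + e.cost + 1) := by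
  constructor
  · rintro ⟨τ, t, h, hQ⟩
    cases h with
    | put _ _ _ _ hi he => exact ⟨hi, he, hQ⟩
  · exact fun h => ⟨_, _, .put a i e σ h.1 h.2.1, h.2.2⟩

theorem runs_seq {P P' : Cmd} :
    Runs S W (.seq P P') σ Q ↔
      Runs S W P σ fun τ s => Runs S W P' τ fun υ t => Q υ (s + t) := by
  constructor
  · rintro ⟨τ, t, h, hQ⟩
    cases h with
    | seq h1 h2 => exact ⟨_, _, h1, _, _, h2, hQ⟩
  · rintro ⟨τ, s, h1, υ, t, h2, hQ⟩
    exact ⟨_, _, .seq h1 h2, hQ⟩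

theorem runs_ite {b : Test} {P P' : Cmd} :
    Runs S W (.ite b P P') σ Q ↔ b.Safe S W σ ∧
      (b.Holds S σ → Runs S W P σ fun τ t => Q τ (b.cost + t)) ∧
      (¬ b.Holds S σ → Runs S W P' σ fun τ t => Q τ (b.cost + t)) := by
  constructor
  · rintro ⟨τ, t, h, hQ⟩
    cases h with
    | ite_true hs hb h => exact ⟨hs, fun _ => ⟨_, _, h, hQ⟩, fun h' => absurd hb h'⟩
    | ite_false hs hb h => exact ⟨hs, fun h' => absurd h' hb, fun _ => ⟨_, _, h, hQ⟩⟩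
  · rintro ⟨hs, h1, h2⟩
    by_cases hb : b.Holds S σ
    · obtain ⟨τ, t, h, hQ⟩ := h1 hb
      exact ⟨_, _, .ite_true hs hb h, hQ⟩
    · obtain ⟨τ, t, h, hQ⟩ := h2 hb
      exact ⟨_, _, .ite_false hs hb h, hQ⟩

/-- The invariant also sees the time elapsed since the loop was entered; `μ` decreases at each
iteration and gives termination. -/
theorem Runs.loop {b : Test} {P : Cmd} (I : State → ℕ → Prop) (μ : State → ℕ) (h0 : I σ 0)
    (hstep : ∀ τ s, I τ s → b.Safe S W τ ∧
      (b.Holds S τ → Runs S W P τ fun υ t => I υ (s + b.cost + t) ∧ μ υ < μ τ) ∧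
      (¬ b.Holds S τ → Q τ (s + b.cost))) : Runs S W (.loop b P) σ Q := by
  have key : ∀ m τ s, μ τ ≤ m → I τ s → Runs S W (.loop b P) τ fun υ t => Q υ (s + t) := by
    intro m
    induction m with
    | zero =>
      intro τ s hm hI
      obtain ⟨hs, h1, h2⟩ := hstep τ s hI
      by_cases hb : b.Holds S τ
      · obtain ⟨υ, t, -, -, hlt⟩ := h1 hb
        omega
      · exact ⟨_, _, .loop_false hs hb, h2 hb⟩
    | succ m ih =>
      intro τ s hm hI
      obtain ⟨hs, h1, h2⟩ := hstep τ s hI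
      by_cases hb : b.Holds S τ
      · obtain ⟨υ, t, hP, hI', hlt⟩ := h1 hb
        obtain ⟨ω, u, hL, hQ⟩ := ih υ _ (by omega) hI'
        exact ⟨_, _, .loop_true hs hb hP hL, by rwa [add_assoc, add_assoc, ← add_assoc s] at *⟩
      · exact ⟨_, _, .loop_false hs hb, h2 hb⟩
  simpa using key _ σ 0 le_rfl h0

@[simp] theorem State.setVar_var (x v y : ℕ) :
    (σ.setVar x v).var y = if y = x then v else σ.var y := by
  simp [State.setVar, Function.update_apply]

@[simp] theorem State.setVar_arr (x v : ℕ) : (σ.setVar x v).arr = σ.arr := rfl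

@[simp] theorem State.setArr_var (a i v : ℕ) : (σ.setArr a i v).var = σ.var := rfl

@[simp] theorem State.setArr_arr (a i v b j : ℕ) :
    (σ.setArr a i v).arr b j = if b = a ∧ j = i then v else σ.arr b j := by
  simp only [State.setArr, Function.update_apply]
  by_cases h1 : b = a
  · subst h1
    by_cases h2 : j = i <;> simp [h2]
  · simp [h1]

@[simp] theorem State.setVar_setVar (x v w : ℕ) : (σ.setVar x v).setVar x w = σ.setVar x w := by
  simp [State.setVar]

/-- Comparison of two keys in direction `d`. -/
def keyLt (d : Bool) (e f : Expr) : Test := if d then .key e f else .key f e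

theorem keyLt_cost (d : Bool) (e f : Expr) : (keyLt d e f).cost = e.cost + f.cost + 1 := by
  cases d <;> simp [keyLt, Test.cost]
  omega

theorem keyLt_safe (d : Bool) (e f : Expr) :
    (keyLt d e f).Safe S W σ ↔ (e.Fits W σ ∧ e.eval σ < n) ∧ (f.Fits W σ ∧ f.eval σ < n) := by
  cases d <;> simp [keyLt, Test.Safe]
  tauto

theorem keyLt_holds (d : Bool) {e f : Expr} (he : e.eval σ < n) (hf : f.eval σ < n) :
    (keyLt d e f).Holds S σ ↔ key S d (e.eval σ) < key S d (f.eval σ) := by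
  cases d <;> simp [keyLt, Test.Holds, key, he, hf]

end Runs

/-! ### Memory layout -/

/-- Numbers of variables and arrays, in pairs. -/
def slot (i : ℕ) (d : Bool) : ℕ := 2 * i + d.toNat

@[simp] theorem slot_inj {i j : ℕ} {d c : Bool} : slot i d = slot j c ↔ i = j ∧ d = c := by
  unfold slot
  cases d <;> cases c <;> simp <;> omega

/-- `τ` arises from `σ` by changing only variables in `X`, auxiliary variables, and arrays
in `Y`. -/
def Frame (X Y : List ℕ) (σ τ : State) : Prop :=
  (∀ i d, i < 10 → slot i d ∉ X → τ.var (slot i d) = σ.var (slot i d)) ∧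
    ∀ i d, slot i d ∉ Y → τ.arr (slot i d) = σ.arr (slot i d)

/-- The variable that holds `n`. -/
abbrev xN : ℕ := slot 0 false

/-- The variable that holds `k`. -/
abbrev xK : ℕ := slot 0 true

/-- The current position. -/
abbrev xT : ℕ := slot 1 false

/-- The largest value of a full sequence. -/
abbrev xL (d : Bool) : ℕ := slot 2 d

/-- The length of the row. -/
abbrev xM (d : Bool) : ℕ := slot 3 d

/-- The place of the current position in the row. -/
abbrev xP (d : Bool) : ℕ := slot 4 d

/-- The best label of a sequence of `k - 1` elements below the current position. -/
abbrev xZ (d : Bool) : ℕ := slot 5 d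

/-- The result of the scan. -/
abbrev xW (d : Bool) : ℕ := slot 6 d

/-- The new value of the current position, and then the new value of `xL d`. -/
abbrev xU (d : Bool) : ℕ := slot 7 d

/-- Best endpoints for each value. -/
abbrev aF (d : Bool) : ℕ := slot 0 d

/-- Positions of the items of the row. -/
abbrev aP (d : Bool) : ℕ := slot 1 d

/-- Labels of the items of the row. -/
abbrev aL (d : Bool) : ℕ := slot 2 d

/-- Fingers of the items of the row. -/
abbrev aG (d : Bool) : ℕ := slot 3 d

/-- Auxiliary variables. -/
abbrev aux (i : ℕ) : ℕ := slot (10 + i) false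

/-! ### Searching a row and selecting a label -/

/-- Find the place of the key of position `x` in the sorted array `a` with `m` cells. -/
def findPlace (d : Bool) (a m p x : ℕ) : Cmd :=
  .seq (.assign p (.const 0))
    (.loop (.and (.lt (.var p) (.var m)) (keyLt d (.get a (.var p)) (.var x)))
      (.assign p (.add (.var p) (.const 1))))

theorem runs_findPlace {n : ℕ} {S : Fin n → ℝ} {W : ℕ} {σ : State} {d : Bool} {a m p x : ℕ}
    (hpm : p ≠ m) (hpx : p ≠ x) (hm : σ.var m + 2 ≤ W) (hn : n ≤ W)
    (ha : ∀ i < σ.var m, σ.arr a i < n) (hx : σ.var x < n) :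
    Runs S W (findPlace d a m p x) σ fun τ t => t ≤ 12 * σ.var m + 20 ∧
      ∃ i, τ = σ.setVar p i ∧ i ≤ σ.var m ∧
        (∀ j < i, key S d (σ.arr a j) < key S d (σ.var x)) ∧
        (i < σ.var m → ¬ key S d (σ.arr a i) < key S d (σ.var x)) := by
  unfold findPlace
  rw [runs_seq, runs_assign]
  refine ⟨by simp [Expr.Fits]; omega, ?_⟩
  refine Runs.loop (fun τ s => ∃ i, τ = σ.setVar p i ∧ i ≤ σ.var m ∧ s ≤ 12 * i ∧
    ∀ j < i, key S d (σ.arr a j) < key S d (σ.var x)) (fun τ => σ.var m - τ.var p) ?_ ?_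
  · exact ⟨0, by simp [Expr.eval]⟩
  · rintro τ s ⟨i, rfl, hi, hs, hlow⟩
    have hev : (Expr.get a (.var p)).eval (σ.setVar p i) = σ.arr a i := by simp [Expr.eval]
    have hex : (Expr.var x).eval (σ.setVar p i) = σ.var x := by simp [Expr.eval, hpx.symm]
    have hlt : (Test.lt (.var p) (.var m)).Holds S (σ.setVar p i) ↔ i < σ.var m := by
      simp [Test.Holds, Expr.eval, hpm.symm]
    have hkey : i < σ.var m → ((keyLt d (.get a (.var p)) (.var x)).Holds S (σ.setVar p i) ↔
        key S d (σ.arr a i) < key S d (σ.var x)) := fun h => by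
      rw [keyLt_holds d (by rw [hev]; exact ha i h) (by rw [hex]; exact hx), hev, hex]
    have hcost : (Test.and (.lt (.var p) (.var m))
        (keyLt d (.get a (.var p)) (.var x))).cost = 8 := by
      simp [Test.cost, keyLt_cost, Expr.cost]
    rw [hcost]
    refine ⟨⟨?_, ?_⟩, ?_, ?_⟩
    · simp [Test.Safe, Expr.Fits, hpm.symm]; omega
    · intro h
      rw [hlt] at h
      rw [keyLt_safe, hev, hex]
      have := ha i h
      simp [Expr.Fits, hpx.symm, Expr.eval]
      omega
    · rintro ⟨h1, h2⟩
      rw [hlt] at h1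
      rw [hkey h1] at h2
      rw [runs_assign]
      refine ⟨by simp [Expr.Fits, Expr.eval]; omega, ⟨i + 1, ?_, h1, ?_, ?_⟩, ?_⟩
      · simp [Expr.eval]
      · simp [Expr.cost]; omega
      · intro j hj
        rcases Nat.lt_or_ge j i with h | h
        · exact hlow j h
        · obtain rfl : j = i := by omega
          exact h2
      · simp [Expr.eval]; omega
    · intro h
      refine ⟨by simp [Expr.cost]; omega, i, rfl, hi, hlow, fun h1 h2 => h ⟨hlt.2 h1, ?_⟩⟩
      exact (hkey h1).2 h2


/-- Determine the best label `z` of a sequence of `k - 1` elements below the current position. -/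
def selectLabel (d : Bool) : Cmd :=
  .seq (.assign (xZ d) (.const 0)) <|
  .seq (.assign (aux 0) (.const 0)) <|
  .loop (.lt (.var (aux 0)) (.var (xP d))) <|
    .seq (.assign (aux 1) (.const 0)) <|
    .seq (.assign (aux 2) (.const 0)) <|
    .seq
      (.loop (.lt (.var (aux 1)) (.var (xP d))) <|
        .seq (.ite (.lt (.get (aL d) (.var (aux 1))) (.get (aL d) (.var (aux 0)))) .skip
          (.assign (aux 2) (.add (.var (aux 2)) (.const 1))))
          (.assign (aux 1) (.add (.var (aux 1)) (.const 1)))) <|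
    .seq
      (.ite (.and (.not (.lt (.add (.var (aux 2)) (.const 1)) (.var xK)))
          (.lt (.var (xZ d)) (.get (aL d) (.var (aux 0)))))
        (.assign (xZ d) (.get (aL d) (.var (aux 0)))) .skip) <|
    .assign (aux 0) (.add (.var (aux 0)) (.const 1))

/-- The number of the first `p` entries of `f` that are at least `l`. -/
def countGe (f : ℕ → ℕ) (p l : ℕ) : ℕ := (List.range p).countP fun j => decide (l ≤ f j)

theorem countGe_succ (f : ℕ → ℕ) (p l : ℕ) :
    countGe f (p + 1) l = countGe f p l + if l ≤ f p then 1 else 0 := by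
  simp [countGe, List.range_succ, List.countP_append, List.countP_cons]

theorem countGe_le (f : ℕ → ℕ) (p l : ℕ) : countGe f p l ≤ p := by
  simpa [countGe] using List.countP_le_length (p := fun j => decide (l ≤ f j)) (l := List.range p)

section

variable {n : ℕ} {S : Fin n → ℝ} {W : ℕ} {σ : State} {d : Bool}

theorem runs_selectLabel_inner (hp : σ.var (xP d) + 2 ≤ W)
    (ha : ∀ i < σ.var (xP d), σ.arr (aL d) i < W) (hi : σ.var (aux 0) < σ.var (xP d))
    (h1 : σ.var (aux 1) = 0) (h2 : σ.var (aux 2) = 0) :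
    Runs S W (.loop (.lt (.var (aux 1)) (.var (xP d))) <|
        .seq (.ite (.lt (.get (aL d) (.var (aux 1))) (.get (aL d) (.var (aux 0)))) .skip
          (.assign (aux 2) (.add (.var (aux 2)) (.const 1))))
          (.assign (aux 1) (.add (.var (aux 1)) (.const 1)))) σ fun τ t =>
      t ≤ 16 * σ.var (xP d) + 3 ∧ τ.arr = σ.arr ∧
        (∀ x, x ≠ aux 1 → x ≠ aux 2 → τ.var x = σ.var x) ∧
        τ.var (aux 2) = countGe (σ.arr (aL d)) (σ.var (xP d)) (σ.arr (aL d) (σ.var (aux 0))) := by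
  refine Runs.loop (fun τ s => s ≤ 16 * τ.var (aux 1) ∧ τ.var (aux 1) ≤ σ.var (xP d) ∧
    τ.arr = σ.arr ∧ (∀ x, x ≠ aux 1 → x ≠ aux 2 → τ.var x = σ.var x) ∧
    τ.var (aux 2) = countGe (σ.arr (aL d)) (τ.var (aux 1)) (σ.arr (aL d) (σ.var (aux 0))))
    (fun τ => σ.var (xP d) - τ.var (aux 1)) ?_ ?_
  · simp [h1, h2, countGe]
  · rintro τ s ⟨hs, hj, harr, hvar, hc⟩
    have e0 := hvar (aux 0) (by simp) (by simp)
    have ep := hvar (xP d) (by simp) (by simp)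
    have hle := countGe_le (σ.arr (aL d)) (τ.var (aux 1)) (σ.arr (aL d) (σ.var (aux 0)))
    have hsucc := countGe_succ (σ.arr (aL d)) (τ.var (aux 1)) (σ.arr (aL d) (σ.var (aux 0)))
    have hai := ha _ hi
    refine ⟨by simp [Test.Safe, Expr.Fits, ep]; omega, ?_, ?_⟩
    · intro hlt
      replace hlt : τ.var (aux 1) < σ.var (xP d) := by simpa [Test.Holds, Expr.eval, ep] using hlt
      have haj := ha _ hlt
      simp only [runs_seq, runs_ite, runs_skip, runs_assign]
      refine ⟨by simp [Test.Safe, Expr.Fits, Expr.eval, harr, e0]; omega, ?_, ?_⟩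
      · intro hb
        simp [Test.Holds, Expr.eval, harr, e0] at hb
        refine ⟨by simp [Expr.Fits, Expr.eval]; omega, ⟨?_, ?_, ?_, ?_, ?_⟩, ?_⟩
        · simp [Expr.cost, Test.cost, Expr.eval]; omega
        · simp [Expr.eval]; omega
        · simp [harr]
        · intro x hx1 hx2
          simp [hx1, hvar x hx1 hx2]
        · simp [Expr.eval, hc, hsucc, hb]
        · simp [Expr.eval]; omega
      · intro hb
        simp [Test.Holds, Expr.eval, harr, e0] at hb
        refine ⟨by simp [Expr.Fits, Expr.eval]; omega,
          by simp [Expr.Fits, Expr.eval]; omega, ⟨?_, ?_, ?_, ?_, ?_⟩, ?_⟩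
        · simp [Expr.cost, Test.cost, Expr.eval]; omega
        · simp [Expr.eval]; omega
        · simp [harr]
        · intro x hx1 hx2
          simp [hx1, hx2, hvar x hx1 hx2]
        · simp [Expr.eval, hc, hsucc, hb]
        · simp [Expr.eval]; omega
    · intro hlt
      replace hlt : ¬ τ.var (aux 1) < σ.var (xP d) := by
        simpa [Test.Holds, Expr.eval, ep] using hlt
      obtain hj' : τ.var (aux 1) = σ.var (xP d) := by omega
      exact ⟨by simp [Test.cost, Expr.cost]; omega, harr, hvar, by rw [hc, hj']⟩

/-- Every item below the current position is tried as a candidate, and its label is compared with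
all the others; this is the only quadratic step. Only labels occurring in the row need to be tried,
see `Selected.le_of_countGe`. -/
theorem runs_selectLabel (hp : σ.var (xP d) + 2 ≤ W)
    (ha : ∀ i < σ.var (xP d), σ.arr (aL d) i < W) (hk : σ.var xK < W) :
    Runs S W (selectLabel d) σ fun τ t => t ≤ 60 * (σ.var (xP d) + 1) ^ 2 ∧
      Frame [xZ d] [] σ τ ∧
        (∀ i < σ.var (xP d), σ.var xK ≤
          countGe (σ.arr (aL d)) (σ.var (xP d)) (σ.arr (aL d) i) + 1 →
            σ.arr (aL d) i ≤ τ.var (xZ d)) ∧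
        (τ.var (xZ d) = 0 ∨ ∃ i < σ.var (xP d), τ.var (xZ d) = σ.arr (aL d) i ∧ σ.var xK ≤
          countGe (σ.arr (aL d)) (σ.var (xP d)) (σ.arr (aL d) i) + 1) := by
  set p := σ.var (xP d) with hpdef
  set f := σ.arr (aL d) with hf
  unfold selectLabel
  simp only [runs_seq, runs_assign]
  refine ⟨by simp [Expr.Fits]; omega, by simp [Expr.Fits]; omega, ?_⟩
  refine Runs.loop (fun τ s => s ≤ (16 * p + 60) * τ.var (aux 0) ∧ τ.var (aux 0) ≤ p ∧
    τ.arr = σ.arr ∧ (∀ x, x ≠ xZ d → x ≠ aux 0 → x ≠ aux 1 → x ≠ aux 2 → τ.var x = σ.var x) ∧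
    (∀ i < τ.var (aux 0), σ.var xK ≤ countGe f p (f i) + 1 → f i ≤ τ.var (xZ d)) ∧
    (τ.var (xZ d) = 0 ∨ ∃ i < p, τ.var (xZ d) = f i ∧ σ.var xK ≤ countGe f p (f i) + 1))
    (fun τ => p - τ.var (aux 0)) ?_ ?_
  · refine ⟨by simp, by simp [Expr.eval], by simp, ?_, by simp [Expr.eval], by simp [Expr.eval]⟩
    intro x h1 h2 _ _
    simp [h1, h2]
  · rintro τ s ⟨hs, hi, harr, hvar, hmax, hz⟩
    have ep : τ.var (xP d) = p := hvar (xP d) (by simp) (by simp) (by simp) (by simp)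
    have ek := hvar xK (by simp) (by simp) (by simp) (by simp)
    refine ⟨by simp [Test.Safe, Expr.Fits, ep]; omega, ?_, ?_⟩
    · intro hlt
      replace hlt : τ.var (aux 0) < p := by simpa [Test.Holds, Expr.eval, ep] using hlt
      simp only [runs_seq, runs_assign]
      refine ⟨by simp [Expr.Fits]; omega, by simp [Expr.Fits]; omega, ?_⟩
      refine (runs_selectLabel_inner (d := d) (by simpa [ep] using hp)
        (by simpa [ep, harr] using ha) (by simpa [ep] using hlt) (by simp [Expr.eval])
        (by simp [Expr.eval])).mono ?_
      rintro υ t ⟨ht, hυarr, hυvar, hυc⟩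
      simp only [State.setVar_arr] at hυarr
      rw [harr] at hυarr
      have hc : υ.var (aux 2) = countGe f p (f (τ.var (aux 0))) := by
        simpa [ep, harr] using hυc
      have hcp := countGe_le f p (f (τ.var (aux 0)))
      have h0 : υ.var (aux 0) = τ.var (aux 0) := by
        simpa using hυvar (aux 0) (by simp) (by simp)
      have hυv : ∀ x, x ≠ aux 1 → x ≠ aux 2 → υ.var x = τ.var x := fun x h1 h2 => by
        simpa [h1, h2] using hυvar x h1 h2
      have hυk : υ.var xK = σ.var xK := by rw [hυv xK (by simp) (by simp), ek]
      have hυz := hυv (xZ d) (by simp) (by simp)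
      have hfi := ha _ hlt
      have hfi' : σ.arr (aL d) (τ.var (aux 0)) < W := hfi
      have hzW : τ.var (xZ d) < W := by
        rcases hz with hz | ⟨i, hi, hz, -⟩
        · omega
        · rw [hz]; exact ha i hi
      simp [ep] at ht
      simp only [runs_ite, runs_skip, runs_assign]
      have hcost : (Test.and (.not (.lt (.add (.var (aux 2)) (.const 1)) (.var xK)))
          (.lt (.var (xZ d)) (.get (aL d) (.var (aux 0))))).cost = 11 := by
        simp [Test.cost, Expr.cost]
      have hholds : (Test.and (.not (.lt (.add (.var (aux 2)) (.const 1)) (.var xK)))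
          (.lt (.var (xZ d)) (.get (aL d) (.var (aux 0))))).Holds S υ ↔
          σ.var xK ≤ countGe f p (f (τ.var (aux 0))) + 1 ∧ τ.var (xZ d) < f (τ.var (aux 0)) := by
        simp [Test.Holds, Expr.eval, hc, hυk, hυz, hυarr, h0, hf]
      rw [hholds, hcost]
      have hmul : (16 * p + 60) * (τ.var (aux 0) + 1) = (16 * p + 60) * τ.var (aux 0) +
        16 * p + 60 := by ring
      refine ⟨?_, ?_, ?_⟩
      · simp [Test.Safe, Expr.Fits, Expr.eval, hc, hυk, hυz, hυarr, h0]
        omega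
      · rintro ⟨hb1, hb2⟩
        refine ⟨by simp [Expr.Fits, Expr.eval, hυarr, h0]; omega,
          by simp [Expr.Fits, Expr.eval, h0]; omega, ⟨?_, ?_, ?_, ?_, ?_, ?_⟩, ?_⟩
        · simp [Expr.cost, Test.cost, Expr.eval, h0, hmul]; omega
        · simp [Expr.eval, h0]; omega
        · simp [hυarr]
        · intro x h1 h2 h3 h4
          simp [h1, h2, hυv x h3 h4, hvar x h1 h2 h3 h4]
        · intro i hi' hle
          simp [Expr.eval, h0, hυarr] at hi' ⊢
          rcases Nat.lt_or_ge i (τ.var (aux 0)) with h | h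
          · exact (hmax i h hle).trans hb2.le
          · obtain rfl : i = τ.var (aux 0) := by omega
            exact le_rfl
        · right
          exact ⟨τ.var (aux 0), hlt, by simp [Expr.eval, h0, hυarr, hf], hb1⟩
        · simp [Expr.eval, h0]; omega
      · intro hb
        refine ⟨by simp [Expr.Fits, Expr.eval, h0]; omega, ⟨?_, ?_, ?_, ?_, ?_, ?_⟩, ?_⟩
        · simp [Expr.cost, Test.cost, Expr.eval, h0, hmul]; omega
        · simp [Expr.eval, h0]; omega
        · simp [hυarr]
        · intro x h1 h2 h3 h4
          simp [h2, hυv x h3 h4, hvar x h1 h2 h3 h4]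
        · intro i hi' hle
          simp [Expr.eval, h0, hυz] at hi' ⊢
          rcases Nat.lt_or_ge i (τ.var (aux 0)) with h | h
          · exact hmax i h hle
          · obtain rfl : i = τ.var (aux 0) := by omega
            exact not_lt.1 fun h' => hb ⟨hle, h'⟩
        · simpa [hυz] using hz
        · simp [Expr.eval, h0]; omega
    · intro hlt
      replace hlt : ¬ τ.var (aux 0) < p := by simpa [Test.Holds, Expr.eval, ep] using hlt
      obtain hi' : τ.var (aux 0) = p := by omega
      rw [hi'] at hs hmax
      refine ⟨?_, ⟨?_, ?_⟩, hmax, hz⟩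
      · simp [Test.cost, Expr.cost]
        nlinarith
      · intro i c hi hX
        exact hvar _ (by simpa using hX) (by simp; omega) (by simp; omega) (by simp; omega)
      · intro i c _
        rw [harr]

end


/-! ### The scan over full values and the update of the endpoints -/

/-- Store in `aux 0` the irrelevance bound that belongs to the values in the variables `x` (same
direction) and `y` (opposite direction). -/
def baseValue (x y : ℕ) : Cmd :=
  .seq (.assign (aux 0) (.sub (.var x) (.var xK)))
    (.ite (.lt (.var y) (.var (aux 0))) (.assign (aux 0) (.var y)) .skip)

/-- Move the scan pointer from the irrelevance bound to the finger. -/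
def scanInit (d : Bool) : Cmd :=
  .seq (.assign (xW d) (.var (aux 0)))
    (.ite (.and (.lt (.var (xP (!d))) (.var (xM (!d))))
        (.lt (.var (xW d)) (.get (aG (!d)) (.var (xP (!d))))))
      (.assign (xW d) (.get (aG (!d)) (.var (xP (!d))))) .skip)

/-- Move the scan pointer upwards. -/
def scanLoop (d : Bool) : Cmd :=
  .loop (.and (.lt (.var (xW d)) (.var (xL d)))
      (keyLt d (.get (aF d) (.add (.var (xW d)) (.const 1))) (.var xT)))
    (.assign (xW d) (.add (.var (xW d)) (.const 1)))

/-- Compute the new value from the result of the scan. -/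
def scanValue (d : Bool) : Cmd :=
  .seq (.assign (xU d) (.const 0)) <|
  .seq (.ite (.lt (.var (aux 0)) (.var (xW d)))
      (.assign (xU d) (.add (.var (xW d)) (.const 1))) .skip)
    (.ite (.and (.lt (.const 0) (.var (xZ d)))
        (.lt (.var (xU d)) (.sub (.add (.var (xZ d)) (.var xK)) (.const 1))))
      (.assign (xU d) (.sub (.add (.var (xZ d)) (.var xK)) (.const 1))) .skip)

/-- Enter the current position as the best endpoint of the values from `xW d + 1` to `xU d`, and
update the largest value. -/
def fillValues (d : Bool) : Cmd :=
  .seq (.assign (aux 0) (.var (xW d))) <|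
  .seq (.loop (.lt (.var (aux 0)) (.var (xU d)))
      (.seq (.assign (aux 0) (.add (.var (aux 0)) (.const 1)))
        (.put (aF d) (.var (aux 0)) (.var xT))))
    (.ite (.lt (.var (xU d)) (.var (xL d))) (.assign (xU d) (.var (xL d))) .skip)

section

variable {n : ℕ} {S : Fin n → ℝ} {W : ℕ} {σ : State} {d : Bool}

theorem runs_baseValue {x y : ℕ} (hy : y ≠ aux 0) (hxW : σ.var x < W)
    (hyW : σ.var y < W) (hk : σ.var xK < W) :
    Runs S W (baseValue x y) σ fun τ t => t ≤ 12 ∧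
      τ = σ.setVar (aux 0) (min (σ.var y) (σ.var x - σ.var xK)) := by
  unfold baseValue
  simp only [runs_seq, runs_assign, runs_ite, runs_skip]
  simp only [Expr.Fits, Expr.eval, Expr.cost, Test.Safe, Test.Holds, Test.cost,
    State.setVar_var, hy, if_false, if_true, State.setVar_setVar]
  refine ⟨⟨hxW, hk⟩, ⟨hyW, by omega⟩, fun h => ⟨hyW, by omega, ?_⟩, fun h => ⟨by omega, ?_⟩⟩
  · rw [min_eq_left h.le]
  · rw [min_eq_right (not_lt.1 h)]

theorem runs_scanInit (hb : σ.var (aux 0) < W)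
    (hm : σ.var (xM (!d)) < W) (hp : σ.var (xP (!d)) < W)
    (hG : ∀ i < σ.var (xM (!d)), σ.arr (aG (!d)) i < W) :
    Runs S W (scanInit d) σ fun τ t => t ≤ 20 ∧ τ = σ.setVar (xW d) (max (σ.var (aux 0))
      (if σ.var (xP (!d)) < σ.var (xM (!d)) then σ.arr (aG (!d)) (σ.var (xP (!d))) else 0)) := by
  unfold scanInit
  simp only [runs_seq, runs_assign, runs_ite, runs_skip]
  have e1 : ∀ c, xP c ≠ xW d := fun c => by simp
  have e2 : ∀ c, xM c ≠ xW d := fun c => by simp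
  simp only [Expr.Fits, Expr.eval, Expr.cost, Test.Safe, Test.Holds, Test.cost,
    State.setVar_var, State.setVar_arr, State.setVar_setVar, e1, e2, if_false, if_true]
  refine ⟨hb, ⟨⟨hp, hm⟩, fun h => ⟨hb, hp, hG _ h⟩⟩, fun h => ⟨⟨hp, hG _ h.1⟩, by omega, ?_⟩,
    fun h => ⟨by omega, ?_⟩⟩
  · rw [if_pos h.1, max_eq_right h.2.le]
  · split_ifs with h1
    · rw [max_eq_left (not_lt.1 fun h2 => h ⟨h1, h2⟩)]
    · rw [max_eq_left (Nat.zero_le _)]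

theorem runs_scanLoop (hL : σ.var (xL d) + 2 ≤ W) (hw : σ.var (xW d) ≤ σ.var (xL d))
    (hF : ∀ v, 1 ≤ v → v ≤ σ.var (xL d) → σ.arr (aF d) v < n) (hn : n ≤ W)
    (hT : σ.var xT < n) :
    Runs S W (scanLoop d) σ fun τ t => ∃ w, τ = σ.setVar (xW d) w ∧
      t ≤ 14 * (w - σ.var (xW d)) + 10 ∧ σ.var (xW d) ≤ w ∧ w ≤ σ.var (xL d) ∧
      (w = σ.var (xW d) ∨ key S d (σ.arr (aF d) w) < key S d (σ.var xT)) ∧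
      (w < σ.var (xL d) → ¬ key S d (σ.arr (aF d) (w + 1)) < key S d (σ.var xT)) := by
  refine Runs.loop (fun τ s => ∃ w, τ = σ.setVar (xW d) w ∧
      s ≤ 14 * (w - σ.var (xW d)) ∧ σ.var (xW d) ≤ w ∧ w ≤ σ.var (xL d) ∧
      (w = σ.var (xW d) ∨ key S d (σ.arr (aF d) w) < key S d (σ.var xT)))
    (fun τ => σ.var (xL d) - τ.var (xW d)) ?_ ?_
  · exact ⟨σ.var (xW d), by simp [State.setVar], by simp, le_rfl, hw, Or.inl rfl⟩
  · rintro τ s ⟨w, rfl, hs, hw1, hw2, hw3⟩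
    have hev : (Expr.get (aF d) (.add (.var (xW d)) (.const 1))).eval (σ.setVar (xW d) w) =
        σ.arr (aF d) (w + 1) := by simp [Expr.eval]
    have hex : (Expr.var xT).eval (σ.setVar (xW d) w) = σ.var xT := by simp [Expr.eval]
    have hlt : (Test.lt (.var (xW d)) (.var (xL d))).Holds S (σ.setVar (xW d) w) ↔
        w < σ.var (xL d) := by
      simp [Test.Holds, Expr.eval]
    have hFw : w < σ.var (xL d) → σ.arr (aF d) (w + 1) < n := fun h => hF _ (by omega) h
    have hkey : w < σ.var (xL d) → ((keyLt d (.get (aF d) (.add (.var (xW d)) (.const 1)))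
        (.var xT)).Holds S (σ.setVar (xW d) w) ↔
        key S d (σ.arr (aF d) (w + 1)) < key S d (σ.var xT)) := fun h => by
      rw [keyLt_holds d (by rw [hev]; exact hFw h) (by rw [hex]; exact hT), hev, hex]
    have hcost : (Test.and (.lt (.var (xW d)) (.var (xL d)))
        (keyLt d (.get (aF d) (.add (.var (xW d)) (.const 1))) (.var xT))).cost = 10 := by
      simp [Test.cost, keyLt_cost, Expr.cost]
    rw [hcost]
    refine ⟨⟨?_, ?_⟩, ?_, ?_⟩
    · simp [Test.Safe, Expr.Fits]; omega
    · intro h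
      rw [hlt] at h
      rw [keyLt_safe, hev, hex]
      have := hFw h
      simp [Expr.Fits, Expr.eval]
      omega
    · rintro ⟨h1, h2⟩
      rw [hlt] at h1
      rw [hkey h1] at h2
      rw [runs_assign]
      refine ⟨by simp [Expr.Fits, Expr.eval]; omega, ⟨w + 1, ?_, ?_, by omega, h1, Or.inr h2⟩, ?_⟩
      · simp [Expr.eval]
      · simp [Expr.cost]; omega
      · simp [Expr.eval]; omega
    · intro h
      refine ⟨w, rfl, by omega, hw1, hw2, hw3, fun h1 h2 => h ⟨hlt.2 h1, (hkey h1).2 h2⟩⟩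

theorem runs_scanValue (hb : σ.var (aux 0) < W) (hw : σ.var (xW d) + 2 ≤ W)
    (hz : σ.var (xZ d) + σ.var xK < W) :
    Runs S W (scanValue d) σ fun τ t => t ≤ 40 ∧ τ = σ.setVar (xU d)
      (newValue (σ.var xK) (σ.var (aux 0)) (σ.var (xW d)) (σ.var (xZ d))) := by
  unfold scanValue newValue
  simp only [runs_seq, runs_assign, runs_ite, runs_skip]
  have e1 : aux 0 ≠ xU d := by simp
  have e2 : xW d ≠ xU d := by simp
  have e3 : xZ d ≠ xU d := by simp
  have e4 : xK ≠ xU d := by simp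
  simp only [Expr.Fits, Expr.eval, Expr.cost, Test.Safe, Test.Holds, Test.cost,
    State.setVar_var, State.setVar_setVar, e1, e2, e3, e4, if_false, if_true]
  refine ⟨by omega, by omega, fun h => ⟨by omega, by omega, fun h1 => ⟨by omega, by omega, ?_⟩,
    fun h1 => ⟨by omega, ?_⟩⟩, fun h => ⟨by omega, fun h1 => ⟨by omega, by omega, ?_⟩,
    fun h1 => ⟨by omega, ?_⟩⟩⟩
  all_goals
    congr 1
    simp only [h, if_true, if_false]
    split_ifs <;> omega

theorem runs_fillValues (hU : σ.var (xU d) + 2 ≤ W) (hw : σ.var (xW d) < W)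
    (hL : σ.var (xL d) < W) (hT : σ.var xT < W) :
    Runs S W (fillValues d) σ fun τ t =>
      t ≤ 10 * (σ.var (xU d) - σ.var (xW d)) + 20 ∧ Frame [xU d] [aF d] σ τ ∧
      τ.var (xU d) = max (σ.var (xL d)) (σ.var (xU d)) ∧
      ∀ v, τ.arr (aF d) v =
        if σ.var (xW d) < v ∧ v ≤ σ.var (xU d) then σ.var xT else σ.arr (aF d) v := by
  unfold fillValues
  rw [runs_seq, runs_assign]
  refine ⟨by simpa [Expr.Fits] using hw, ?_⟩
  rw [runs_seq]
  -- The upper bound is a maximum because `xU d` may lie below `xW d`, in which case nothing is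
  -- written.
  refine Runs.loop (fun τ s => s ≤ 10 * (τ.var (aux 0) - σ.var (xW d)) ∧
    σ.var (xW d) ≤ τ.var (aux 0) ∧ τ.var (aux 0) ≤ max (σ.var (xW d)) (σ.var (xU d)) ∧
    (∀ x, x ≠ aux 0 → τ.var x = σ.var x) ∧ (∀ i c, slot i c ≠ aF d →
      τ.arr (slot i c) = σ.arr (slot i c)) ∧
    ∀ v, τ.arr (aF d) v = if σ.var (xW d) < v ∧ v ≤ τ.var (aux 0) then σ.var xT
      else σ.arr (aF d) v) (fun τ => σ.var (xU d) - τ.var (aux 0)) ?_ ?_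
  · refine ⟨by simp, by simp [Expr.eval], by simp [Expr.eval], ?_, by simp, ?_⟩
    · intro x hx
      simp [hx]
    · intro v
      simp [Expr.eval]
  · rintro τ s ⟨hs, h1, h2, hvar, harr, hF⟩
    have eU := hvar (xU d) (by simp)
    have eT := hvar xT (by simp)
    have eL := hvar (xL d) (by simp)
    refine ⟨by simp [Test.Safe, Expr.Fits, eU]; omega, ?_, ?_⟩
    · intro hlt
      replace hlt : τ.var (aux 0) < σ.var (xU d) := by simpa [Test.Holds, Expr.eval, eU] using hlt
      simp only [runs_seq, runs_assign, runs_put]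
      refine ⟨by simp [Expr.Fits, Expr.eval]; omega, by simp [Expr.Fits, Expr.eval]; omega,
        by simp [Expr.Fits, eT]; omega, ⟨?_, ?_, ?_, ?_, ?_, ?_⟩, ?_⟩
      · simp [Expr.cost, Test.cost, Expr.eval]; omega
      · simp [Expr.eval]; omega
      · simp [Expr.eval]; omega
      · intro x hx
        simp [hx, hvar x hx]
      · intro i c hc
        funext v
        rw [State.setArr_arr, if_neg (fun h => hc h.1), State.setVar_arr, harr i c hc]
      · intro v
        simp only [State.setArr_arr, State.setArr_var, State.setVar_var, State.setVar_arr,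
          Expr.eval, hF, true_and, if_true, slot_inj]
        simp [eT]
        split_ifs <;> first | rfl | omega
      · simp [Expr.eval]; omega
    · intro hlt
      replace hlt : ¬ τ.var (aux 0) < σ.var (xU d) := by
        simpa [Test.Holds, Expr.eval, eU] using hlt
      have hfr : Frame [xU d] [aF d] σ τ := by
        refine ⟨fun i c hi _ => hvar _ (by simp; omega), fun i c hc => harr i c (by simpa using hc)⟩
      have hFv : ∀ v, τ.arr (aF d) v =
          if σ.var (xW d) < v ∧ v ≤ σ.var (xU d) then σ.var xT else σ.arr (aF d) v := by
        intro v
        rw [hF]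
        split_ifs <;> first | rfl | omega
      simp only [runs_ite, runs_assign, runs_skip]
      refine ⟨by simp [Test.Safe, Expr.Fits, eU, eL]; omega, ?_, ?_⟩
      · intro hb
        simp [Test.Holds, Expr.eval, eU, eL] at hb
        refine ⟨by simpa [Expr.Fits, eL] using hL, ?_, ⟨?_, hfr.2⟩, ?_, hFv⟩
        · simp [Expr.cost, Test.cost]; omega
        · intro i c hi hc
          rw [State.setVar_var, if_neg (by simpa using hc), hfr.1 i c hi hc]
        · simp [Expr.eval, eL]; omega
      · intro hb
        simp [Test.Holds, Expr.eval, eU, eL] at hb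
        refine ⟨?_, hfr, ?_, hFv⟩
        · simp [Expr.cost, Test.cost]; omega
        · rw [eU]; omega

end


/-! ### Rows stored in arrays -/

/-- The item of a row stored in the cells `i`. -/
def State.item (σ : State) (d : Bool) (i : ℕ) : Item :=
  ⟨σ.arr (aP d) i, σ.arr (aL d) i, σ.arr (aG d) i⟩

/-- The values of `g` at `a, …, b - 1`. -/
def segment (g : ℕ → Item) (a b : ℕ) : List Item := (List.range' a (b - a)).map g

section segment

variable {g h : ℕ → Item} {a b c : ℕ}

theorem segment_of_le (hab : b ≤ a) : segment g a b = [] := by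
  simp [segment, Nat.sub_eq_zero_of_le hab]

theorem segment_cons (hab : a < b) : segment g a b = g a :: segment g (a + 1) b := by
  unfold segment
  obtain ⟨m, rfl⟩ := Nat.exists_eq_add_of_lt hab
  rw [show a + m + 1 - a = m + 1 by omega, show a + m + 1 - (a + 1) = m by omega]
  simp [List.range'_succ]

theorem segment_append (hab : a ≤ b) (hbc : b ≤ c) :
    segment g a b ++ segment g b c = segment g a c := by
  unfold segment
  rw [← List.map_append]
  congr 1
  have := List.range'_append_1 (s := a) (m := b - a) (n := c - b)
  rw [Nat.add_sub_cancel' hab] at this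
  rw [this]
  congr 1
  omega

theorem segment_snoc (hab : a ≤ b) : segment g a (b + 1) = segment g a b ++ [g b] := by
  rw [← segment_append hab (Nat.le_succ b), segment_cons (Nat.lt_succ_self b),
    segment_of_le le_rfl]

theorem segment_congr (hgh : ∀ i, a ≤ i → i < b → g i = h i) : segment g a b = segment h a b := by
  unfold segment
  refine List.map_congr_left fun i hi => ?_
  rw [List.mem_range'_1] at hi
  exact hgh i hi.1 (by omega)

@[simp] theorem length_segment : (segment g a b).length = b - a := by simp [segment]

theorem mem_segment {x : Item} : x ∈ segment g a b ↔ ∃ i, a ≤ i ∧ i < b ∧ g i = x := by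
  simp only [segment, List.mem_map, List.mem_range'_1]
  constructor
  · rintro ⟨i, h1, rfl⟩
    exact ⟨i, h1.1, by omega, rfl⟩
  · rintro ⟨i, h1, h2, rfl⟩
    exact ⟨i, ⟨h1, by omega⟩, rfl⟩

theorem take_segment (m : ℕ) : (segment g 0 b).take m = segment g 0 (min m b) := by
  rcases le_total m b with hm | hm
  · rw [min_eq_left hm, ← segment_append (Nat.zero_le m) hm, List.take_left']
    simp
  · rw [min_eq_right hm, List.take_of_length_le]
    simpa using hm

end segment

/-- The row of direction `d` that is stored in memory. -/
def State.row (σ : State) (d : Bool) : List Item := segment (σ.item d) 0 (σ.var (xM d))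

/-- Push the label in `aux 1` through the cells of the row from `aux 0` on. -/
def cascadeLoop (d : Bool) : Cmd :=
  .loop (.lt (.var (aux 0)) (.var (xM d))) <|
    .seq (.assign (aux 2) (.get (aL d) (.var (aux 0)))) <|
    .seq (.ite (.lt (.var (aux 2)) (.var (aux 1))) .skip
      (.seq (.put (aL d) (.var (aux 0)) (.var (aux 1))) (.assign (aux 1) (.var (aux 2))))) <|
    .assign (aux 0) (.add (.var (aux 0)) (.const 1))

/-- Keep the items of the row whose label is at least `aux 1`; their number is left in `aux 2`. -/
def filterLoop (d : Bool) : Cmd :=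
  .loop (.lt (.var (aux 0)) (.var (xM d))) <|
    .seq (.ite (.lt (.get (aL d) (.var (aux 0))) (.var (aux 1))) .skip <|
      .seq (.put (aP d) (.var (aux 2)) (.get (aP d) (.var (aux 0)))) <|
      .seq (.put (aL d) (.var (aux 2)) (.get (aL d) (.var (aux 0)))) <|
      .seq (.put (aG d) (.var (aux 2)) (.get (aG d) (.var (aux 0)))) <|
      .assign (aux 2) (.add (.var (aux 2)) (.const 1))) <|
    .assign (aux 0) (.add (.var (aux 0)) (.const 1))

section

variable {n : ℕ} {S : Fin n → ℝ} {W : ℕ} {σ : State} {d : Bool}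

/-- The cells already treated, followed by the cascade of the remaining cells with the label
currently carried, form a constant list. -/
theorem runs_cascadeLoop (hm : σ.var (xM d) + 2 ≤ W) (hr : σ.var (aux 1) < W)
    (ha : ∀ i < σ.var (xM d), σ.arr (aL d) i < W) (hi : σ.var (aux 0) ≤ σ.var (xM d)) :
    Runs S W (cascadeLoop d) σ fun τ t => t ≤ 25 * σ.var (xM d) + 3 ∧ Frame [] [aL d] σ τ ∧
      (∀ j, j < σ.var (aux 0) → τ.item d j = σ.item d j) ∧
      segment (τ.item d) (σ.var (aux 0)) (σ.var (xM d)) =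
        cascade (σ.var (aux 1)) (segment (σ.item d) (σ.var (aux 0)) (σ.var (xM d))) := by
  set p := σ.var (aux 0) with hp
  set m := σ.var (xM d) with hmdef
  refine Runs.loop (fun τ s => s ≤ 25 * (τ.var (aux 0) - p) ∧ p ≤ τ.var (aux 0) ∧
    τ.var (aux 0) ≤ m ∧ τ.var (aux 1) < W ∧ Frame [] [aL d] σ τ ∧
    (∀ j, j < p → τ.item d j = σ.item d j) ∧
    (∀ j, τ.var (aux 0) ≤ j → τ.item d j = σ.item d j) ∧
    segment (τ.item d) p (τ.var (aux 0)) ++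
      cascade (τ.var (aux 1)) (segment (τ.item d) (τ.var (aux 0)) m) =
        cascade (σ.var (aux 1)) (segment (σ.item d) p m)) (fun τ => m - τ.var (aux 0)) ?_ ?_
  · refine ⟨by simp, le_rfl, hi, hr, ⟨fun _ _ _ _ => rfl, fun _ _ _ => rfl⟩, fun _ _ => rfl,
      fun _ _ => rfl, ?_⟩
    rw [segment_of_le (a := p) (b := σ.var (aux 0)) le_rfl]
    rfl
  · rintro τ s ⟨hs, hpi, him, hrW, hfr, hlow, hhigh, hseg⟩
    have em : τ.var (xM d) = m := hfr.1 3 d (by norm_num) (by simp)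
    refine ⟨by simp [Test.Safe, Expr.Fits, em]; omega, ?_, ?_⟩
    · intro hlt
      replace hlt : τ.var (aux 0) < m := by simpa [Test.Holds, Expr.eval, em] using hlt
      have hlab : τ.arr (aL d) (τ.var (aux 0)) < W := by
        have h1 : (τ.item d (τ.var (aux 0))).lab = (σ.item d (τ.var (aux 0))).lab := by
          rw [hhigh _ le_rfl]
        change τ.arr (aL d) _ = σ.arr (aL d) _ at h1
        rw [h1]
        exact ha _ hlt
      rw [segment_cons hlt, cascade] at hseg
      simp only [runs_seq, runs_assign, runs_ite, runs_skip, runs_put]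
      simp only [Expr.Fits, Expr.eval, Expr.cost, Test.Safe, Test.Holds, Test.cost,
        State.setVar_var, State.setArr_var]
      simp only [slot_inj, show (10 + 1 = 10 + 0) = False by simp,
        show (10 + 0 = 10 + 1) = False by simp,
        show (10 + 0 = 10 + 2) = False by simp, show (10 + 1 = 10 + 2) = False by simp,
        if_false, and_true, if_true]
      refine ⟨⟨by omega, hlab⟩, ⟨hlab, hrW⟩, fun h => ⟨⟨by omega, by omega, by omega⟩, ?_, ?_⟩,
        fun h => ⟨by omega, hrW, hlab, ⟨by omega, by omega, by omega⟩, ?_, ?_⟩⟩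
      · refine ⟨by omega, by omega, by omega, hrW, ⟨?_, hfr.2⟩, hlow, ?_, ?_⟩
        · intro i c hi hc
          rw [State.setVar_var, if_neg (by simp; omega), State.setVar_var, if_neg (by simp; omega),
            hfr.1 i c hi hc]
        · exact fun j hj => hhigh j (by omega)
        · rw [← hseg]
          change segment (τ.item d) p (τ.var (aux 0) + 1) ++ cascade _
            (segment (τ.item d) (τ.var (aux 0) + 1) m) = _
          rw [segment_snoc hpi, List.append_assoc]
          have e1 : min (τ.item d (τ.var (aux 0))).lab (τ.var (aux 1)) =
            (τ.item d (τ.var (aux 0))).lab := min_eq_left h.le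
          have e2 : max (τ.var (aux 1)) (τ.item d (τ.var (aux 0))).lab = τ.var (aux 1) :=
            max_eq_left h.le
          rw [e1, e2]
          rfl
      · omega
      · refine ⟨by omega, by omega, by omega, hlab, ⟨?_, ?_⟩, ?_, ?_, ?_⟩
        · intro i c hi hc
          rw [State.setVar_var, if_neg (by simp; omega), State.setVar_var, if_neg (by simp; omega),
            State.setArr_var, State.setVar_var, if_neg (by simp; omega), hfr.1 i c hi hc]
        · intro i c hc
          funext j
          rw [State.setVar_arr, State.setVar_arr, State.setArr_arr,
            if_neg (fun h => hc (by simp [h.1])), State.setVar_arr, hfr.2 i c hc]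
        · intro j hj
          rw [← hlow j hj]
          have : j ≠ τ.var (aux 0) := by omega
          simp [State.item, this]
        · intro j hj
          rw [← hhigh j (by omega)]
          have : j ≠ τ.var (aux 0) := by omega
          simp [State.item, this]
        · rw [← hseg]
          have hitem : ∀ j, j ≠ τ.var (aux 0) →
              ((((τ.setVar (aux 2) (τ.arr (aL d) (τ.var (aux 0)))).setArr (aL d) (τ.var (aux 0))
                (τ.var (aux 1))).setVar (aux 1) (τ.arr (aL d) (τ.var (aux 0)))).setVar (aux 0)
                (τ.var (aux 0) + 1)).item d j = τ.item d j := fun j hj => by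
            simp [State.item, hj]
          rw [segment_snoc hpi, List.append_assoc, segment_congr (b := τ.var (aux 0))
            fun i _ hi => hitem i (by omega), segment_congr (b := m)
            fun i hi _ => hitem i (by omega)]
          have e1 : min (τ.item d (τ.var (aux 0))).lab (τ.var (aux 1)) = τ.var (aux 1) :=
            min_eq_right (not_lt.1 h)
          have e2 : max (τ.var (aux 1)) (τ.item d (τ.var (aux 0))).lab =
            (τ.item d (τ.var (aux 0))).lab := max_eq_right (not_lt.1 h)
          rw [e1, e2]
          simp [State.item]
      · omega
    · intro hlt
      replace hlt : ¬ τ.var (aux 0) < m := by simpa [Test.Holds, Expr.eval, em] using hlt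
      obtain hi' : τ.var (aux 0) = m := by omega
      rw [hi', segment_of_le le_rfl, cascade, List.append_nil] at hseg
      exact ⟨by simp [Test.cost, Expr.cost]; omega, hfr, hlow, hseg⟩

/-- Filtering in place is safe because the write index never overtakes the read index, so unread
cells still hold their original items. -/
theorem runs_filterLoop (hm : σ.var (xM d) + 2 ≤ W) (hr : σ.var (aux 1) < W)
    (ha : ∀ i < σ.var (xM d), σ.arr (aP d) i < W ∧ σ.arr (aL d) i < W ∧ σ.arr (aG d) i < W)
    (h0 : σ.var (aux 0) = 0) (h2 : σ.var (aux 2) = 0) :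
    Runs S W (filterLoop d) σ fun τ t => t ≤ 40 * σ.var (xM d) + 3 ∧
      Frame [] [aP d, aL d, aG d] σ τ ∧ τ.var (aux 2) ≤ σ.var (xM d) ∧
      segment (τ.item d) 0 (τ.var (aux 2)) =
        (σ.row d).filter fun x => decide (σ.var (aux 1) ≤ x.lab) := by
  set m := σ.var (xM d) with hmdef
  set r := σ.var (aux 1) with hrdef
  refine Runs.loop (fun τ s => s ≤ 40 * τ.var (aux 0) ∧ τ.var (aux 0) ≤ m ∧ τ.var (aux 1) = r ∧
    τ.var (aux 2) ≤ τ.var (aux 0) ∧ Frame [] [aP d, aL d, aG d] σ τ ∧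
    (∀ j, τ.var (aux 0) ≤ j → τ.item d j = σ.item d j) ∧
    segment (τ.item d) 0 (τ.var (aux 2)) ++
      (segment (τ.item d) (τ.var (aux 0)) m).filter (fun x => decide (r ≤ x.lab)) =
        (σ.row d).filter fun x => decide (r ≤ x.lab)) (fun τ => m - τ.var (aux 0)) ?_ ?_
  · refine ⟨by simp, by omega, rfl, by omega, ⟨fun _ _ _ _ => rfl, fun _ _ _ => rfl⟩,
      fun _ _ => rfl, ?_⟩
    rw [h2, h0, segment_of_le (b := 0) le_rfl]
    rfl
  · rintro τ s ⟨hs, him, her, hoi, hfr, hhigh, hseg⟩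
    have em : τ.var (xM d) = m := hfr.1 3 d (by norm_num) (by simp)
    refine ⟨by simp [Test.Safe, Expr.Fits, em]; omega, ?_, ?_⟩
    · intro hlt
      replace hlt : τ.var (aux 0) < m := by simpa [Test.Holds, Expr.eval, em] using hlt
      have hfit : τ.arr (aP d) (τ.var (aux 0)) < W ∧ τ.arr (aL d) (τ.var (aux 0)) < W ∧
          τ.arr (aG d) (τ.var (aux 0)) < W := by
        have h1 := hhigh _ (le_refl (τ.var (aux 0)))
        simp only [State.item, Item.mk.injEq] at h1
        rw [h1.1, h1.2.1, h1.2.2]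
        exact ha _ hlt
      rw [segment_cons hlt, List.filter_cons] at hseg
      have hinner : Runs S W (.ite (.lt (.get (aL d) (.var (aux 0))) (.var (aux 1))) .skip <|
          .seq (.put (aP d) (.var (aux 2)) (.get (aP d) (.var (aux 0)))) <|
          .seq (.put (aL d) (.var (aux 2)) (.get (aL d) (.var (aux 0)))) <|
          .seq (.put (aG d) (.var (aux 2)) (.get (aG d) (.var (aux 0)))) <|
          .assign (aux 2) (.add (.var (aux 2)) (.const 1))) τ fun υ t => t ≤ 30 ∧
          υ.var (aux 0) = τ.var (aux 0) ∧ υ.var (aux 1) = r ∧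
          υ.var (aux 2) ≤ τ.var (aux 0) + 1 ∧ Frame [] [aP d, aL d, aG d] σ υ ∧
          (∀ j, τ.var (aux 0) + 1 ≤ j → υ.item d j = τ.item d j) ∧
          segment (υ.item d) 0 (υ.var (aux 2)) = segment (τ.item d) 0 (τ.var (aux 2)) ++
            if r ≤ (τ.item d (τ.var (aux 0))).lab then [τ.item d (τ.var (aux 0))] else [] := by
        simp only [runs_seq, runs_assign, runs_ite, runs_skip, runs_put]
        refine ⟨by simp [Test.Safe, Expr.Fits, Expr.eval]; omega, fun h => ?_, fun h => ?_⟩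
        · simp [Test.Holds, Expr.eval, her] at h
          refine ⟨by simp [Test.cost, Expr.cost], trivial, her, by omega, hfr, fun _ _ => trivial, ?_⟩
          rw [if_neg (by simpa [State.item] using h), List.append_nil]
        · simp [Test.Holds, Expr.eval, her] at h
          refine ⟨by simp [Expr.Fits]; omega, by simp [Expr.Fits, Expr.eval]; omega,
            by simp [Expr.Fits]; omega, by simp [Expr.Fits, Expr.eval]; omega,
            by simp [Expr.Fits]; omega, by simp [Expr.Fits, Expr.eval]; omega,
            by simp [Expr.Fits, Expr.eval]; omega, by simp [Test.cost, Expr.cost], by simp,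
            by simpa using her, by simp [Expr.eval]; omega, ⟨?_, ?_⟩, ?_, ?_⟩
          · intro i c hi hc
            rw [State.setVar_var, if_neg (by simp; omega)]
            exact hfr.1 i c hi hc
          · intro i c hc
            rw [← hfr.2 i c hc]
            funext j
            rw [State.setVar_arr, State.setArr_arr, if_neg (fun h => hc (by simp [h.1])),
              State.setArr_arr, if_neg (fun h => hc (by simp [h.1])),
              State.setArr_arr, if_neg (fun h => hc (by simp [h.1]))]
          · intro j hj
            have : j ≠ τ.var (aux 2) := by omega
            simp [State.item, Expr.eval, this]
          · rw [if_pos (by simpa [State.item] using h)]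
            simp only [State.setVar_var, if_true, Expr.eval, State.setArr_var]
            rw [segment_snoc (Nat.zero_le _)]
            congr 1
            · refine segment_congr fun j _ hj => ?_
              have : j ≠ τ.var (aux 2) := by omega
              simp [State.item, this]
            · simp [State.item]
      rw [runs_seq]
      refine hinner.mono ?_
      rintro υ t ⟨ht, h0', h1', h2', hfr', hitem, hseg'⟩
      rw [runs_assign]
      refine ⟨by simp [Expr.Fits, Expr.eval]; omega, ⟨?_, ?_, ?_, ?_, ⟨?_, hfr'.2⟩, ?_, ?_⟩, ?_⟩
      · simp [Expr.eval, Test.cost, Expr.cost, h0']; omega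
      · simp [Expr.eval, h0']; omega
      · simpa using h1'
      · simpa [Expr.eval, h0'] using h2'
      · intro i c hi hc
        rw [State.setVar_var, if_neg (by simp; omega)]
        exact hfr'.1 i c hi hc
      · intro j hj
        simp [Expr.eval, h0'] at hj
        exact (hitem j hj).trans (hhigh j (by omega))
      · simp only [State.setVar_var, if_true, Expr.eval, h0']
        rw [if_neg (by simp)]
        change segment (υ.item d) 0 _ ++ (segment (υ.item d) _ m).filter _ = _
        rw [hseg', ← hseg, List.append_assoc, segment_congr (b := m) fun i hi _ => hitem i hi]
        congr 1
        by_cases hc : r ≤ (τ.item d (τ.var (aux 0))).lab <;> simp [hc]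
      · simp [Expr.eval, h0']; omega
    · intro hlt
      replace hlt : ¬ τ.var (aux 0) < m := by simpa [Test.Holds, Expr.eval, em] using hlt
      obtain hi' : τ.var (aux 0) = m := by omega
      rw [hi', segment_of_le (a := m) le_rfl, List.filter_nil, List.append_nil] at hseg
      exact ⟨by simp [Test.cost, Expr.cost]; omega, hfr, by omega, hseg⟩

end


/-! ### Labels, thresholds, insertion and truncation -/

/-- The label of the current position. -/
abbrev xA (d : Bool) : ℕ := slot 8 d

/-- The threshold below which labels are irrelevant. -/
abbrev xB (d : Bool) : ℕ := slot 9 d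

/-- Compute the label of the current position. -/
def newLabel (d : Bool) : Cmd :=
  .seq (.assign (xA d) (.add (.var (xL (!d))) (.const 1)))
    (.ite (.lt (.var (xA d)) (.var (xU (!d)))) (.assign (xA d) (.var (xU (!d)))) .skip)

/-- Compute the threshold for the labels. -/
def newThreshold (d : Bool) : Cmd :=
  .seq (baseValue (xU d) (xU (!d)))
    (.assign (xB d) (.sub (.add (.var (aux 0)) (.const 1)) (.var xK)))

/-- Insert the current position into the row. -/
def insertItem (d : Bool) : Cmd :=
  .seq
    (.ite (.lt (.var (xP d)) (.var (xM d)))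
      (.seq (.assign (aux 1) (.get (aL d) (.var (xP d)))) <|
        .seq (.assign (aux 0) (.add (.var (xP d)) (.const 1))) (cascadeLoop d))
      (.assign (xM d) (.add (.var (xP d)) (.const 1)))) <|
  .seq (.put (aP d) (.var (xP d)) (.var xT)) <|
  .seq (.put (aL d) (.var (xP d)) (.var (xA d)))
    (.put (aG d) (.var (xP d)) (.var (xW (!d))))

/-- Truncate the row. -/
def truncateRow (d : Bool) : Cmd :=
  .seq (.assign (aux 0) (.const 0)) <|
  .seq (.assign (aux 1) (.var (xB d))) <|
  .seq (.assign (aux 2) (.const 0)) <|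
  .seq (filterLoop d) <|
  .seq (.assign (xM d) (.add (.var xK) (.add (.var xK) (.var xK))))
    (.ite (.lt (.var (aux 2)) (.var (xM d))) (.assign (xM d) (.var (aux 2))) .skip)

section

variable {n : ℕ} {S : Fin n → ℝ} {W : ℕ} {σ : State} {d : Bool}

theorem Frame.refl (X Y : List ℕ) (σ : State) : Frame X Y σ σ :=
  ⟨fun _ _ _ _ => rfl, fun _ _ _ => rfl⟩

theorem Frame.trans {X Y : List ℕ} {τ υ : State} (h : Frame X Y σ τ) (h' : Frame X Y τ υ) :
    Frame X Y σ υ :=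
  ⟨fun i c hi hc => (h'.1 i c hi hc).trans (h.1 i c hi hc),
    fun i c hc => (h'.2 i c hc).trans (h.2 i c hc)⟩

@[simp] theorem State.item_setVar (x v : ℕ) (d : Bool) : (σ.setVar x v).item d = σ.item d := rfl

theorem State.row_setVar {x : ℕ} (hx : x ≠ xM d) (v : ℕ) : (σ.setVar x v).row d = σ.row d := by
  simp [State.row, hx.symm]

theorem Frame.setVar {X Y : List ℕ} {τ : State} (h : Frame X Y σ τ) {i : ℕ} {c : Bool} (v : ℕ)
    (hX : 10 ≤ i ∨ slot i c ∈ X) : Frame X Y σ (τ.setVar (slot i c) v) := by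
  refine ⟨fun j b hj hb => ?_, h.2⟩
  rw [State.setVar_var, if_neg, h.1 j b hj hb]
  rintro h'
  rcases hX with hX | hX
  · have := (slot_inj.1 h').1
    omega
  · exact hb (h' ▸ hX)

theorem Frame.setArr {X Y : List ℕ} {τ : State} (h : Frame X Y σ τ) {a : ℕ} (i v : ℕ)
    (hY : a ∈ Y) : Frame X Y σ (τ.setArr a i v) := by
  refine ⟨h.1, fun j b hb => ?_⟩
  rw [← h.2 j b hb]
  funext l
  rw [State.setArr_arr, if_neg]
  rintro ⟨rfl, -⟩
  exact hb hY

theorem Frame.mono {X Y X' Y' : List ℕ} {τ : State} (h : Frame X Y σ τ) (hX : X ⊆ X')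
    (hY : Y ⊆ Y') : Frame X' Y' σ τ :=
  ⟨fun i c hi hc => h.1 i c hi fun h' => hc (hX h'), fun i c hc => h.2 i c fun h' => hc (hY h')⟩

theorem runs_newLabel (hL : σ.var (xL (!d)) + 1 < W) (hU : σ.var (xU (!d)) < W) :
    Runs S W (newLabel d) σ fun τ t => t ≤ 12 ∧
      τ = σ.setVar (xA d) (max (σ.var (xU (!d))) (σ.var (xL (!d)) + 1)) := by
  unfold newLabel
  simp only [runs_seq, runs_assign, runs_ite, runs_skip]
  have e1 : xU (!d) ≠ xA d := by simp
  simp only [Expr.Fits, Expr.eval, Expr.cost, Test.Safe, Test.Holds, Test.cost,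
    State.setVar_var, State.setVar_setVar, e1, if_false, if_true]
  refine ⟨by omega, ⟨hL, hU⟩, fun h => ⟨hU, by omega, ?_⟩, fun h => ⟨by omega, ?_⟩⟩
  · rw [max_eq_left h.le]
  · rw [max_eq_right (not_lt.1 h)]

theorem runs_newThreshold (hU : ∀ c, σ.var (xU c) + 1 < W) (hk : σ.var xK < W) :
    Runs S W (newThreshold d) σ fun τ t => t ≤ 20 ∧ Frame [xB d] [] σ τ ∧
      τ.var (xB d) = min (σ.var (xU (!d))) (σ.var (xU d) - σ.var xK) + 1 - σ.var xK := by
  unfold newThreshold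
  have h1 := hU d
  have h2 := hU (!d)
  rw [runs_seq]
  refine (runs_baseValue (by simp) (by omega) (by omega) hk).mono ?_
  rintro τ t ⟨ht, rfl⟩
  rw [runs_assign]
  refine ⟨by simp [Expr.Fits, Expr.eval]; omega, by simp [Expr.cost]; omega,
    ((Frame.refl _ _ _).setVar _ (by simp)).setVar _ (by simp), by simp [Expr.eval]⟩

/-- The cascade runs before the new item is written, since the label in its cell is the first one to
be displaced. If the place is the end of the row, the row grows by one instead. -/
theorem runs_insertItem (hm : σ.var (xM d) + 2 ≤ W) (hp : σ.var (xP d) ≤ σ.var (xM d))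
    (ha : ∀ i < σ.var (xM d), σ.arr (aL d) i < W) (hT : σ.var xT < W) (hA : σ.var (xA d) < W)
    (hw : σ.var (xW (!d)) < W) :
    Runs S W (insertItem d) σ fun τ t => t ≤ 25 * σ.var (xM d) + 40 ∧
      Frame [xM d] [aP d, aL d, aG d] σ τ ∧
      τ.var (xM d) = max (σ.var (xM d)) (σ.var (xP d) + 1) ∧
      τ.row d = segment (σ.item d) 0 (σ.var (xP d)) ++
        ⟨σ.var xT, σ.var (xA d), σ.var (xW (!d))⟩ ::
          displace (segment (σ.item d) (σ.var (xP d)) (σ.var (xM d))) := by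
  set p := σ.var (xP d) with hpdef
  set m := σ.var (xM d) with hmdef
  have hput : ∀ τ : State, τ.var (xP d) = p → τ.var xT = σ.var xT → τ.var (xA d) = σ.var (xA d) →
      τ.var (xW (!d)) = σ.var (xW (!d)) → Runs S W (.seq (.put (aP d) (.var (xP d)) (.var xT)) <|
      .seq (.put (aL d) (.var (xP d)) (.var (xA d)))
        (.put (aG d) (.var (xP d)) (.var (xW (!d))))) τ fun υ t => t ≤ 9 ∧
      (∀ Y, Frame [xM d] [aP d, aL d, aG d] Y τ → Frame [xM d] [aP d, aL d, aG d] Y υ) ∧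
      υ.var = τ.var ∧ (∀ j, j ≠ p → υ.item d j = τ.item d j) ∧
      υ.item d p = ⟨σ.var xT, σ.var (xA d), σ.var (xW (!d))⟩ := by
    intro τ h1 h2 h3 h4
    simp only [runs_seq, runs_put]
    simp only [Expr.Fits, Expr.eval, Expr.cost, State.setArr_var, h1, h2, h3, h4]
    refine ⟨by omega, hT, by omega, hA, by omega, hw, by omega, ?_, trivial, ?_, ?_⟩
    · intro Y hY
      exact ((hY.setArr _ _ (by simp)).setArr _ _ (by simp)).setArr _ _ (by simp)
    · intro j hj
      simp [State.item, hj]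
    · simp [State.item]
  unfold insertItem
  rw [runs_seq, runs_ite]
  refine ⟨by simp [Test.Safe, Expr.Fits]; omega, fun h => ?_, fun h => ?_⟩
  · replace h : p < m := h
    rw [runs_seq, runs_assign]
    refine ⟨by simp [Expr.Fits, Expr.eval]; exact ⟨by omega, ha _ h⟩, ?_⟩
    rw [runs_seq, runs_assign]
    refine ⟨by simp [Expr.Fits, Expr.eval]; omega, ?_⟩
    refine (runs_cascadeLoop (d := d) (by simpa using hm)
      (by simpa [Expr.eval] using ha _ h) (by simpa using ha)
      (by simp [Expr.eval]; omega)).mono ?_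
    rintro τ t ⟨ht, hfr, hlow, hseg⟩
    have hfr' : Frame [xM d] [aP d, aL d, aG d] σ τ := by
      refine Frame.trans ?_ (hfr.mono (by simp) (by simp))
      exact ((Frame.refl _ _ _).setVar _ (Or.inl (by simp))).setVar _ (Or.inl (by simp))
    simp [Expr.eval] at ht hlow hseg
    have em : τ.var (xM d) = m := by
      have := hfr.1 3 d (by norm_num) (by simp)
      simpa using this
    refine (hput τ (hfr'.1 4 d (by norm_num) (by simp)) (hfr'.1 1 false (by norm_num) (by simp))
      (hfr'.1 8 d (by norm_num) (by simp)) (hfr'.1 6 (!d) (by norm_num) (by simp))).mono ?_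
    rintro υ s ⟨hs, hυfr, hυv, hυi, hυp⟩
    refine ⟨by simp [Expr.cost, Test.cost]; omega, hυfr _ hfr', ?_, ?_⟩
    · rw [hυv, em]
      omega
    · unfold State.row
      rw [hυv, em, ← segment_append (Nat.zero_le p) h.le, segment_cons h, segment_cons h, hυp,
        displace]
      congr 1
      · exact segment_congr fun i _ hi => (hυi i (by omega)).trans (hlow i (by omega))
      · congr 1
        rw [segment_congr fun i hi _ => hυi i (by omega), hseg]
        rfl
  · replace h : ¬ p < m := h
    obtain hpm : p = m := by omega
    rw [runs_assign]
    refine ⟨by simp [Expr.Fits, Expr.eval]; omega, ?_⟩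
    refine (hput _ (by simp [hpdef]) (by simp) (by simp) (by simp)).mono ?_
    rintro υ s ⟨hs, hυfr, hυv, hυi, hυp⟩
    have em : υ.var (xM d) = p + 1 := by rw [hυv]; simp [Expr.eval, hpdef]
    refine ⟨by simp [Expr.cost, Test.cost]; omega,
      hυfr _ ((Frame.refl _ _ _).setVar _ (by simp)), by omega, ?_⟩
    unfold State.row
    rw [em, segment_snoc (Nat.zero_le p), hυp, segment_of_le (a := p) (by omega), displace]
    congr 1
    exact segment_congr fun i _ hi => hυi i (by omega)

theorem runs_truncateRow (hm : σ.var (xM d) + 2 ≤ W) (hB : σ.var (xB d) < W)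
    (hk : 3 * σ.var xK < W)
    (ha : ∀ x ∈ σ.row d, x.pos < W ∧ x.lab < W ∧ x.fin < W) :
    Runs S W (truncateRow d) σ fun τ t => t ≤ 40 * σ.var (xM d) + 40 ∧
      Frame [xM d] [aP d, aL d, aG d] σ τ ∧
      τ.row d = ((σ.row d).filter fun x => decide (σ.var (xB d) ≤ x.lab)).take (3 * σ.var xK) := by
  unfold truncateRow
  simp only [runs_seq, runs_assign]
  refine ⟨by simp [Expr.Fits]; omega, by simpa [Expr.Fits] using hB, by simp [Expr.Fits]; omega, ?_⟩
  refine (runs_filterLoop (d := d) (by simpa using hm) (by simpa [Expr.eval] using hB) ?_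
    (by simp [Expr.eval]) (by simp [Expr.eval])).mono ?_
  · intro i hi
    exact ha (σ.item d i) (mem_segment.2 ⟨i, Nat.zero_le i, by simpa using hi, rfl⟩)
  · rintro τ t ⟨ht, hfr, hle, hseg⟩
    have hfr' : Frame [xM d] [aP d, aL d, aG d] σ τ := by
      refine Frame.trans ?_ (hfr.mono (by simp) (by simp))
      exact (((Frame.refl _ _ _).setVar _ (Or.inl (by simp))).setVar _ (Or.inl (by simp))).setVar _
        (Or.inl (by simp))
    have ek : τ.var xK = σ.var xK := hfr'.1 0 true (by norm_num) (by simp)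
    rw [State.row_setVar (by simp), State.row_setVar (by simp), State.row_setVar (by simp)] at hseg
    simp [Expr.eval] at ht hle hseg
    simp only [runs_ite, runs_assign, runs_skip]
    refine ⟨by simp [Expr.Fits, Expr.eval, ek]; omega,
      by simp [Test.Safe, Expr.Fits, Expr.eval, ek]; omega, fun h => ?_, fun h => ?_⟩
    · simp [Test.Holds, Expr.eval, ek] at h
      refine ⟨by simp [Expr.Fits]; omega, by simp [Expr.cost, Test.cost]; omega,
        (hfr'.setVar _ (by simp)).setVar _ (by simp), ?_⟩
      rw [← hseg, take_segment, min_eq_right (by omega)]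
      unfold State.row
      simp [Expr.eval]
    · simp [Test.Holds, Expr.eval, ek] at h
      refine ⟨by simp [Expr.cost, Test.cost]; omega, hfr'.setVar _ (by simp), ?_⟩
      rw [← hseg, take_segment, min_eq_left (by omega)]
      unfold State.row
      simp [Expr.eval, ek]
      rw [show σ.var xK + (σ.var xK + σ.var xK) = 3 * σ.var xK by omega]

end


/-! ### The phases preceding the update, for both directions -/

/-- Run a program for both directions. -/
def both (f : Bool → Cmd) : Cmd := .seq (f true) (f false)

/-- The two halves work on disjoint memory apart from auxiliary variables, so what `true` has
established survives `false`. The bound `c` may depend on the final state because the cost of a scan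
depends on where it stops. -/
theorem runs_both {n : ℕ} {S : Fin n → ℝ} {W : ℕ} {σ : State} {f : Bool → Cmd}
    {X Y : Bool → List ℕ} {P : Bool → State → Prop} {c : Bool → State → ℕ}
    (h : ∀ d τ, Frame (X (!d)) (Y (!d)) σ τ →
      Runs S W (f d) τ fun υ t => t ≤ c d υ ∧ Frame (X d) (Y d) τ υ ∧ P d υ)
    (stable : ∀ d υ ω, P d υ → Frame (X (!d)) (Y (!d)) υ ω → P d ω ∧ c d ω = c d υ) :
    Runs S W (both f) σ fun τ t => t ≤ c true τ + c false τ ∧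
      Frame (X true ++ X false) (Y true ++ Y false) σ τ ∧ ∀ d, P d τ := by
  unfold both
  rw [runs_seq]
  refine (h true σ (Frame.refl _ _ _)).mono ?_
  rintro τ s ⟨hs, hf, hP⟩
  refine (h false τ hf).mono ?_
  rintro υ t ⟨ht, hf', hP'⟩
  obtain ⟨h1, h2⟩ := stable true τ υ hP hf'
  refine ⟨by omega, (hf.mono (by simp) (by simp)).trans (hf'.mono (by simp) (by simp)), ?_⟩
  intro d
  cases d
  · exact hP'
  · exact h1

/-- The data stored in memory. -/
def State.data (σ : State) : Data where
  L d := σ.var (xL d)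
  F d := σ.arr (aF d)
  R d := σ.row d

/-- The memory at the beginning of an iteration. -/
structure Ready {n : ℕ} (S : Fin n → ℝ) (W k : ℕ) (σ : State) : Prop where
  inj : Function.Injective S
  three_le : 3 ≤ k
  eq_k : σ.var xK = k
  lt : σ.var xT < n
  word : 8 * (n + k + 2) ≤ W
  inv : Inv n k (key S) (3 * k) (σ.var xT) σ.data

/-- Values are lengths of subsequences of the input; together with `Inv.fin_le` this keeps the
stored numbers within machine words. -/
theorem Inv.L_le {n k m t : ℕ} {T : Bool → ℕ → ℝ} {D : Data} (h : Inv n k T m t D) (d : Bool) :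
    D.L d ≤ n := by
  rcases Nat.eq_zero_or_pos (D.L d) with h0 | h0
  · omega
  · obtain ⟨-, v, h1, h2⟩ := h.full d _ h0 le_rfl
    have := h2.le
    have := h2.lt
    omega

theorem Inv.fin_le {n k m t : ℕ} {T : Bool → ℕ → ℝ} {D : Data} (h : Inv n k T m t D) {d : Bool}
    {a : Item} (ha : a ∈ D.R d) : a.fin ≤ n := by
  have h1 := h.finger d a ha
  have h2 := h.L_le (!d)
  have h3 : D.base k (!d) ≤ D.L (!d) := by unfold Data.base; omega
  omega

section

variable {n : ℕ} {S : Fin n → ℝ} {W k : ℕ} {σ τ : State}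

namespace Ready

theorem item (h : Ready S W k σ) {d : Bool} {i : ℕ} (hi : i < σ.var (xM d)) :
    σ.arr (aP d) i < σ.var xT ∧ 1 ≤ σ.arr (aL d) i ∧ σ.arr (aL d) i ≤ n + 1 ∧
      σ.arr (aG d) i ≤ n := by
  have hmem : σ.item d i ∈ σ.data.R d := mem_segment.2 ⟨i, Nat.zero_le i, hi, rfl⟩
  obtain ⟨h1, h2, h3⟩ := h.inv.item d _ hmem
  have h4 := h.inv.fin_le hmem
  have h5 := h.inv.L_le (!d)
  simp only [State.item] at h1 h2 h3 h4
  exact ⟨h1, h2, by omega, h4⟩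

theorem length_le (h : Ready S W k σ) (d : Bool) : σ.var (xM d) ≤ 3 * k := by
  have := h.inv.length d
  simpa [State.data, State.row] using this

theorem L_le (h : Ready S W k σ) (d : Bool) : σ.var (xL d) ≤ n := h.inv.L_le d

end Ready

/-- The places of the current position in the rows. -/
structure Placed (S : Fin n → ℝ) (σ : State) (d : Bool) (p : ℕ) : Prop where
  le : p ≤ σ.var (xM d)
  below : ∀ j < p, key S d (σ.arr (aP d) j) < key S d (σ.var xT)
  maximal : p < σ.var (xM d) → ¬ key S d (σ.arr (aP d) p) < key S d (σ.var xT)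

theorem Ready.runs_findPlace (h : Ready S W k σ) :
    Runs S W (both fun d => findPlace d (aP d) (xM d) (xP d) xT) σ fun τ t =>
      t ≤ 100 * k ∧ Frame [xP true, xP false] [] σ τ ∧ ∀ d, Placed S σ d (τ.var (xP d)) := by
  have hk := h.three_le
  refine (runs_both (X := fun d => [xP d]) (Y := fun _ => [])
    (P := fun d τ => Placed S σ d (τ.var (xP d))) (c := fun _ _ => 50 * k) ?_ ?_).mono ?_
  · intro d τ hf
    have eM : τ.var (xM d) = σ.var (xM d) := hf.1 3 d (by norm_num) (by simp)
    have eT : τ.var xT = σ.var xT := hf.1 1 false (by norm_num) (by simp)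
    have eP : τ.arr (aP d) = σ.arr (aP d) := hf.2 1 d (by simp)
    have h1 := h.length_le d
    have h2 := h.word
    have h3 := h.lt
    refine (Rollercoaster.runs_findPlace (by simp) (by simp) (by omega) (by omega) ?_
      (by omega)).mono ?_
    · intro i hi
      rw [eM] at hi
      rw [eP]
      exact (h.item hi).1.trans h3
    · rintro υ t ⟨ht, i, rfl, h4, h5, h6⟩
      rw [eM, eP, eT] at *
      refine ⟨by omega, (Frame.refl _ _ _).setVar _ (by simp), ?_⟩
      simp only [State.setVar_var, if_true]
      exact ⟨h4, h5, h6⟩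
  · intro d υ ω hP hf
    refine ⟨?_, rfl⟩
    rw [hf.1 4 d (by norm_num) (by simp)]
    exact hP
  · rintro τ t ⟨ht, hf, hP⟩
    exact ⟨by omega, hf, hP⟩

/-- The specification of the label `z` found below place `p`. -/
structure Selected (k : ℕ) (f : ℕ → ℕ) (p z : ℕ) : Prop where
  le : ∀ i < p, k ≤ countGe f p (f i) + 1 → f i ≤ z
  eq : z = 0 ∨ ∃ i < p, z = f i ∧ k ≤ countGe f p (f i) + 1

theorem Ready.runs_selectLabel (h : Ready S W k σ) (hf : Frame [xP true, xP false] [] σ τ)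
    (hp : ∀ d, Placed S σ d (τ.var (xP d))) :
    Runs S W (both selectLabel) τ fun υ t => t ≤ 1400 * k ^ 2 ∧
      Frame [xZ true, xZ false] [] τ υ ∧
        ∀ d, Selected k (σ.arr (aL d)) (τ.var (xP d)) (υ.var (xZ d)) := by
  have hk := h.three_le
  refine (runs_both (X := fun d => [xZ d]) (Y := fun _ => [])
    (P := fun d υ => Selected k (σ.arr (aL d)) (τ.var (xP d)) (υ.var (xZ d)))
    (c := fun _ _ => 700 * k ^ 2) ?_ ?_).mono ?_
  · intro d υ hf'
    have eP : υ.var (xP d) = τ.var (xP d) := hf'.1 4 d (by norm_num) (by simp)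
    have eK : υ.var xK = k := by
      rw [hf'.1 0 true (by norm_num) (by simp), hf.1 0 true (by norm_num) (by simp), h.eq_k]
    have eL : υ.arr (aL d) = σ.arr (aL d) := by
      rw [hf'.2 2 d (by simp), hf.2 2 d (by simp)]
    have h1 := h.length_le d
    have h2 := h.word
    have h3 := (hp d).le
    refine (Rollercoaster.runs_selectLabel (by omega) ?_ (by omega)).mono ?_
    · intro i hi
      rw [eP] at hi
      rw [eL]
      have := (h.item (hi.trans_le h3)).2.2.1
      omega
    · rintro ω t ⟨ht, hω, h4, h5⟩
      rw [eP, eL, eK] at *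
      refine ⟨ht.trans ?_, hω, ⟨h4, h5⟩⟩
      have : τ.var (xP d) + 1 ≤ 3 * k + 1 := by omega
      have := Nat.pow_le_pow_left this 2
      nlinarith
  · intro d υ ω hP hf'
    refine ⟨?_, rfl⟩
    rw [hf'.1 5 d (by norm_num) (by simp)]
    exact hP
  · rintro υ t ⟨ht, hf', hP⟩
    exact ⟨by omega, hf', hP⟩

/-- The specification of the scan: it moves from `s` to `w`. -/
structure Scanned (S : Fin n → ℝ) (σ : State) (d : Bool) (s w : ℕ) : Prop where
  start_le : s ≤ w
  le : w ≤ σ.var (xL d)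
  low : w = s ∨ key S d (σ.arr (aF d) w) < key S d (σ.var xT)
  maximal : w < σ.var (xL d) → ¬ key S d (σ.arr (aF d) (w + 1)) < key S d (σ.var xT)

/-- The finger from which the scan starts. -/
def State.finger (σ : State) (d : Bool) (p : ℕ) : ℕ :=
  if p < σ.var (xM d) then σ.arr (aG d) p else 0

/-- The scan in direction `d`. -/
def scan (d : Bool) : Cmd :=
  .seq (baseValue (xL d) (xL (!d))) (.seq (scanInit d) (.seq (scanLoop d) (scanValue d)))

/-- The scans read only old data: neither changes `xL`, the rows or `F`, so both are specified
relative to the state `σ` at the start of the iteration. -/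
theorem Ready.runs_scan (h : Ready S W k σ)
    (hf : Frame [xP true, xP false, xZ true, xZ false] [] σ τ)
    (hp : ∀ d, τ.var (xP d) ≤ σ.var (xM d)) (hz : ∀ d, τ.var (xZ d) ≤ n + 1)
    (hg : ∀ d, σ.finger (!d) (τ.var (xP (!d))) ≤ σ.var (xL d)) :
    Runs S W (both scan) τ fun υ t =>
      t ≤ 14 * (υ.var (xW true) -
          max (σ.data.base k true) (σ.finger false (τ.var (xP false)))) +
        14 * (υ.var (xW false) -
          max (σ.data.base k false) (σ.finger true (τ.var (xP true)))) + 200 ∧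
      Frame [xW true, xU true, xW false, xU false] [] τ υ ∧
      ∀ d, Scanned S σ d (max (σ.data.base k d) (σ.finger (!d) (τ.var (xP (!d))))) (υ.var (xW d)) ∧
        υ.var (xU d) = newValue k (σ.data.base k d) (υ.var (xW d)) (τ.var (xZ d)) := by
  have hk := h.three_le
  refine (runs_both (X := fun d => [xW d, xU d]) (Y := fun _ => [])
    (P := fun d υ =>
      Scanned S σ d (max (σ.data.base k d) (σ.finger (!d) (τ.var (xP (!d))))) (υ.var (xW d)) ∧
        υ.var (xU d) = newValue k (σ.data.base k d) (υ.var (xW d)) (τ.var (xZ d)))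
    (c := fun d υ => 14 * (υ.var (xW d) -
      max (σ.data.base k d) (σ.finger (!d) (τ.var (xP (!d))))) + 100) ?_ ?_).mono ?_
  · intro d υ hf'
    have hfr : Frame [xP true, xP false, xZ true, xZ false, xW (!d), xU (!d)] [] σ υ :=
      (hf.mono (by simp) (by simp)).trans (hf'.mono (by simp) (by simp))
    have eL : ∀ c, υ.var (xL c) = σ.var (xL c) := fun c => hfr.1 2 c (by norm_num) (by simp)
    have eM : ∀ c, υ.var (xM c) = σ.var (xM c) := fun c => hfr.1 3 c (by norm_num) (by simp)
    have eK : υ.var xK = k := by rw [hfr.1 0 true (by norm_num) (by simp), h.eq_k]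
    have eT : υ.var xT = σ.var xT := hfr.1 1 false (by norm_num) (by simp)
    have eP : ∀ c, υ.var (xP c) = τ.var (xP c) := fun c => hf'.1 4 c (by norm_num) (by simp)
    have eZ : ∀ c, υ.var (xZ c) = τ.var (xZ c) := fun c => hf'.1 5 c (by norm_num) (by simp)
    have eA : ∀ i c, υ.arr (slot i c) = σ.arr (slot i c) := fun i c => hfr.2 i c (by simp)
    have hL := h.L_le d
    have hL' := h.L_le (!d)
    have hm := h.length_le (!d)
    have hW := h.word
    have hlt := h.lt
    have hpd := hp (!d)
    have hzd := hz d
    have hgd := hg d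
    set b := σ.data.base k d with hb
    have hbL : b ≤ σ.var (xL d) := by
      have h1 : b = min (σ.var (xL (!d))) (σ.var (xL d) - k) := rfl
      omega
    set g := σ.finger (!d) (τ.var (xP (!d))) with hgdef
    unfold scan
    rw [runs_seq]
    refine (runs_baseValue (by simp) (by rw [eL]; omega) (by rw [eL]; omega) (by omega)).mono ?_
    rintro _ t1 ⟨ht1, rfl⟩
    have hb' : min (υ.var (xL !d)) (υ.var (xL d) - υ.var xK) = b := by
      rw [eL, eL, eK]; rfl
    rw [hb', runs_seq]
    refine (runs_scanInit (d := d) (by simp; omega) (by simp [eM]; omega)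
      (by simp [eP]; omega) ?_).mono ?_
    · intro i hi
      simp [eM] at hi
      simp only [State.setVar_arr, eA]
      have h9 : σ.arr (slot 3 !d) i ≤ n := (h.item hi).2.2.2
      omega
    rintro _ t2 ⟨ht2, rfl⟩
    have hg' : max ((υ.setVar (aux 0) b).var (aux 0))
        (if (υ.setVar (aux 0) b).var (xP !d) < (υ.setVar (aux 0) b).var (xM !d) then
          (υ.setVar (aux 0) b).arr (aG !d) ((υ.setVar (aux 0) b).var (xP !d)) else 0) =
        max b g := by
      simp [eP, eM, eA, hgdef, State.finger]
    rw [hg', runs_seq]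
    refine (runs_scanLoop (d := d) (by simp [eL]; omega) (by simp [eL]; omega) ?_
      (by omega) (by simp [eT]; exact hlt)).mono ?_
    · intro v hv hvL
      simp [eL] at hvL
      simp only [State.setVar_arr, eA]
      exact (h.inv.full d v hv hvL).1.trans hlt
    rintro _ t3 ⟨w, rfl, ht3, hw1, hw2, hw3, hw4⟩
    simp [eL, eT, eA] at ht3 hw1 hw2 hw3 hw4
    refine (runs_scanValue (d := d) (by simp; omega) (by simp; omega)
      (by simp [eZ, eK]; omega)).mono ?_
    rintro _ t4 ⟨ht4, rfl⟩
    refine ⟨?_, ?_, ⟨?_, ?_, ?_, ?_⟩, ?_⟩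
    · simp; omega
    · exact ((((Frame.refl _ _ _).setVar _ (by simp)).setVar _ (by simp)).setVar _
        (by simp)).setVar _ (by simp)
    · simp; omega
    · simpa using hw2
    · simpa using hw3
    · simpa using hw4
    · simp [eK, eZ]
  · rintro d υ ω ⟨hP, hU⟩ hf'
    rw [hf'.1 6 d (by norm_num) (by simp), hf'.1 7 d (by norm_num) (by simp)]
    exact ⟨⟨hP, hU⟩, rfl⟩
  · rintro υ t ⟨ht, hf', hP⟩
    refine ⟨?_, hf', hP⟩
    simp only [Bool.not_true, Bool.not_false] at ht
    omega

end


/-! ### From the results of the phases to `Probe` -/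

theorem count_segment {T : ℕ → ℝ} {g : ℕ → Item} {p : ℕ} {s : ℝ}
    (h : ∀ i < p, T (g i).pos < s) (l : ℕ) :
    count T (segment g 0 p) l s = countGe (fun i => (g i).lab) p l := by
  induction p with
  | zero => simp [segment, countGe]
  | succ p ih =>
    rw [segment_snoc (Nat.zero_le p), count_append, ih fun i hi => h i (by omega), countGe_succ,
      count_cons, count_nil, zero_add]
    simp [h p (Nat.lt_succ_self p)]

/-- An arbitrary threshold `l` can be raised to the smallest occurring label that is at least `l`
without changing the count. -/
theorem Selected.le_of_countGe {k p z l : ℕ} {f : ℕ → ℕ} (h : Selected k f p z) (hk : 2 ≤ k)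
    (hl : k ≤ countGe f p l + 1) : l ≤ z := by
  have hne : ((Finset.range p).filter fun i => l ≤ f i).Nonempty := by
    have hpos : 0 < countGe f p l := by omega
    obtain ⟨i, hi, hl⟩ := List.countP_pos_iff.1 hpos
    exact ⟨i, by simpa using ⟨List.mem_range.1 hi, of_decide_eq_true hl⟩⟩
  obtain ⟨i, hi, hmin⟩ := Finset.exists_min_image _ f hne
  simp only [Finset.mem_filter, Finset.mem_range] at hi hmin
  have heq : countGe f p (f i) = countGe f p l := by
    unfold countGe
    refine List.countP_congr fun j hj => ?_
    simp only [decide_eq_true_eq]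
    exact ⟨fun hj' => hi.2.trans hj', fun hj' => hmin j ⟨List.mem_range.1 hj, hj'⟩⟩
  exact hi.2.trans (h.le i hi.1 (by omega))

/-- The items of the rows below given places. -/
def State.lower (σ : State) (p : Bool → ℕ) (d : Bool) : List Item := segment (σ.item d) 0 (p d)

/-- The items of the rows from given places on. -/
def State.upper (σ : State) (p : Bool → ℕ) (d : Bool) : List Item :=
  segment (σ.item d) (p d) (σ.var (xM d))

section

variable {n : ℕ} {S : Fin n → ℝ} {W k : ℕ} {σ τ : State} {p z w : Bool → ℕ} {d : Bool}

theorem State.upper_of_lt (h : p d < σ.var (xM d)) :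
    σ.upper p d = σ.item d (p d) :: segment (σ.item d) (p d + 1) (σ.var (xM d)) :=
  segment_cons h

theorem State.upper_of_le (h : σ.var (xM d) ≤ p d) : σ.upper p d = [] := segment_of_le h

theorem State.finger_eq : ((σ.upper p d).head?.map Item.fin).getD 0 = σ.finger d (p d) := by
  unfold State.finger
  split_ifs with h
  · rw [State.upper_of_lt h]
    rfl
  · rw [State.upper_of_le (not_lt.1 h)]
    rfl

theorem State.scanStart_eq :
    σ.data.scanStart k (σ.upper p) d = max (σ.data.base k d) (σ.finger (!d) (p (!d))) := by
  rw [Data.scanStart, State.finger_eq]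

namespace Ready

theorem finger_le (h : Ready S W k σ) (d : Bool) (i : ℕ) : σ.finger (!d) i ≤ σ.var (xL d) := by
  unfold State.finger
  split_ifs with hi
  · have h1 := h.inv.finger (!d) (σ.item (!d) i) (mem_segment.2 ⟨i, Nat.zero_le i, hi, rfl⟩)
    rw [Bool.not_not] at h1
    have h2 : σ.data.base k d ≤ σ.var (xL d) := by
      have : σ.data.base k d = min (σ.var (xL (!d))) (σ.var (xL d) - k) := rfl
      omega
    rcases h1 with h1 | h1
    · exact h1.trans h2
    · exact h1.1
  · exact Nat.zero_le _

theorem z_le (h : Ready S W k σ) {q y : ℕ} (hq : q ≤ σ.var (xM d))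
    (hz : Selected k (σ.arr (aL d)) q y) : y ≤ σ.var (xL (!d)) + 1 := by
  rcases hz.eq with rfl | ⟨i, hi, rfl, -⟩
  · exact Nat.zero_le _
  · exact (h.inv.item d (σ.item d i) (mem_segment.2 ⟨i, Nat.zero_le i, hi.trans_le hq, rfl⟩)).2.2

/-- The search place splits the row, with distinctness of the keys turning "not below" into "above".
Items above do not count towards the label selection, so counting in the row is `countGe` on the
lower part. -/
theorem probe (h : Ready S W k σ) (hp : ∀ d, Placed S σ d (p d))
    (hz : ∀ d, Selected k (σ.arr (aL d)) (p d) (z d))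
    (hw : ∀ d, Scanned S σ d (max (σ.data.base k d) (σ.finger (!d) (p (!d)))) (w d)) :
    Probe k (key S) (σ.var xT) σ.data (σ.lower p) (σ.upper p) z w := by
  have hk := h.three_le
  have hsplit : ∀ d, σ.data.R d = σ.lower p d ++ σ.upper p d := fun d =>
    (segment_append (Nat.zero_le _) (hp d).le).symm
  have habove : ∀ d, ∀ a ∈ σ.upper p d, key S d (σ.var xT) < key S d a.pos := by
    intro d a ha
    rcases Nat.lt_or_ge (p d) (σ.var (xM d)) with hlt | hge
    · have h1 : key S d (σ.var xT) < key S d (σ.item d (p d)).pos :=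
        lt_of_le_of_ne (not_lt.1 ((hp d).maximal hlt))
          (key_ne h.inj d (h.item hlt).1 h.lt).symm
      have h2 := (h.inv.sorted d).sublist
        (show (σ.upper p d).Sublist _ by rw [hsplit]; exact List.sublist_append_right _ _)
      rw [State.upper_of_lt hlt] at ha h2
      rcases List.mem_cons.1 ha with rfl | ha
      · exact h1
      · exact h1.trans ((List.pairwise_cons.1 h2).1 a ha)
    · rw [State.upper_of_le hge] at ha
      simp at ha
  have hcount : ∀ d l, count (key S d) (σ.data.R d) l (key S d (σ.var xT)) =
      countGe (σ.arr (aL d)) (p d) l := by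
    intro d l
    rw [hsplit, count_append, count_eq_zero (R := σ.upper p d) fun a ha => (habove d a ha).le,
      add_zero]
    exact count_segment (hp d).below l
  exact
    { split := hsplit
      below := by
        intro d a ha
        obtain ⟨i, -, hi, rfl⟩ := mem_segment.1 ha
        exact (hp d).below i hi
      above := habove
      le_z := by
        intro d l _ hl
        rw [hcount] at hl
        exact (hz d).le_of_countGe (by omega) hl
      z_spec := by
        intro d hd
        rcases (hz d).eq with h0 | ⟨i, -, hi, hc⟩
        · omega
        · rwa [hcount, hi]
      base_le := fun d => (le_max_left _ _).trans (hw d).start_le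
      finger_le := by
        intro d a ha
        refine le_trans ?_ ((le_max_right _ _).trans (hw d).start_le)
        rw [← State.finger_eq, ha]
        exact le_rfl
      w_le := fun d => (hw d).le
      scanned := by
        intro d
        rcases (hw d).low with h1 | h1
        · rcases max_choice (σ.data.base k d) (σ.finger (!d) (p (!d))) with h2 | h2
          · exact Or.inl (h1.trans h2)
          · rw [h2, ← State.finger_eq] at h1
            cases hh : (σ.upper p (!d)).head? with
            | none =>
              -- Without an upper item the finger defaults to `0`; the scan result is then `0`,
              -- which forces the base to be `0` too.
              left
              rw [hh] at h1
              have := (le_max_left _ _).trans (hw d).start_le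
              simp only [Option.map_none, Option.getD_none] at h1
              omega
            | some a =>
              rw [hh] at h1
              exact Or.inr (Or.inl ⟨a, rfl, h1⟩)
        · exact Or.inr (Or.inr h1)
      maximal := fun d hd => not_lt.1 ((hw d).maximal hd) }

end Ready

theorem Frame.row {X Y : List ℕ} (h : Frame X Y σ τ) (hX : xM d ∉ X) (hP : aP d ∉ Y)
    (hL : aL d ∉ Y) (hG : aG d ∉ Y) : τ.row d = σ.row d := by
  unfold State.row State.item
  rw [h.1 3 d (by norm_num) hX, h.2 1 d hP, h.2 2 d hL, h.2 3 d hG]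

/-! ### Updating the memory -/

/-- The treatment of the current position once its value is known. -/
def update : Cmd :=
  .seq (both fillValues) <| .seq (both newLabel) <| .seq (both newThreshold) <|
  .seq (both insertItem) <| .seq (both truncateRow) <|
  .seq (both fun d => .assign (xL d) (.var (xU d))) (.assign xT (.add (.var xT) (.const 1)))

/-- This bounds the number of cells of `F` to be overwritten. Since `z d ≤ L (!d) + 1`, the excess
of `z d + k - 1` over `w d` is at most `k` when the base is `L (!d)`; when the base is `L d - k`,
the excess of any new value is at most `k` plus the growth of `L d`. -/
theorem newValue_sub_le {A B : Bool → List Item}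
    (hp : Probe k (key S) (σ.var xT) σ.data A B z w) (hz : z d ≤ σ.var (xL (!d)) + 1) :
    newValue k (σ.data.base k d) (w d) (z d) - w d ≤
      k + 1 + ((σ.data.insert k (σ.var xT) A B z w).L d - σ.data.L d) := by
  have h1 : newValue k (σ.data.base k d) (w d) (z d) ≤
    (σ.data.insert k (σ.var xT) A B z w).L d := le_max_right _ _
  have h2 := hp.base_le d
  have h3 : σ.data.base k d = min (σ.var (xL (!d))) (σ.var (xL d) - k) := rfl
  have h4 : σ.data.L d = σ.var (xL d) := rfl
  have h5 : newValue k (σ.data.base k d) (w d) (z d) ≤ max (w d + 1) (z d + k - 1) := by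
    unfold newValue
    split_ifs <;> omega
  omega

/-- During the update `xL` keeps the old maxima while `xU` already holds the new ones, because the
new label needs both; `xL` is overwritten only at the end. -/
theorem Ready.runs_update (h : Ready S W k σ)
    (hf : Frame [xP true, xP false, xZ true, xZ false, xW true, xU true, xW false, xU false] [] σ τ)
    (hpl : ∀ d, p d ≤ σ.var (xM d)) (hz : ∀ d, z d ≤ σ.var (xL (!d)) + 1)
    (hp : Probe k (key S) (σ.var xT) σ.data (σ.lower p) (σ.upper p) z w)
    (eP : ∀ d, τ.var (xP d) = p d) (eW : ∀ d, τ.var (xW d) = w d)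
    (eU : ∀ d, τ.var (xU d) = newValue k (σ.data.base k d) (w d) (z d))
    {D : Data} (hD : D = σ.data.insert k (σ.var xT) (σ.lower p) (σ.upper p) z w) :
    Runs S W update τ fun υ t =>
      t ≤ 10 * (D.L true - σ.data.L true) + 10 * (D.L false - σ.data.L false) + 500 * k + 500 ∧
      υ.data = D.trim k ∧ υ.var xT = σ.var xT + 1 ∧ υ.var xK = k ∧ υ.var xN = σ.var xN := by
  have hk := h.three_le
  have hW := h.word
  have hlt := h.lt
  have hinv : Inv n k (key S) (3 * k + 1) (σ.var xT + 1) D :=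
    hD ▸ hp.insert hk h.lt key_not h.inv
  have hDL : ∀ d, D.L d = max (σ.var (xL d)) (τ.var (xU d)) := fun d => by rw [hD, eU]; rfl
  have hDn := hinv.L_le
  have eK : τ.var xK = k := by rw [hf.1 0 true (by norm_num) (by simp), h.eq_k]
  have eN : τ.var xN = σ.var xN := hf.1 0 false (by norm_num) (by simp)
  have eT : τ.var xT = σ.var xT := hf.1 1 false (by norm_num) (by simp)
  have eL : ∀ d, τ.var (xL d) = σ.var (xL d) := fun d => hf.1 2 d (by norm_num) (by simp)
  have eM : ∀ d, τ.var (xM d) = σ.var (xM d) := fun d => hf.1 3 d (by norm_num) (by simp)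
  have eA : ∀ i c, τ.arr (slot i c) = σ.arr (slot i c) := fun i c => hf.2 i c (by simp)
  have hwL : ∀ d, w d ≤ σ.var (xL d) := hp.w_le
  have hLn := h.L_le
  have hm := h.length_le
  have hfill : ∀ d, τ.var (xU d) - τ.var (xW d) ≤ k + 1 + (D.L d - σ.data.L d) := by
    intro d
    rw [eU, eW, hD]
    exact newValue_sub_le hp (hz d)
  unfold update
  rw [runs_seq]
  refine (runs_both (X := fun d => [xU d]) (Y := fun d => [aF d])
    (P := fun d υ => υ.var (xU d) = D.L d ∧ υ.arr (aF d) = D.F d)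
    (c := fun d _ => 10 * (k + 1 + (D.L d - σ.data.L d)) + 20) ?_ ?_).mono ?_
  · intro d υ hυ
    have e1 : υ.var (xU d) = τ.var (xU d) := hυ.1 7 d (by norm_num) (by simp)
    have e2 : υ.var (xW d) = τ.var (xW d) := hυ.1 6 d (by norm_num) (by simp)
    have e3 : υ.var (xL d) = σ.var (xL d) := (hυ.1 2 d (by norm_num) (by simp)).trans (eL d)
    have e4 : υ.var xT = σ.var xT := (hυ.1 1 false (by norm_num) (by simp)).trans eT
    have e5 : υ.arr (aF d) = σ.arr (aF d) := (hυ.2 0 d (by simp)).trans (eA 0 d)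
    have h1 := hDL d
    have h2 := hDn d
    have h3 := hwL d
    have h4 := hLn d
    have h5 := eW d
    have h6 := hfill d
    refine (runs_fillValues (by omega) (by omega) (by omega) (by omega)).mono ?_
    rintro ω t ⟨ht, hω, e6, e7⟩
    refine ⟨by rw [e1, e2] at ht; omega, hω, by rw [e6, e3, e1, h1], ?_⟩
    funext v
    rw [e7, e1, e2, e4, e5, eW, eU, hD]
    rfl
  · rintro d υ ω ⟨h1, h2⟩ hf'
    rw [hf'.1 7 d (by norm_num) (by simp), hf'.2 0 d (by simp)]
    exact ⟨⟨h1, h2⟩, rfl⟩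
  rintro σ4 t4 ⟨ht4, f4, h4⟩
  have f4' : Frame [xU true, xU false, xA true, xA false, xB true, xB false]
    [aF true, aF false] τ σ4 := f4.mono (by simp) (by simp)
  rw [runs_seq]
  refine (runs_both (X := fun d => [xA d]) (Y := fun _ => [])
    (P := fun d υ => υ.var (xA d) = max (D.L (!d)) (σ.var (xL (!d)) + 1))
    (c := fun _ _ => 12) ?_ ?_).mono ?_
  · intro d υ hυ
    have e1 : υ.var (xU (!d)) = D.L (!d) := by rw [hυ.1 7 (!d) (by norm_num) (by simp), (h4 _).1]
    have e2 : υ.var (xL (!d)) = σ.var (xL (!d)) := by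
      rw [hυ.1 2 (!d) (by norm_num) (by simp), f4.1 2 (!d) (by norm_num) (by simp), eL]
    have h1 := hDn (!d)
    have h2 := hLn (!d)
    refine (runs_newLabel (by omega) (by omega)).mono ?_
    rintro _ t ⟨ht, rfl⟩
    exact ⟨ht, (Frame.refl _ _ _).setVar _ (by simp), by simp [e1, e2]⟩
  · rintro d υ ω h1 hf'
    rw [hf'.1 8 d (by norm_num) (by simp)]
    exact ⟨h1, rfl⟩
  rintro σ5 t5 ⟨ht5, f5, h5⟩
  have f5' := f4'.trans (f5.mono (by simp) (by simp))
  rw [runs_seq]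
  refine (runs_both (X := fun d => [xB d]) (Y := fun _ => [])
    (P := fun d υ => υ.var (xB d) = D.threshold k d)
    (c := fun _ _ => 20) ?_ ?_).mono ?_
  · intro d υ hυ
    have e1 : ∀ c, υ.var (xU c) = D.L c := fun c => by
      rw [hυ.1 7 c (by norm_num) (by simp), f5.1 7 c (by norm_num) (by simp), (h4 _).1]
    have e2 : υ.var xK = k := by
      rw [hυ.1 0 true (by norm_num) (by simp), f5'.1 0 true (by norm_num) (by simp), eK]
    refine (runs_newThreshold (fun c => ?_) (by omega)).mono ?_
    · have := hDn c
      have := e1 c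
      omega
    rintro ω t ⟨ht, hω, h1⟩
    refine ⟨ht, hω, ?_⟩
    rw [h1, e1, e1, e2]
    rfl
  · rintro d υ ω h1 hf'
    rw [hf'.1 9 d (by norm_num) (by simp)]
    exact ⟨h1, rfl⟩
  rintro σ6 t6 ⟨ht6, f6, h6⟩
  have f6' := f5'.trans (f6.mono (by simp) (by simp))
  rw [runs_seq]
  refine (runs_both (X := fun d => [xM d]) (Y := fun d => [aP d, aL d, aG d])
    (P := fun d υ => υ.row d = D.R d)
    (c := fun _ _ => 75 * k + 40) ?_ ?_).mono ?_
  · intro d υ hυ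
    have e1 : υ.var (xM d) = σ.var (xM d) := by
      rw [hυ.1 3 d (by norm_num) (by simp), f6'.1 3 d (by norm_num) (by simp), eM]
    have e2 : υ.var (xP d) = p d := by
      rw [hυ.1 4 d (by norm_num) (by simp), f6'.1 4 d (by norm_num) (by simp), eP]
    have e3 : υ.var xT = σ.var xT := by
      rw [hυ.1 1 false (by norm_num) (by simp), f6'.1 1 false (by norm_num) (by simp), eT]
    have e4 : υ.var (xW (!d)) = w (!d) := by
      rw [hυ.1 6 (!d) (by norm_num) (by simp), f6'.1 6 (!d) (by norm_num) (by simp), eW]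
    have e5 : υ.var (xA d) = max (D.L (!d)) (σ.var (xL (!d)) + 1) := by
      rw [hυ.1 8 d (by norm_num) (by simp), f6.1 8 d (by norm_num) (by simp), h5]
    have e6 : ∀ i, 1 ≤ i → i ≤ 3 → υ.arr (slot i d) = σ.arr (slot i d) := fun i h1 h2 => by
      rw [hυ.2 i d (by simp), f6'.2 i d (by simp; omega), eA]
    have e7 : υ.item d = σ.item d := by
      funext i
      simp only [State.item, e6 1 le_rfl (by omega), e6 2 (by omega) (by omega),
        e6 3 (by omega) le_rfl]
    have h1 := hm d
    have h2 := hpl d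
    have h3 := hDn (!d)
    have h7 := hLn (!d)
    have h8 := hwL (!d)
    refine (runs_insertItem (by omega) (by omega) ?_ (by omega) (by omega) (by omega)).mono ?_
    · intro i hi
      rw [e6 2 (by omega) (by omega)]
      rw [e1] at hi
      have h9 : σ.arr (slot 2 d) i ≤ n + 1 := (h.item hi).2.2.1
      omega
    rintro ω t ⟨ht, hω, -, e8⟩
    refine ⟨by omega, hω, ?_⟩
    rw [e8, e7, e2, e3, e4, e5, e1, hD]
    rfl
  · rintro d υ ω h1 hf'
    exact ⟨(hf'.row (by simp) (by simp) (by simp) (by simp)).trans h1, rfl⟩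
  rintro σ7 t7 ⟨ht7, f7, h7⟩
  have hm7 : ∀ d, σ7.var (xM d) ≤ 3 * k + 1 := by
    intro d
    have := hinv.length d
    rw [← h7 d] at this
    simpa [State.row] using this
  rw [runs_seq]
  refine (runs_both (X := fun d => [xM d]) (Y := fun d => [aP d, aL d, aG d])
    (P := fun d υ => υ.row d = (D.trim k).R d)
    (c := fun _ _ => 120 * k + 80) ?_ ?_).mono ?_
  · intro d υ hυ
    have e1 : υ.var (xM d) = σ7.var (xM d) := hυ.1 3 d (by norm_num) (by simp)
    have e2 : υ.row d = D.R d :=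
      (hυ.row (by simp) (by simp) (by simp) (by simp)).trans (h7 d)
    have e3 : υ.var xK = k := by
      rw [hυ.1 0 true (by norm_num) (by simp), f7.1 0 true (by norm_num) (by simp),
        f6'.1 0 true (by norm_num) (by simp), eK]
    have e4 : υ.var (xB d) = D.threshold k d := by
      rw [hυ.1 9 d (by norm_num) (by simp), f7.1 9 d (by norm_num) (by simp), h6]
    have h1 := hm7 d
    have h2 := hDn d
    have h3 : D.threshold k d ≤ D.L d + 1 := by
      unfold Data.threshold Data.base
      omega
    refine (runs_truncateRow (by omega) (by omega) (by omega) ?_).mono ?_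
    · intro x hx
      rw [e2] at hx
      have h8 := hinv.item d x hx
      have h9 := hinv.fin_le hx
      have h10 := hDn (!d)
      omega
    rintro ω t ⟨ht, hω, e5⟩
    refine ⟨by omega, hω, ?_⟩
    rw [e5, e2, e3, e4]
    rfl
  · rintro d υ ω h1 hf'
    exact ⟨(hf'.row (by simp) (by simp) (by simp) (by simp)).trans h1, rfl⟩
  rintro σ8 t8 ⟨ht8, f8, h8⟩
  have f8' := f7.trans f8
  rw [runs_seq]
  refine (runs_both (X := fun d => [xL d]) (Y := fun _ => [])
    (P := fun d υ => υ.var (xL d) = D.L d) (c := fun _ _ => 2) ?_ ?_).mono ?_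
  · intro d υ hυ
    have e1 : υ.var (xU d) = D.L d := by
      rw [hυ.1 7 d (by norm_num) (by simp), f8'.1 7 d (by norm_num) (by simp),
        f6.1 7 d (by norm_num) (by simp), f5.1 7 d (by norm_num) (by simp), (h4 d).1]
    have h1 := hDn d
    rw [runs_assign]
    refine ⟨by simp only [Expr.Fits]; omega, le_rfl, (Frame.refl _ _ _).setVar _ (by simp), ?_⟩
    simpa [Expr.eval] using e1
  · rintro d υ ω h1 hf'
    rw [hf'.1 2 d (by norm_num) (by simp)]
    exact ⟨h1, rfl⟩
  rintro σ9 t9 ⟨ht9, f9, h9⟩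
  have e1 : σ9.var xT = σ.var xT := by
    rw [f9.1 1 false (by norm_num) (by simp), f8'.1 1 false (by norm_num) (by simp),
      f6'.1 1 false (by norm_num) (by simp), eT]
  rw [runs_assign]
  refine ⟨by simp [Expr.Fits, Expr.eval]; omega, ?_, ?_, ?_, ?_, ?_⟩
  · simp only [Expr.cost]
    omega
  · unfold State.data Data.trim
    congr 1
    · funext d
      simpa using h9 d
    · funext d
      rw [State.setVar_arr, f9.2 0 d (by simp), f8'.2 0 d (by simp), f6.2 0 d (by simp),
        f5.2 0 d (by simp), (h4 d).2]
    · funext d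
      rw [State.row_setVar (by simp), f9.row (by simp) (by simp) (by simp) (by simp), h8]
      rfl
  · simp [Expr.eval, e1]
  · rw [State.setVar_var, if_neg (by simp), f9.1 0 true (by norm_num) (by simp),
      f8'.1 0 true (by norm_num) (by simp), f6'.1 0 true (by norm_num) (by simp), eK]
  · rw [State.setVar_var, if_neg (by simp), f9.1 0 false (by norm_num) (by simp),
      f8'.1 0 false (by norm_num) (by simp), f6'.1 0 false (by norm_num) (by simp), eN]

end


/-! ### The main loop and the total running time -/

/-- The treatment of one position. -/
def advance : Cmd :=
  .seq (both fun d => findPlace d (aP d) (xM d) (xP d) xT) <|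
  .seq (both selectLabel) <| .seq (both scan) update

/-- The program that computes the length of a longest `k`-rollercoaster. -/
def longest : Cmd :=
  .seq (.loop (.lt (.var xT) (.var xN)) advance)
    (.ite (.lt (.var (xL true)) (.var (xL false))) (.assign xN (.var (xL false)))
      (.assign xN (.var (xL true))))

section

variable {n : ℕ} {S : Fin n → ℝ} {W k : ℕ} {σ : State}

theorem Ready.runs_advance (h : Ready S W k σ) :
    Runs S W advance σ fun τ t => ∃ A B z w, Probe k (key S) (σ.var xT) σ.data A B z w ∧
      τ.data = (σ.data.insert k (σ.var xT) A B z w).trim k ∧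
      τ.var xT = σ.var xT + 1 ∧ τ.var xK = k ∧ τ.var xN = σ.var xN ∧
      t ≤ 14 * (w true - σ.data.scanStart k B true) + 14 * (w false - σ.data.scanStart k B false) +
        10 * (τ.data.L true - σ.data.L true) + 10 * (τ.data.L false - σ.data.L false) +
        2000 * k ^ 2 := by
  have hk := h.three_le
  have hn : ∀ d, σ.var (xL d) ≤ n := h.L_le
  unfold advance
  rw [runs_seq]
  refine h.runs_findPlace.mono ?_
  rintro σ1 t1 ⟨ht1, f1, h1⟩
  rw [runs_seq]
  refine (h.runs_selectLabel f1 h1).mono ?_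
  rintro σ2 t2 ⟨ht2, f2, h2⟩
  have eP2 : ∀ d, σ2.var (xP d) = σ1.var (xP d) := fun d => f2.1 4 d (by norm_num) (by simp)
  have hz : ∀ d, σ2.var (xZ d) ≤ σ.var (xL (!d)) + 1 := fun d => h.z_le (h1 d).le (h2 d)
  have f2' : Frame [xP true, xP false, xZ true, xZ false] [] σ σ2 :=
    (f1.mono (by simp) (by simp)).trans (f2.mono (by simp) (by simp))
  rw [runs_seq]
  refine (h.runs_scan f2' (fun d => (eP2 d).trans_le (h1 d).le)
    (fun d => (hz d).trans (Nat.succ_le_succ (hn (!d)))) fun d => h.finger_le d _).mono ?_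
  rintro σ3 t3 ⟨ht3, f3, h3⟩
  simp only [eP2] at ht3 h3
  have eP3 : ∀ d, σ3.var (xP d) = σ1.var (xP d) := fun d =>
    (f3.1 4 d (by norm_num) (by simp)).trans (eP2 d)
  have hp := h.probe (p := fun d => σ1.var (xP d)) (z := fun d => σ2.var (xZ d))
    (w := fun d => σ3.var (xW d)) h1 h2 fun d => (h3 d).1
  refine (h.runs_update ((f2'.mono (by simp) (by simp)).trans (f3.mono (by simp) (by simp)))
    (fun d => (h1 d).le) hz hp eP3 (fun _ => rfl) (fun d => (h3 d).2) rfl).mono ?_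
  rintro υ t4 ⟨ht4, hdata, hT, hK, hN⟩
  refine ⟨_, _, _, _, hp, hdata, hT, hK, hN, ?_⟩
  rw [hdata, State.scanStart_eq, State.scanStart_eq]
  simp only [Bool.not_true, Bool.not_false]
  have hL : ∀ (D : Data) d, (D.trim k).L d = D.L d := fun _ _ => rfl
  rw [hL, hL]
  have hk2 : 3 * k ≤ k ^ 2 := by nlinarith
  omega

/-- The total potential. -/
def Data.energy (D : Data) (k : ℕ) : ℕ := D.potential k true + D.potential k false

/-- The time used by the first `t` iterations, up to the potential. -/
def State.budget (σ : State) (k : ℕ) : ℕ :=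
  3000 * k ^ 2 * σ.var xT + (84 * k + 60) * (σ.data.L true + σ.data.L false)

/-- A scan step costs `14`, hence the factor of the energy. Per unit of growth of some `L d`, the
energy terms give `14 * (2 * (3 * k + 1) + 1)` and filling gives `10`, within `84 * k + 60`. The
remaining `O(k ^ 2)` terms, including the loop test of cost `3`, fit into `3000 * k ^ 2`. -/
theorem Ready.runs_advance_amortized (h : Ready S W k σ) :
    Runs S W advance σ fun τ t => Inv n k (key S) (3 * k) (τ.var xT) τ.data ∧
      τ.var xT = σ.var xT + 1 ∧ τ.var xK = k ∧ τ.var xN = σ.var xN ∧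
      t + 4 + 14 * τ.data.energy k + σ.budget k ≤ 14 * σ.data.energy k + τ.budget k := by
  have hk := h.three_le
  refine h.runs_advance.mono ?_
  rintro τ t ⟨A, B, z, w, hp, hdata, hT, hK, hN, ht⟩
  set D := σ.data.insert k (σ.var xT) A B z w with hD
  have hinv : Inv n k (key S) (3 * k + 1) (σ.var xT + 1) D := hp.insert hk h.lt key_not h.inv
  refine ⟨by rw [hdata, hT]; exact hinv.trim hk, hT, hK, hN, ?_⟩
  have hL : ∀ d, (D.trim k).L d = D.L d := fun _ => rfl
  have h1 := hp.potential_insert_le hk h.inv true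
  have h2 := hp.potential_insert_le hk h.inv false
  have h3 := hinv.potential_trim_le hk true
  have h4 := hinv.potential_trim_le hk false
  have hle : ∀ d, σ.data.L d ≤ D.L d := fun d => le_max_left _ _
  obtain ⟨a, ha⟩ := Nat.exists_eq_add_of_le (hle true)
  obtain ⟨b, hb⟩ := Nat.exists_eq_add_of_le (hle false)
  rw [← hD] at h1 h2
  rw [hdata] at ht
  unfold Data.energy State.budget
  rw [hdata, hT]
  simp only [hL, Bool.not_true, Bool.not_false, ha, hb, Nat.add_sub_cancel_left] at *
  have hk2 : 3 * k ≤ k ^ 2 := by nlinarith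
  nlinarith

end

/-- The energy is `0` initially and never negative, so the elapsed time is bounded by the budget; in
the end both `L d` are at most `n`. -/
theorem exists_runs_longest {n k : ℕ} (hk : 3 ≤ k) {S : Fin n → ℝ} (hS : Function.Injective S) :
    Runs S ((n + k + 2) ^ 3) longest (initState n k) fun τ t =>
      IsLongestLength k S (τ.var 0) ∧ t ≤ 4000 * (max n 1 * k ^ 2) := by
  set W := (n + k + 2) ^ 3 with hWdef
  have hW : 8 * (n + k + 2) ≤ W := by
    rw [hWdef, pow_succ]
    -- Exponent `3` leaves room for the intermediate sums: `n + k + 2 ≥ 5`, so the word bound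
    -- exceeds every small multiple of `n + k + 2` that occurs.
    have : 5 ^ 2 ≤ (n + k + 2) ^ 2 := Nat.pow_le_pow_left (by omega) 2
    exact Nat.mul_le_mul_right _ (by omega)
  have hk2 : 3 * k ≤ k ^ 2 := by nlinarith
  unfold longest
  rw [runs_seq]
  refine Runs.loop (fun τ s => τ.var xT ≤ n ∧ τ.var xK = k ∧ τ.var xN = n ∧
    Inv n k (key S) (3 * k) (τ.var xT) τ.data ∧ s + 14 * τ.data.energy k ≤ τ.budget k)
    (fun τ => n - τ.var xT) ?_ ?_
  · refine ⟨by simp [initState, slot], by simp [initState, slot], by simp [initState, slot], ?_, ?_⟩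
    · have h1 : (initState n k).var xT = 0 := by simp [initState, slot]
      have h2 : (initState n k).data = ⟨fun _ => 0, fun _ _ => 0, fun _ => []⟩ := by
        unfold State.data
        congr 1
        · funext d
          cases d <;> simp [initState, slot]
        · funext d
          cases d <;> simp [State.row, initState, slot, segment]
      rw [h1, h2]
      exact inv_zero n k (key S) fun _ _ => 0
    · simp [State.budget, Data.energy, Data.potential, potential, State.data, State.row, initState,
        slot, segment]
  · rintro τ s ⟨hT, hK, hN, hinv, hs⟩
    refine ⟨by simp only [Test.Safe, Expr.Fits]; omega, fun hlt => ?_, fun hge => ?_⟩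
    · replace hlt : τ.var xT < n := by simpa [Test.Holds, Expr.eval, hN] using hlt
      have hr : Ready S W k τ := ⟨hS, hk, hK, hlt, hW, hinv⟩
      refine hr.runs_advance_amortized.mono ?_
      rintro υ t ⟨hinv', hT', hK', hN', ht⟩
      refine ⟨⟨by omega, hK', by omega, hinv', ?_⟩, by omega⟩
      simp only [Test.cost, Expr.cost]
      omega
    · have hT' : τ.var xT = n := by
        simp only [Test.Holds, Expr.eval] at hge
        omega
      rw [hT'] at hinv
      have hL : ∀ d, τ.var (xL d) ≤ n := hinv.L_le
      have hL1 := hL true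
      have hL2 := hL false
      have hlong : ∀ r, (∃ d, r = τ.var (xL d)) → (∀ d, τ.var (xL d) ≤ r) →
          IsLongestLength k S r := by
        rintro r ⟨d, hd⟩ hmax
        refine isLongestLength_of_reach hS (by omega) ?_ fun c x v hR =>
          (hinv.complete c x v hR.lt hR).trans (hmax c)
        rcases Nat.eq_zero_or_pos r with h0 | h0
        · exact Or.inl h0
        · obtain ⟨-, v, h1, h2⟩ := hinv.full d r h0 hd.le
          exact Or.inr ⟨d, _, v, h1, h2⟩
      have htime : s + 3 + 5 ≤ 4000 * (max n 1 * k ^ 2) := by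
        have h1 : τ.budget k ≤ 3000 * k ^ 2 * n + (84 * k + 60) * (2 * n) := by
          unfold State.budget
          rw [hT']
          have h2 : τ.data.L true + τ.data.L false ≤ 2 * n := by
            change τ.var (xL true) + τ.var (xL false) ≤ 2 * n
            omega
          have := Nat.mul_le_mul_left (84 * k + 60) h2
          omega
        have h3 : n ≤ max n 1 := le_max_left _ _
        have h4 : 1 ≤ max n 1 := le_max_right _ _
        have h5 : 3000 * k ^ 2 * n + (84 * k + 60) * (2 * n) ≤ 3200 * k ^ 2 * n := by nlinarith
        have h6 := Nat.mul_le_mul_left (k ^ 2) h3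
        have h7 := Nat.mul_le_mul_left (k ^ 2) h4
        nlinarith
      simp only [runs_ite, runs_assign, Test.Safe, Test.Holds, Test.cost, Expr.Fits, Expr.eval,
        Expr.cost]
      refine ⟨by omega, fun hlt => ⟨by omega, ?_, by omega⟩, fun hge => ⟨by omega, ?_, by omega⟩⟩
      · refine hlong _ ⟨false, by simp [slot]⟩ fun d => ?_
        cases d
        · exact le_rfl
        · exact hlt.le
      · refine hlong _ ⟨true, by simp [slot]⟩ fun d => ?_
        cases d
        · exact not_lt.1 hge
        · exact le_rfl

end Rollercoaster

theorem mainTheorem1 :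
    ∃ (P : Rollercoaster.Cmd) (c C : ℕ),
      (∀ k : ℕ, 3 ≤ k → ∀ (n : ℕ) (S : Fin n → ℝ), Function.Injective S →
        Rollercoaster.ComputesWithin P c k S (C * (max n 1 * k ^ 2))) ∧
      (∀ k : ℕ, 3 ≤ k → ∃ D : ℕ, ∀ (n : ℕ) (S : Fin n → ℝ), Function.Injective S →
        Rollercoaster.ComputesWithin P c k S (D * max n 1)) := by
  have key : ∀ k : ℕ, 3 ≤ k → ∀ (n : ℕ) (S : Fin n → ℝ), Function.Injective S →
      Rollercoaster.ComputesWithin Rollercoaster.longest 3 k S (4000 * (max n 1 * k ^ 2)) := by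
    intro k hk n S hS
    obtain ⟨τ, t, h, h1, h2⟩ := Rollercoaster.exists_runs_longest hk hS
    exact ⟨τ, t, h, h1, h2⟩
  -- For fixed `k` the factor `k ^ 2` is absorbed into the constant.
  refine ⟨_, 3, 4000, key, fun k hk => ⟨4000 * k ^ 2, fun n S hS => ?_⟩⟩
  convert key k hk n S hS using 1
  ring
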